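/- A \emph{mixed state} of dimension $d$ is a positive semidefinite matrix $\rho\in\mathbb{C}^{d\times d}$ with $\mathrm{Tr}\,\rho=1$, and $\|\cdot\|_1$ is the trace norm (the sum of the singular values). A \emph{POVM} is a finite family $\{M_z\}$ of positive semidefinite matrices with $\sum_z M_z=I_d$; measuring $\rho$ with it gives the outcome $z$ with probability $\mathrm{Tr}(\rho M_z)$. An \emph{algorithm that uses $n$ incoherent (possibly adaptive) measurements} measures $n$ copies of an unknown state one at a time, each with a POVM that may depend on the outcomes of the earlier measurements, and then outputs an answer determined by the sequence of the $n$ outcomes. It \emph{tests mixedness to error $\varepsilon$} if it answers "mixed" with probability at least $2/3$ when $\rho=\frac1d I_d$, and answers "far" with probability at least $2/3$ for every mixed state $\rho$ with $\|\rho-\frac1d I_d\|_1>\varepsilon$. \textbf{Theorem.} There are absolute constants $c,C>0$ and $d_0\in\mathbb{N}$ such that for all $d\ge d_0$ and all $0<\varepsilon\le 1/12$: (1) every algorithm that uses $n$ incoherent, possibly adaptive, measurements and tests mixedness to error $\varepsilon$ has $n\ge c\,d^{3/2}/\varepsilon^2$; (2) there are an $n\le C\,d^{3/2}/\varepsilon^2$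 and an algorithm that uses $n$ incoherent measurements and tests mixedness to error $\varepsilon$. Thus the copy complexity of mixedness testing with incoherent measurements is $\Theta(d^{3/2}/\varepsilon^2)$. -/

import Mathlib

namespace MixednessTesting

open scoped ComplexOrder

/-- A `d`-dimensional mixed state: a positive semidefinite complex matrix of trace one. -/
structure IsState {d : ℕ} (ρ : Matrix (Fin d) (Fin d) ℂ) : Prop where
  posSemidef : ρ.PosSemidef
  trace_eq_one : ρ.trace = 1

/-- The maximally mixed state `I / d`. -/
noncomputable def maximallyMixed (d : ℕ) : Matrix (Fin d) (Fin d) ℂ :=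
  ((d : ℂ)⁻¹) • (1 : Matrix (Fin d) (Fin d) ℂ)

/-- The trace norm `‖A‖₁ = Tr √(Aᴴ A)`: the sum of the singular values of `A`, which are the
square roots of the eigenvalues of `Aᴴ A`. -/
noncomputable def traceNorm {d : ℕ} (A : Matrix (Fin d) (Fin d) ℂ) : ℝ :=
  ∑ i, √((Matrix.isHermitian_conjTranspose_mul_self A).eigenvalues i)

/-- A positive operator valued measurement on `ℂ^d` with outcomes `0, …, k - 1`. -/
structure POVM (d k : ℕ) where
  /-- The positive semidefinite matrix of each outcome. -/
  effect : Fin k → Matrix (Fin d) (Fin d) ℂ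
  posSemidef : ∀ z, (effect z).PosSemidef
  sum_eq_one : ∑ z, effect z = 1

/-- The probability `Tr (ρ M_z)` of the outcome `z` when `ρ` is measured with `M`. -/
noncomputable def POVM.prob {d k : ℕ} (M : POVM d k) (ρ : Matrix (Fin d) (Fin d) ℂ)
    (z : Fin k) : ℝ :=
  (ρ * M.effect z).trace.re

/-- The two possible answers of a mixedness tester. -/
inductive Answer : Type
  | mixed
  | far
deriving DecidableEq

/-- A decision algorithm that uses exactly `n` incoherent, possibly adaptive, measurements, as a
rooted tree of depth `n`. Each inner node carries the POVM that is applied to the next copy of the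
unknown state and has one child for each outcome, so the later measurements may depend on all the
outcomes seen so far; each leaf carries the answer given after that sequence of outcomes. -/
inductive IncoherentAlgorithm (d : ℕ) : ℕ → Type
  | output (a : Answer) : IncoherentAlgorithm d 0
  | measure {n k : ℕ} (M : POVM d k) (next : Fin k → IncoherentAlgorithm d n) :
      IncoherentAlgorithm d (n + 1)

/-- The probability that the algorithm answers `a` when it is run on `n` copies of `ρ`, that is,
the total probability of the leaves with answer `a`, where the probability of a leaf is the product
of the probabilities `Tr (ρ M_z)` of the outcomes along the path from the root. -/
noncomputable def IncoherentAlgorithm.answerProb {d : ℕ} (ρ : Matrix (Fin d) (Fin d) ℂ)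
    (a : Answer) : {n : ℕ} → IncoherentAlgorithm d n → ℝ
  | _, .output b => if b = a then 1 else 0
  | _, .measure M next => ∑ z, M.prob ρ z * (next z).answerProb ρ a

/-- The algorithm distinguishes between `ρ = I / d` and `‖ρ - I / d‖₁ > ε` with probability at
least `2 / 3`: in either case it gives the right answer with at least this probability. -/
def IncoherentAlgorithm.TestsMixedness {d n : ℕ} (A : IncoherentAlgorithm d n) (ε : ℝ) : Prop :=
  2 / 3 ≤ A.answerProb (maximallyMixed d) .mixed ∧
    ∀ ρ : Matrix (Fin d) (Fin d) ℂ, IsState ρ → ε < traceNorm (ρ - maximallyMixed d) →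
      2 / 3 ≤ A.answerProb ρ .far

end MixednessTesting

/-! Lower bound. With `m = ⌊d/2⌋`, perturb `I/d` by a random `m × m` sign matrix `W` in the
off-diagonal blocks, scaled by `2ε/(d√m)`. A net argument bounds the operator norm of `W` by `11/2
√m` outside an exponentially small event, so the perturbation is usually a state. The fourth moment
of the singular values is small with probability at least `19/29`, and then the trace distance
exceeds `ε`. An outcome with effect `M` has likelihood ratio `1 + β⟨y, W⟩` against the maximally
mixed state, where `β = 4ε/√m` and `y` is twice-indexed: the real off-diagonal block of `M` divided
by `Tr M`, a vector of norm at most one. A leaf therefore only matters through its list of vectors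
`y`, and the chance of answering "mixed", averaged over good `W`, is a mean under the null
hypothesis of averaged products of such factors.

It is enough to bound this averaged likelihood ratio from below at typical leaves. The Gibbs
variational principle (Jensen's inequality after a change of measure to independent signs with means
`β ∑ y`) gives the lower bound `exp(β² ∑_{i<j} ⟨y_i, y_j⟩ - errors)`, less the contribution of the
bad `W`; this is `exp_sub_le_cubeMean_prod`. The errors are controlled by `alignSum` and
`quarticSum`. Under the null hypothesis the `y` are martingale differences with conditional
covariance at most `1/d` (`POVM.isIsotropicStep`), so the mean of `potential` is `O(n²/d + n)`
(`nullMean_potential_le`). Since `β⁴ n²/d` is of order `ε⁴n²/d³`, for `n` far below `d^{3/2}/ε²` the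
ratio is at least `9/10` at most leaves, and the tester cannot reject the hard states often enough.

Upper bound. Measure in a random basis: the computational one, or the Fourier basis with random
phases. The first sees the diagonal of `ρ - I/d`. For the second the deviation of the outcome law
from uniform is a vector-valued quadratic form in random signs, whose mean square is the
off-diagonal Frobenius mass over `d`. Hypercontractivity and Paley–Zygmund turn this mean into a
constant probability (`card_basisPOVM_ge`) that the squared `ℓ²` distance from uniform is at least
`ε²/(4d²)`. A collision test detects this with `O(d^{3/2}/ε²)` samples, and a constant number of
repetitions with fresh bases amplifies the gap. -/

namespace MixednessTesting

/-! ### Product measures on the cube `{-1, 1}^N` -/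

/-- The sign `±1` encoded by a Boolean. -/
noncomputable def sg (b : Bool) : ℝ := if b then 1 else -1

@[simp] lemma sg_true : sg true = 1 := rfl
@[simp] lemma sg_false : sg false = -1 := by simp [sg]

lemma sg_mul_self (b : Bool) : sg b * sg b = 1 := by cases b <;> simp

lemma sg_sq (b : Bool) : sg b ^ 2 = 1 := by cases b <;> simp

/-- The expectation of `f` when the coordinates are independent signs, with means `θ`. -/
noncomputable def cubeMean {N : ℕ} (θ : Fin N → ℝ) (f : (Fin N → Bool) → ℝ) : ℝ :=
  ∑ w, (∏ a, (1 + θ a * sg (w a)) / 2) * f w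

variable {N : ℕ}

lemma cubeMean_fin_zero (θ : Fin 0 → ℝ) (f : (Fin 0 → Bool) → ℝ) :
    cubeMean θ f = f Fin.elim0 := by
  simp only [cubeMean, Finset.univ_eq_empty, Finset.prod_empty, one_mul, Fintype.sum_unique]
  congr 1

lemma sum_fin_succ_fun {α β : Type*} [Fintype α] [AddCommMonoid β]
    (f : (Fin (N + 1) → α) → β) :
    ∑ w, f w = ∑ b, ∑ w : Fin N → α, f (Fin.cons b w) := by
  rw [← (Fin.consEquiv (fun _ : Fin (N + 1) => α)).sum_comp, Fintype.sum_prod_type]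
  rfl

lemma cubeMean_succ (θ : Fin (N + 1) → ℝ) (f : (Fin (N + 1) → Bool) → ℝ) :
    cubeMean θ f = (1 + θ 0) / 2 * cubeMean (Fin.tail θ) (fun w => f (Fin.cons true w)) +
      (1 - θ 0) / 2 * cubeMean (Fin.tail θ) (fun w => f (Fin.cons false w)) := by
  simp only [cubeMean, sum_fin_succ_fun, Fintype.sum_bool, Fin.prod_univ_succ, Fin.cons_zero,
    Fin.cons_succ, sg_true, sg_false, Finset.mul_sum, Fin.tail]
  congr 1 <;> refine Finset.sum_congr rfl fun w _ => ?_ <;> ring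

lemma cubeMean_add (θ : Fin N → ℝ) (f g : (Fin N → Bool) → ℝ) :
    cubeMean θ (fun w => f w + g w) = cubeMean θ f + cubeMean θ g := by
  simp [cubeMean, mul_add, Finset.sum_add_distrib]

lemma cubeMean_sub (θ : Fin N → ℝ) (f g : (Fin N → Bool) → ℝ) :
    cubeMean θ (fun w => f w - g w) = cubeMean θ f - cubeMean θ g := by
  simp [cubeMean, mul_sub, Finset.sum_sub_distrib]

lemma cubeMean_const_mul (θ : Fin N → ℝ) (c : ℝ) (f : (Fin N → Bool) → ℝ) :
    cubeMean θ (fun w => c * f w) = c * cubeMean θ f := by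
  simp only [cubeMean, Finset.mul_sum]
  exact Finset.sum_congr rfl fun w _ => by ring

lemma cubeMean_sum {ι : Type*} (s : Finset ι) (θ : Fin N → ℝ) (f : ι → (Fin N → Bool) → ℝ) :
    cubeMean θ (fun w => ∑ i ∈ s, f i w) = ∑ i ∈ s, cubeMean θ (f i) := by
  simp only [cubeMean, Finset.mul_sum]
  exact Finset.sum_comm

lemma cubeMean_const (θ : Fin N → ℝ) (c : ℝ) : cubeMean θ (fun _ => c) = c := by
  induction N with
  | zero => simp [cubeMean_fin_zero]
  | succ N ih => rw [cubeMean_succ, ih]; ring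

lemma cubeWeight_nonneg {θ : Fin N → ℝ} (hθ : ∀ a, |θ a| ≤ 1) (w : Fin N → Bool) :
    0 ≤ ∏ a, (1 + θ a * sg (w a)) / 2 := by
  refine Finset.prod_nonneg fun a _ => ?_
  have := abs_le.1 (hθ a)
  cases w a <;> simp <;> linarith

lemma cubeMean_mono {θ : Fin N → ℝ} (hθ : ∀ a, |θ a| ≤ 1) {f g : (Fin N → Bool) → ℝ}
    (h : ∀ w, f w ≤ g w) : cubeMean θ f ≤ cubeMean θ g :=
  Finset.sum_le_sum fun w _ => mul_le_mul_of_nonneg_left (h w) (cubeWeight_nonneg hθ w)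

lemma cubeMean_nonneg {θ : Fin N → ℝ} (hθ : ∀ a, |θ a| ≤ 1) {f : (Fin N → Bool) → ℝ}
    (h : ∀ w, 0 ≤ f w) : 0 ≤ cubeMean θ f :=
  Finset.sum_nonneg fun w _ => mul_nonneg (cubeWeight_nonneg hθ w) (h w)

lemma abs_zero_apply_le (a : Fin N) : |(0 : Fin N → ℝ) a| ≤ 1 := by simp

/-- The uniform mean is the average over the points of the cube. -/
lemma cubeMean_zero (f : (Fin N → Bool) → ℝ) :
    cubeMean 0 f = ((2 : ℝ) ^ N)⁻¹ * ∑ w, f w := by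
  simp [cubeMean, Finset.mul_sum]

/-- Change of measure between a tilted and the uniform mean. -/
lemma cubeMean_eq_zero_tilt (θ : Fin N → ℝ) (f : (Fin N → Bool) → ℝ) :
    cubeMean θ f = cubeMean 0 (fun w => (∏ a, (1 + θ a * sg (w a))) * f w) := by
  simp only [cubeMean]
  refine Finset.sum_congr rfl fun w _ => ?_
  simp [Finset.prod_div_distrib]
  ring

/-- Cauchy–Schwarz. -/
lemma cubeMean_mul_sq_le {θ : Fin N → ℝ} (hθ : ∀ a, |θ a| ≤ 1) (f g : (Fin N → Bool) → ℝ) :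
    cubeMean θ (fun w => f w * g w) ^ 2 ≤
      cubeMean θ (fun w => f w ^ 2) * cubeMean θ (fun w => g w ^ 2) := by
  have h := Finset.sum_mul_sq_le_sq_mul_sq Finset.univ
    (fun w => √(∏ a, (1 + θ a * sg (w a)) / 2) * f w)
    (fun w => √(∏ a, (1 + θ a * sg (w a)) / 2) * g w)
  have e := fun w => Real.sq_sqrt (cubeWeight_nonneg hθ w)
  simp only [mul_pow, e] at h
  refine le_trans (le_of_eq ?_) h
  congr 1
  refine Finset.sum_congr rfl fun w _ => ?_
  linear_combination (-f w * g w) * e w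

/-- Jensen's inequality for the exponential function. -/
lemma exp_cubeMean_le {θ : Fin N → ℝ} (hθ : ∀ a, |θ a| ≤ 1) (f : (Fin N → Bool) → ℝ) :
    Real.exp (cubeMean θ f) ≤ cubeMean θ (fun w => Real.exp (f w)) := by
  have h1 : ∑ w : Fin N → Bool, ∏ a, (1 + θ a * sg (w a)) / 2 = 1 := by
    simpa [cubeMean] using cubeMean_const θ 1
  have := convexOn_exp.map_sum_le (t := Finset.univ)
    (w := fun w : Fin N → Bool => ∏ a, (1 + θ a * sg (w a)) / 2) (p := f)
    (fun w _ => cubeWeight_nonneg hθ w) h1 (fun _ _ => Set.mem_univ _)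
  simpa [cubeMean] using this

/-- Markov's inequality for the uniform mean. -/
lemma cubeMean_ite_lt_le {f : (Fin N → Bool) → ℝ} (hf : ∀ w, 0 ≤ f w) {t : ℝ} (ht : 0 < t) :
    cubeMean 0 (fun w => if t < f w then (1 : ℝ) else 0) ≤ cubeMean 0 f / t := by
  rw [le_div_iff₀ ht, mul_comm, ← cubeMean_const_mul]
  refine cubeMean_mono abs_zero_apply_le fun w => ?_
  split_ifs with h
  · simpa using h.le
  · simpa using hf w

/-- A function that changes sign when one coordinate is flipped has mean zero. -/
lemma cubeMean_eq_zero_of_flip (a : Fin N) {f : (Fin N → Bool) → ℝ}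
    (h : ∀ w, f (Function.update w a (!w a)) = -f w) : cubeMean 0 f = 0 := by
  have hinv : Function.Involutive (fun w : Fin N → Bool => Function.update w a (!w a)) := by
    intro w; simp
  have := Equiv.sum_comp (hinv.toPerm _) f
  simp only [Function.Involutive.coe_toPerm, h, Finset.sum_neg_distrib] at this
  rw [cubeMean_zero, show ∑ w, f w = 0 by linarith, mul_zero]

lemma cubeMean_sum_mul_sg (θ c : Fin N → ℝ) :
    cubeMean θ (fun w => ∑ a, c a * sg (w a)) = ∑ a, c a * θ a := by
  induction N with
  | zero => simp [cubeMean_fin_zero]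
  | succ N ih =>
    simp only [cubeMean_succ, Fin.sum_univ_succ, Fin.cons_zero, Fin.cons_succ, cubeMean_add,
      cubeMean_const, ih, sg_true, sg_false, Fin.tail]
    ring

/-- Mean of a sum of functions of the single coordinates. -/
lemma cubeMean_sum_single (θ : Fin N → ℝ) (h : Fin N → ℝ → ℝ) :
    cubeMean θ (fun w => ∑ a, h a (sg (w a))) =
      ∑ a, ((1 + θ a) / 2 * h a 1 + (1 - θ a) / 2 * h a (-1)) := by
  induction N with
  | zero => simp [cubeMean_fin_zero]
  | succ N ih =>
    simp only [cubeMean_succ, Fin.sum_univ_succ, Fin.cons_zero, Fin.cons_succ, cubeMean_add,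
      cubeMean_const, sg_true, sg_false, ih _ (fun a => h a.succ)]
    simp only [Fin.tail]
    ring

/-- The centred linear form `∑ cₐ (wₐ - θₐ)`. -/
noncomputable def centered (θ c : Fin N → ℝ) (w : Fin N → Bool) : ℝ := ∑ a, c a * (sg (w a) - θ a)

lemma centered_cons (θ c : Fin (N + 1) → ℝ) (b : Bool) (w : Fin N → Bool) :
    centered θ c (Fin.cons b w) =
      c 0 * (sg b - θ 0) + centered (Fin.tail θ) (Fin.tail c) w := by
  simp [centered, Fin.sum_univ_succ, Fin.tail]

lemma cubeMean_centered (θ c : Fin N → ℝ) : cubeMean θ (centered θ c) = 0 := by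
  induction N with
  | zero => simp [cubeMean_fin_zero, centered]
  | succ N ih =>
    simp only [cubeMean_succ, centered_cons, cubeMean_add, cubeMean_const, ih, sg_true, sg_false]
    ring

lemma cubeMean_centered_sq (θ c : Fin N → ℝ) :
    cubeMean θ (fun w => centered θ c w ^ 2) = ∑ a, c a ^ 2 * (1 - θ a ^ 2) := by
  induction N with
  | zero => simp [cubeMean_fin_zero, centered]
  | succ N ih =>
    have e : ∀ b : Bool, cubeMean (Fin.tail θ) (fun w => centered θ c (Fin.cons b w) ^ 2) =
        (c 0 * (sg b - θ 0)) ^ 2 +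
          cubeMean (Fin.tail θ) (fun w => centered (Fin.tail θ) (Fin.tail c) w ^ 2) := by
      intro b
      simp only [centered_cons, add_sq, cubeMean_add, cubeMean_const, cubeMean_const_mul,
        cubeMean_centered]
      ring
    rw [cubeMean_succ, e, e, ih, Fin.sum_univ_succ]
    simp only [sg_true, sg_false, Fin.tail]
    ring

/-- Induction on the coordinates. On averaging over the new sign, the cubic moment of the rest drops
out because its coefficient is centred. The constant 4 leaves room for the biased fourth moment `(1
- θ²)(1 + 3θ²)`. -/
lemma cubeMean_centered_pow_four {θ : Fin N → ℝ} (hθ : ∀ a, |θ a| ≤ 1) (c : Fin N → ℝ) :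
    cubeMean θ (fun w => centered θ c w ^ 4) ≤ 4 * (∑ a, c a ^ 2) ^ 2 := by
  induction N with
  | zero => simp [cubeMean_fin_zero, centered]
  | succ N ih =>
    set A := ∑ a, Fin.tail c a ^ 2
    have hA : 0 ≤ A := Finset.sum_nonneg fun a _ => sq_nonneg _
    have hθ' : ∀ a, |Fin.tail θ a| ≤ 1 := fun a => hθ a.succ
    set S := centered (Fin.tail θ) (Fin.tail c)
    have e : ∀ b : Bool, cubeMean (Fin.tail θ) (fun w => centered θ c (Fin.cons b w) ^ 4) =
        (c 0 * (sg b - θ 0)) ^ 4 + 6 * (c 0 * (sg b - θ 0)) ^ 2 *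
          cubeMean (Fin.tail θ) (fun w => S w ^ 2) +
          4 * (c 0 * (sg b - θ 0)) * cubeMean (Fin.tail θ) (fun w => S w ^ 3) +
          cubeMean (Fin.tail θ) (fun w => S w ^ 4) := by
      intro b
      have : (fun w => centered θ c (Fin.cons b w) ^ 4) = fun w =>
          (c 0 * (sg b - θ 0)) ^ 4 + 6 * (c 0 * (sg b - θ 0)) ^ 2 * S w ^ 2 +
          4 * (c 0 * (sg b - θ 0)) * S w ^ 3 + S w ^ 4 + 4 * (c 0 * (sg b - θ 0)) ^ 3 * S w := by
        funext w; rw [centered_cons]; ring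
      rw [this]
      simp only [cubeMean_add, cubeMean_const, cubeMean_const_mul, S, cubeMean_centered]
      ring
    have h2 : cubeMean (Fin.tail θ) (fun w => S w ^ 2) ≤ A := by
      rw [cubeMean_centered_sq]
      refine Finset.sum_le_sum fun a _ => ?_
      nlinarith [sq_nonneg (Fin.tail c a), sq_nonneg (Fin.tail θ a),
        mul_nonneg (sq_nonneg (Fin.tail c a)) (sq_nonneg (Fin.tail θ a))]
    have h4 := ih hθ' (Fin.tail c)
    rw [cubeMean_succ, e, e, Fin.sum_univ_succ]
    simp only [sg_true, sg_false]
    change _ ≤ 4 * (c 0 ^ 2 + A) ^ 2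
    change cubeMean (Fin.tail θ) (fun w => S w ^ 4) ≤ 4 * A ^ 2 at h4
    have ht : θ 0 ^ 2 ≤ 1 := (sq_le_one_iff_abs_le_one _).2 (hθ 0)
    have k1 : (1 - θ 0 ^ 2) * (1 + 3 * θ 0 ^ 2) ≤ 4 := by nlinarith [sq_nonneg (θ 0)]
    have k2 : c 0 ^ 2 * (1 - θ 0 ^ 2) * cubeMean (Fin.tail θ) (fun w => S w ^ 2) ≤ c 0 ^ 2 * A := by
      have : 0 ≤ c 0 ^ 2 * θ 0 ^ 2 := by positivity
      calc _ ≤ c 0 ^ 2 * (1 - θ 0 ^ 2) * A :=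
            mul_le_mul_of_nonneg_left h2 (mul_nonneg (sq_nonneg _) (by linarith))
        _ ≤ c 0 ^ 2 * A := by nlinarith
    have k3 : c 0 ^ 4 * ((1 - θ 0 ^ 2) * (1 + 3 * θ 0 ^ 2)) ≤ c 0 ^ 4 * 4 :=
      mul_le_mul_of_nonneg_left k1 (by positivity)
    have k4 : 0 ≤ c 0 ^ 2 * A := by positivity
    nlinarith

/-- Signs are subgaussian: the mean factorises over the coordinates and `cosh c ≤ exp (c²/2)`. -/
lemma cubeMean_exp_le (c : Fin N → ℝ) :
    cubeMean 0 (fun w => Real.exp (∑ a, c a * sg (w a))) ≤ Real.exp ((∑ a, c a ^ 2) / 2) := by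
  induction N with
  | zero => simp [cubeMean_fin_zero]
  | succ N ih =>
    have h0 : Fin.tail (0 : Fin (N + 1) → ℝ) = 0 := rfl
    simp only [cubeMean_succ, Fin.sum_univ_succ, Fin.cons_zero, Fin.cons_succ, Real.exp_add,
      cubeMean_const_mul, sg_true, sg_false, h0]
    have := ih (Fin.tail c)
    simp only [Fin.tail] at this
    rw [add_div (c 0 ^ 2), Real.exp_add]
    refine le_trans (le_of_eq ?_) (mul_le_mul (Real.cosh_le_exp_half_sq (c 0)) this
      (cubeMean_nonneg abs_zero_apply_le fun w => (Real.exp_pos _).le) (Real.exp_pos _).le)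
    rw [Real.cosh_eq]
    simp
    ring

end MixednessTesting

namespace MixednessTesting

open Matrix

variable {N : ℕ}

/-! ### Statistics of a sequence of vectors -/

/-- The sum of the inner products of the pairs of entries of a list. -/
noncomputable def pairSum : List (Fin N → ℝ) → ℝ
  | [] => 0
  | y :: l => pairSum l + y ⬝ᵥ l.sum

/-- The sum of the squared inner products of the entries of a list with their sum. -/
noncomputable def alignSum (l : List (Fin N → ℝ)) : ℝ := (l.map fun y => (l.sum ⬝ᵥ y) ^ 2).sum

/-- The sum of the fourth powers of the coordinates of the sum of a list. -/
noncomputable def quarticSum (l : List (Fin N → ℝ)) : ℝ := ∑ a, l.sum a ^ 4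

lemma alignSum_nonneg (l : List (Fin N → ℝ)) : 0 ≤ alignSum l :=
  List.sum_nonneg (by simp only [List.mem_map]; rintro _ ⟨y, -, rfl⟩; positivity)

lemma quarticSum_nonneg (l : List (Fin N → ℝ)) : 0 ≤ quarticSum l :=
  Finset.sum_nonneg fun _ _ => by positivity

lemma dotProduct_self_nonneg' (x : Fin N → ℝ) : 0 ≤ x ⬝ᵥ x :=
  Finset.sum_nonneg fun _ _ => mul_self_nonneg _

lemma dotProduct_sq_le (x y : Fin N → ℝ) : (x ⬝ᵥ y) ^ 2 ≤ (x ⬝ᵥ x) * (y ⬝ᵥ y) := by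
  have := Finset.sum_mul_sq_le_sq_mul_sq Finset.univ x y
  simpa [dotProduct, sq] using this

lemma sum_dotProduct_self (l : List (Fin N → ℝ)) :
    l.sum ⬝ᵥ l.sum = (l.map fun y => y ⬝ᵥ y).sum + 2 * pairSum l := by
  induction l with
  | nil => simp [pairSum]
  | cons y l ih =>
    simp only [List.sum_cons, add_dotProduct, dotProduct_add, ih, List.map_cons, pairSum,
      dotProduct_comm l.sum y]
    ring

lemma list_sum_map_le {α : Type*} {f g : α → ℝ} {l : List α} (h : ∀ y ∈ l, f y ≤ g y) :
    (l.map f).sum ≤ (l.map g).sum := List.sum_le_sum h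

lemma list_sum_map_mul_left {α : Type*} (c : ℝ) (f : α → ℝ) (l : List α) :
    (l.map fun y => c * f y).sum = c * (l.map f).sum := by
  simp [List.sum_map_mul_left]

lemma list_sum_map_le_length {α : Type*} {f : α → ℝ} {l : List α} (h : ∀ y ∈ l, f y ≤ 1) :
    (l.map f).sum ≤ l.length := by
  simpa using list_sum_map_le (g := fun _ => (1 : ℝ)) h

lemma cubeMean_list_sum {α : Type*} (θ : Fin N → ℝ) (f : α → (Fin N → Bool) → ℝ) (l : List α) :
    cubeMean θ (fun w => (l.map fun y => f y w).sum) = (l.map fun y => cubeMean θ (f y)).sum := by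
  induction l with
  | nil => simp [cubeMean_const]
  | cons y l ih => simp [cubeMean_add, ih]

/-- The linear form on the cube with coefficients `y`. -/
noncomputable def linForm (y : Fin N → ℝ) (w : Fin N → Bool) : ℝ := ∑ a, y a * sg (w a)

lemma linForm_list_sum (l : List (Fin N → ℝ)) (w : Fin N → Bool) :
    linForm l.sum w = (l.map fun y => linForm y w).sum := by
  induction l with
  | nil => simp [linForm]
  | cons y l ih =>
    rw [List.map_cons, List.sum_cons, List.sum_cons, ← ih]
    simp [linForm, add_mul, Finset.sum_add_distrib]

lemma linForm_eq_centered (θ y : Fin N → ℝ) (w : Fin N → Bool) :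
    linForm y w = centered θ y w + θ ⬝ᵥ y := by
  simp only [linForm, centered, dotProduct, ← Finset.sum_add_distrib]
  exact Finset.sum_congr rfl fun a _ => by ring

lemma cubeMean_linForm (θ y : Fin N → ℝ) : cubeMean θ (linForm y) = θ ⬝ᵥ y := by
  rw [dotProduct_comm]
  exact cubeMean_sum_mul_sg θ y

lemma cubeMean_linForm_sq_le (θ y : Fin N → ℝ) :
    cubeMean θ (fun w => linForm y w ^ 2) ≤ y ⬝ᵥ y + (θ ⬝ᵥ y) ^ 2 := by
  simp only [linForm_eq_centered θ y, add_sq, cubeMean_add, cubeMean_const]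
  have : (fun w => 2 * centered θ y w * θ ⬝ᵥ y) = fun w => (2 * θ ⬝ᵥ y) * centered θ y w := by
    funext w; ring
  rw [this, cubeMean_const_mul, cubeMean_centered, cubeMean_centered_sq, mul_zero, add_zero]
  gcongr
  refine Finset.sum_le_sum fun a _ => ?_
  nlinarith [mul_nonneg (sq_nonneg (y a)) (sq_nonneg (θ a))]

lemma cubeMean_linForm_pow_four_le {θ : Fin N → ℝ} (hθ : ∀ a, |θ a| ≤ 1) (y : Fin N → ℝ) :
    cubeMean θ (fun w => linForm y w ^ 4) ≤ 8 * (4 * (y ⬝ᵥ y) ^ 2 + (θ ⬝ᵥ y) ^ 4) := by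
  calc _ ≤ cubeMean θ (fun w => 8 * (centered θ y w ^ 4 + (θ ⬝ᵥ y) ^ 4)) := by
        refine cubeMean_mono hθ fun w => ?_
        rw [linForm_eq_centered θ y]
        set x := centered θ y w
        set z := θ ⬝ᵥ y
        nlinarith [sq_nonneg (x - z), sq_nonneg (x ^ 2 - z ^ 2), sq_nonneg (x + z),
          mul_nonneg (sq_nonneg (x - z)) (add_nonneg (sq_nonneg x) (sq_nonneg z)),
          sq_nonneg ((x-z)^2), mul_nonneg (sq_nonneg (x-z)) (sq_nonneg (x+z))]
    _ ≤ _ := by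
        rw [cubeMean_const_mul, cubeMean_add, cubeMean_const]
        have := cubeMean_centered_pow_four hθ y
        simp only [dotProduct, ← sq] at this ⊢
        gcongr

/-! ### Scalar inequalities for the logarithm -/

/-- The Taylor remainder is `|x|³ / (1 - |x|)`, and `1 - |x| ≥ 1/12`. -/
lemma log_one_add_ge {x : ℝ} (hx : |x| ≤ 11 / 12) :
    x - x ^ 2 / 2 - 12 * |x| ^ 3 ≤ Real.log (1 + x) := by
  have h := Real.abs_log_sub_add_sum_range_le (x := -x) (by rw [abs_neg]; linarith) 2
  simp only [Finset.sum_range_succ, Finset.sum_range_zero, abs_neg, sub_neg_eq_add] at h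
  have h3 : |x| ^ 3 / (1 - |x|) ≤ 12 * |x| ^ 3 := by
    rw [div_le_iff₀ (by linarith)]
    nlinarith [pow_nonneg (abs_nonneg x) 3]
  have := (abs_le.1 (h.trans h3)).1
  norm_num at this
  nlinarith

/-- AM–GM trades the cubic remainder for even powers, whose means under a product measure are
computable. The parameter `δ` is free for later balancing. -/
lemma log_one_add_ge_quartic {x δ : ℝ} (hx : |x| ≤ 11 / 12) (hδ : 0 < δ) :
    x - x ^ 2 / 2 - (6 * δ * x ^ 2 + 6 / δ * x ^ 4) ≤ Real.log (1 + x) := by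
  refine le_trans ?_ (log_one_add_ge hx)
  have e : 6 * δ * x ^ 2 + 6 / δ * x ^ 4 - 12 * |x| ^ 3 = 6 / δ * (|x| * (δ - |x|)) ^ 2 := by
    have h2 : x ^ 2 = |x| ^ 2 := (sq_abs x).symm
    have h4 : x ^ 4 = |x| ^ 4 := by rw [show x ^ 4 = (x ^ 2) ^ 2 by ring, h2]; ring
    rw [h2, h4]
    field_simp
    ring
  have : 0 ≤ 6 / δ * (|x| * (δ - |x|)) ^ 2 := by positivity
  linarith

lemma log_one_add_le_cubic {t : ℝ} (ht : |t| ≤ 1 / 2) :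
    Real.log (1 + t) ≤ t - t ^ 2 / 2 + t ^ 3 / 3 + 2 * t ^ 4 := by
  have h := Real.abs_log_sub_add_sum_range_le (x := -t) (by rw [abs_neg]; linarith) 3
  simp only [Finset.sum_range_succ, Finset.sum_range_zero, abs_neg, sub_neg_eq_add] at h
  have h4 : t ^ 4 = |t| ^ 4 := by
    rw [show t ^ 4 = (t ^ 2) ^ 2 by ring, ← sq_abs t]; ring
  have h3 : |t| ^ 4 / (1 - |t|) ≤ 2 * |t| ^ 4 := by
    rw [div_le_iff₀ (by linarith)]
    nlinarith [pow_nonneg (abs_nonneg t) 4]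
  have := (abs_le.1 (h.trans h3)).2
  norm_num at this
  rw [h4]
  nlinarith

/-- The left side is the relative entropy of a sign of mean `t` to a fair sign. The odd terms of the
two expansions combine into even ones, leaving `t²/2` plus a quartic error. -/
lemma binary_relative_entropy_le {t : ℝ} (ht : |t| ≤ 1 / 2) :
    (1 + t) / 2 * Real.log (1 + t) + (1 - t) / 2 * Real.log (1 - t) ≤ t ^ 2 / 2 + 3 * t ^ 4 := by
  have h1 := log_one_add_le_cubic ht
  have h2 := log_one_add_le_cubic (t := -t) (by rwa [abs_neg])
  obtain ⟨ha, hb⟩ := abs_le.1 ht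
  have k1 := mul_le_mul_of_nonneg_left h1 (show 0 ≤ (1 + t) / 2 by linarith)
  have k2 := mul_le_mul_of_nonneg_left h2 (show 0 ≤ (1 - t) / 2 by linarith)
  rw [← sub_eq_add_neg] at k2
  nlinarith [sq_nonneg (t ^ 2)]

/-! ### A lower bound for an averaged likelihood ratio -/

/-- The mean over the cube of a product of factors `1 + β ⟨w, y⟩`, restricted to points `w` at
which these factors are bounded away from zero. -/
lemma exp_sub_le_cubeMean_prod {l : List (Fin N → ℝ)} {β δ b : ℝ} (hδ : 0 < δ) (hb : 0 ≤ b)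
    (hl : ∀ y ∈ l, y ⬝ᵥ y ≤ 1) (hθ : ∀ a, |β * l.sum a| ≤ 1 / 2)
    (good : (Fin N → Bool) → Prop) [DecidablePred good]
    (hgood : ∀ w, good w → ∀ y ∈ l, |β * linForm y w| ≤ 11 / 12)
    (hbad : cubeMean 0 (fun w => if good w then (0 : ℝ) else 1) ≤ b ^ 2) :
    Real.exp (β ^ 2 * pairSum l - 3 * (β ^ 4 * quarticSum l) - β ^ 4 * alignSum l / 2 -
        6 * δ * (β ^ 2 * l.length + β ^ 4 * alignSum l) -
        48 / δ * (β ^ 4 * (4 * l.length + β ^ 4 * (l.sum ⬝ᵥ l.sum) * alignSum l))) -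
      b * Real.exp (β ^ 2 * (l.sum ⬝ᵥ l.sum)) ≤
    cubeMean 0 (fun w => if good w then (l.map fun y => 1 + β * linForm y w).prod else 0) := by
  -- This tilt maximises the leading part `β⟨θ, ∑ y⟩ - |θ|²/2` of mean exponent minus entropy.
  set θ : Fin N → ℝ := β • l.sum with hθdef
  have hθ1 : ∀ a, |θ a| ≤ 1 / 2 := hθ
  have hθ2 : ∀ a, |θ a| ≤ 1 := fun a => (hθ1 a).trans (by norm_num)
  set ℓ : (Fin N → Bool) → ℝ := fun w => (l.map fun y => β * linForm y w -
    (β * linForm y w) ^ 2 / 2 -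
      (6 * δ * (β * linForm y w) ^ 2 + 6 / δ * (β * linForm y w) ^ 4)).sum with hℓ
  set D : (Fin N → Bool) → ℝ := fun w => ∏ a, (1 + θ a * sg (w a)) with hD
  have hfac : ∀ (w : Fin N → Bool) a, 0 < 1 + θ a * sg (w a) := by
    intro w a
    have := abs_le.1 (hθ1 a)
    cases w a <;> simp <;> linarith
  have hDpos : ∀ w, 0 < D w := fun w => Finset.prod_pos fun a _ => hfac w a
  -- the linear part dominates the exponent
  have hℓle : ∀ w, ℓ w ≤ linForm θ w := by
    intro w
    have e : linForm θ w = (l.map fun y => β * linForm y w).sum := by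
      rw [list_sum_map_mul_left, ← linForm_list_sum]
      simp [linForm, hθdef, Finset.mul_sum, mul_assoc]
    rw [e]
    refine list_sum_map_le fun y _ => ?_
    have : 0 ≤ 6 * δ * (β * linForm y w) ^ 2 + 6 / δ * (β * linForm y w) ^ 4 := by positivity
    nlinarith [sq_nonneg (β * linForm y w)]
  -- the good part
  have hgoodle : ∀ w, good w → Real.exp (ℓ w) ≤ (l.map fun y => 1 + β * linForm y w).prod := by
    intro w hw
    have hpos : ∀ y ∈ l, 0 < 1 + β * linForm y w := fun y hy => by
      have := abs_le.1 (hgood w hw y hy); linarith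
    have : (l.map fun y => 1 + β * linForm y w).prod =
        Real.exp ((l.map fun y => Real.log (1 + β * linForm y w)).sum) := by
      clear_value ℓ θ
      clear hℓ hℓle hgood hbad hθ hl hθdef
      induction l with
      | nil => simp
      | cons y l ih =>
        simp only [List.map_cons, List.prod_cons, List.sum_cons, Real.exp_add]
        rw [Real.exp_log (hpos y (by simp)), ih fun y hy => hpos y (by simp [hy])]
    rw [this]
    exact Real.exp_le_exp.2 (list_sum_map_le fun y hy =>
      log_one_add_ge_quartic (hgood w hw y hy) hδ)
  -- the bad part
  have hbadle : cubeMean 0 (fun w => (if good w then (0 : ℝ) else 1) * Real.exp (ℓ w)) ≤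
      b * Real.exp (β ^ 2 * (l.sum ⬝ᵥ l.sum)) := by
    have h1 : cubeMean 0 (fun w => (if good w then (0 : ℝ) else 1) * Real.exp (ℓ w)) ≤
        cubeMean 0 (fun w => (if good w then (0 : ℝ) else 1) * Real.exp (linForm θ w)) := by
      refine cubeMean_mono abs_zero_apply_le fun w => ?_
      have := Real.exp_le_exp.2 (hℓle w)
      split_ifs <;> simp <;> linarith [hℓle w]
    -- Cauchy–Schwarz separates the bad event, of mass at most `b²`, from the second exponential
    -- moment, which is at most `exp (2|θ|²)`.
    refine h1.trans (abs_le_of_sq_le_sq' ?_ (by positivity)).2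
    refine (cubeMean_mul_sq_le abs_zero_apply_le _ _).trans ?_
    rw [mul_pow]
    refine mul_le_mul (le_trans (le_of_eq ?_) hbad) ?_
      (cubeMean_nonneg abs_zero_apply_le fun w => by positivity) (by positivity)
    · congr 1; funext w; split_ifs <;> simp
    · have h2 := cubeMean_exp_le (fun a => 2 * θ a)
      have e1 : (fun w => Real.exp (linForm θ w) ^ 2) =
          fun w : Fin N → Bool => Real.exp (∑ a, 2 * θ a * sg (w a)) := by
        funext w
        rw [← Real.exp_nat_mul]
        simp [linForm, Finset.mul_sum, mul_assoc]
      rw [e1]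
      refine h2.trans (le_of_eq ?_)
      rw [← Real.exp_nat_mul]
      congr 1
      simp only [hθdef, dotProduct, Pi.smul_apply, smul_eq_mul, Finset.mul_sum, Finset.sum_div]
      refine Finset.sum_congr rfl fun a _ => ?_
      push_cast; ring
  -- Jensen's inequality for the tilted mean
  have hjensen : Real.exp (cubeMean θ (fun w => ℓ w - Real.log (D w))) ≤
      cubeMean 0 (fun w => Real.exp (ℓ w)) := by
    refine (exp_cubeMean_le hθ2 _).trans (le_of_eq ?_)
    rw [cubeMean_eq_zero_tilt]
    congr 1
    funext w
    rw [Real.exp_sub, Real.exp_log (hDpos w)]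
    exact mul_div_cancel₀ _ (hDpos w).ne'
  -- The relative entropy of the tilted product measure to the uniform one adds up over the
  -- coordinates.
  have hent : cubeMean θ (fun w => Real.log (D w)) ≤
      β ^ 2 * (l.sum ⬝ᵥ l.sum) / 2 + 3 * (β ^ 4 * quarticSum l) := by
    have e : (fun w => Real.log (D w)) = fun w : Fin N → Bool =>
        ∑ a, Real.log (1 + θ a * sg (w a)) := by
      funext w
      exact Real.log_prod fun a _ => (hfac w a).ne'
    rw [e, cubeMean_sum_single θ (fun a x => Real.log (1 + θ a * x))]
    have : β ^ 2 * (l.sum ⬝ᵥ l.sum) / 2 + 3 * (β ^ 4 * quarticSum l) =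
        ∑ a, (θ a ^ 2 / 2 + 3 * θ a ^ 4) := by
      simp only [quarticSum, dotProduct, Finset.mul_sum, Finset.sum_div, ← Finset.sum_add_distrib,
        hθdef, Pi.smul_apply, smul_eq_mul]
      exact Finset.sum_congr rfl fun a _ => by ring
    rw [this]
    refine Finset.sum_le_sum fun a _ => ?_
    simpa [← sub_eq_add_neg] using binary_relative_entropy_le (hθ1 a)
  have hexp : β ^ 2 * (l.sum ⬝ᵥ l.sum) - (1 / 2 + 6 * δ) *
      (β ^ 2 * (l.map fun y => y ⬝ᵥ y).sum + β ^ 4 * alignSum l) -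
      48 / δ * (β ^ 4 * (4 * l.length + β ^ 4 * (l.sum ⬝ᵥ l.sum) * alignSum l)) ≤
      cubeMean θ ℓ := by
    have hy : ∀ y ∈ l, β ^ 2 * (l.sum ⬝ᵥ y) - (1 / 2 + 6 * δ) *
        (β ^ 2 * (y ⬝ᵥ y) + β ^ 4 * (l.sum ⬝ᵥ y) ^ 2) -
        48 / δ * (β ^ 4 * (4 + β ^ 4 * (l.sum ⬝ᵥ l.sum) * (l.sum ⬝ᵥ y) ^ 2)) ≤
        cubeMean θ (fun w => β * linForm y w - (β * linForm y w) ^ 2 / 2 -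
          (6 * δ * (β * linForm y w) ^ 2 + 6 / δ * (β * linForm y w) ^ 4)) := by
      intro y hyl
      have e : (fun w => β * linForm y w - (β * linForm y w) ^ 2 / 2 -
          (6 * δ * (β * linForm y w) ^ 2 + 6 / δ * (β * linForm y w) ^ 4)) =
          fun w => β * linForm y w - ((1 / 2 + 6 * δ) * β ^ 2 * linForm y w ^ 2 +
            6 / δ * β ^ 4 * linForm y w ^ 4) := by funext w; ring
      rw [e, cubeMean_sub, cubeMean_add, cubeMean_const_mul, cubeMean_const_mul,
        cubeMean_const_mul, cubeMean_linForm]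
      have h2 := cubeMean_linForm_sq_le θ y
      have h4 := cubeMean_linForm_pow_four_le hθ2 y
      have ety : θ ⬝ᵥ y = β * (l.sum ⬝ᵥ y) := by rw [hθdef, smul_dotProduct, smul_eq_mul]
      rw [ety] at h2 h4 ⊢
      have hyy := hl y hyl
      have hyy0 := dotProduct_self_nonneg' y
      have hc := dotProduct_sq_le l.sum y
      have hX0 := dotProduct_self_nonneg' l.sum
      have hc' : (l.sum ⬝ᵥ y) ^ 2 ≤ l.sum ⬝ᵥ l.sum := hc.trans (by nlinarith)
      have h4' : cubeMean θ (fun w => linForm y w ^ 4) ≤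
          8 * (4 + β ^ 4 * (l.sum ⬝ᵥ l.sum) * (l.sum ⬝ᵥ y) ^ 2) := by
        refine h4.trans ?_
        have a1 : (y ⬝ᵥ y) ^ 2 ≤ 1 := by nlinarith
        -- Only one of the two factors `⟨∑ y, y⟩²` is bounded by `|∑ y|²`; the other is kept so that
        -- summing over the list gives `alignSum`.
        have a2 : (β * (l.sum ⬝ᵥ y)) ^ 4 ≤ β ^ 4 * (l.sum ⬝ᵥ l.sum) * (l.sum ⬝ᵥ y) ^ 2 := by
          rw [show (β * (l.sum ⬝ᵥ y)) ^ 4 = β ^ 4 * (l.sum ⬝ᵥ y) ^ 2 * (l.sum ⬝ᵥ y) ^ 2 by ring]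
          gcongr
        linarith
      have k2 := mul_le_mul_of_nonneg_left h2 (show 0 ≤ (1 / 2 + 6 * δ) * β ^ 2 by positivity)
      have k4 := mul_le_mul_of_nonneg_left h4' (show 0 ≤ 6 / δ * β ^ 4 by positivity)
      have e4 : 6 / δ * β ^ 4 * (8 * (4 + β ^ 4 * (l.sum ⬝ᵥ l.sum) * (l.sum ⬝ᵥ y) ^ 2)) =
        48 / δ * (β ^ 4 * (4 + β ^ 4 * (l.sum ⬝ᵥ l.sum) * (l.sum ⬝ᵥ y) ^ 2)) := by ring
      rw [e4] at k4
      have e2 : (1 / 2 + 6 * δ) * β ^ 2 * (y ⬝ᵥ y + (β * (l.sum ⬝ᵥ y)) ^ 2) =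
        (1 / 2 + 6 * δ) * (β ^ 2 * (y ⬝ᵥ y) + β ^ 4 * (l.sum ⬝ᵥ y) ^ 2) := by ring
      rw [e2] at k2
      have e1 : β * (β * (l.sum ⬝ᵥ y)) = β ^ 2 * (l.sum ⬝ᵥ y) := by ring
      rw [e1]
      linarith
    rw [hℓ, cubeMean_list_sum]
    refine le_trans (le_of_eq ?_) (list_sum_map_le hy)
    have esum : ∀ (x : Fin N → ℝ) (l' : List (Fin N → ℝ)),
        x ⬝ᵥ l'.sum = (l'.map fun y => x ⬝ᵥ y).sum := by
      intro x l'
      induction l' with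
      | nil => simp
      | cons y l' ih => simp [dotProduct_add, ih]
    have elin : ∀ (x : Fin N → ℝ) (p q r s u : ℝ) (l' : List (Fin N → ℝ)),
        (l'.map fun y => p * (x ⬝ᵥ y) - q * (r * (y ⬝ᵥ y) + s * (x ⬝ᵥ y) ^ 2) -
          u * (s * (4 + s * (x ⬝ᵥ x) * (x ⬝ᵥ y) ^ 2))).sum =
        p * (l'.map fun y => x ⬝ᵥ y).sum - q * (r * (l'.map fun y => y ⬝ᵥ y).sum +
          s * (l'.map fun y => (x ⬝ᵥ y) ^ 2).sum) -
          u * (s * (4 * l'.length + s * (x ⬝ᵥ x) * (l'.map fun y => (x ⬝ᵥ y) ^ 2).sum)) := by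
      intro x p q r s u l'
      induction l' with
      | nil => simp
      | cons y l' ih =>
        simp only [List.map_cons, List.sum_cons, ih, List.length_cons, Nat.cast_add, Nat.cast_one]
        ring
    rw [elin, ← esum, alignSum]
  have hsplit : cubeMean 0 (fun w => Real.exp (ℓ w)) -
      cubeMean 0 (fun w => (if good w then (0 : ℝ) else 1) * Real.exp (ℓ w)) ≤
      cubeMean 0 (fun w => if good w then (l.map fun y => 1 + β * linForm y w).prod else 0) := by
    rw [← cubeMean_sub]
    refine cubeMean_mono abs_zero_apply_le fun w => ?_
    split_ifs with hw
    · simpa using hgoodle w hw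
    · simp
  refine le_trans (sub_le_sub ?_ hbadle) hsplit
  refine le_trans (Real.exp_le_exp.2 ?_) hjensen
  rw [cubeMean_sub]
  have hself := sum_dotProduct_self l
  have hlen := list_sum_map_le_length hl
  have k1 : 6 * δ * (β ^ 2 * (l.map fun y => y ⬝ᵥ y).sum) ≤ 6 * δ * (β ^ 2 * l.length) := by
    gcongr
  -- The key cancellation: half of `β²|∑ y|²` goes to the entropy, the diagonal terms `|y|²` go to
  -- the quadratic term of the logarithm, and exactly `β²` times the off-diagonal pair sum survives.
  have k2 : β ^ 2 * (l.sum ⬝ᵥ l.sum) = β ^ 2 * (l.map fun y => y ⬝ᵥ y).sum +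
    2 * (β ^ 2 * pairSum l) := by rw [hself]; ring
  have e3 : (1 / 2 + 6 * δ) *
      (β ^ 2 * (l.map fun y => y ⬝ᵥ y).sum + β ^ 4 * alignSum l) =
      (β ^ 2 * (l.map fun y => y ⬝ᵥ y).sum) / 2 + β ^ 4 * alignSum l / 2 +
      6 * δ * (β ^ 2 * (l.map fun y => y ⬝ᵥ y).sum) + 6 * δ * (β ^ 4 * alignSum l) := by ring
  rw [e3] at hexp
  have e5 : 6 * δ * (β ^ 2 * l.length + β ^ 4 * alignSum l) =
    6 * δ * (β ^ 2 * l.length) + 6 * δ * (β ^ 4 * alignSum l) := by ring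
  rw [e5]
  linarith

end MixednessTesting

namespace MixednessTesting

open Matrix

variable {N : ℕ}

/-! ### The growth of the statistics under one random step -/

/-- A centred random vector of norm at most one, with covariance at most `κ`, that takes the value
`y z` with probability `p z`. -/
structure IsIsotropicStep {k : ℕ} (κ : ℝ) (p : Fin k → ℝ) (y : Fin k → Fin N → ℝ) : Prop where
  nonneg : ∀ z, 0 ≤ p z
  sum_eq_one : ∑ z, p z = 1
  norm_le : ∀ z, y z ⬝ᵥ y z ≤ 1
  mean_eq_zero : ∀ v, ∑ z, p z * (y z ⬝ᵥ v) = 0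
  cov_le : ∀ v, ∑ z, p z * (y z ⬝ᵥ v) ^ 2 ≤ κ * (v ⬝ᵥ v)

namespace IsIsotropicStep

variable {k : ℕ} {κ : ℝ} {p : Fin k → ℝ} {y : Fin k → Fin N → ℝ}

lemma mean_le_of_le (h : IsIsotropicStep κ p y) {f : Fin k → ℝ} {c : ℝ} (hf : ∀ z, f z ≤ c) :
    ∑ z, p z * f z ≤ c := by
  calc _ ≤ ∑ z, p z * c :=
        Finset.sum_le_sum fun z _ => mul_le_mul_of_nonneg_left (hf z) (h.nonneg z)
    _ = c := by rw [← Finset.sum_mul, h.sum_eq_one, one_mul]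

lemma mean_affine (h : IsIsotropicStep κ p y) (a b : ℝ) (v : Fin N → ℝ) :
    ∑ z, p z * (a + b * (y z ⬝ᵥ v)) = a := by
  have : ∀ z, p z * (a + b * (y z ⬝ᵥ v)) = p z * a + b * (p z * (y z ⬝ᵥ v)) := fun z => by ring
  simp only [this, Finset.sum_add_distrib, ← Finset.sum_mul, ← Finset.mul_sum, h.sum_eq_one,
    h.mean_eq_zero]
  ring

lemma mean_affine_sq_le (h : IsIsotropicStep κ p y) (a : ℝ) (v : Fin N → ℝ) :
    ∑ z, p z * (a + y z ⬝ᵥ v) ^ 2 ≤ a ^ 2 + κ * (v ⬝ᵥ v) := by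
  have : ∀ z, p z * (a + y z ⬝ᵥ v) ^ 2 =
      p z * (a ^ 2 + (2 * a) * (y z ⬝ᵥ v)) + p z * (y z ⬝ᵥ v) ^ 2 := fun z => by ring
  simp only [this, Finset.sum_add_distrib]
  rw [h.mean_affine]
  linarith [h.cov_le v]

lemma coord_sq_le (h : IsIsotropicStep κ p y) (a : Fin N) : ∑ z, p z * y z a ^ 2 ≤ κ := by
  simpa using h.cov_le (Pi.single a 1)

lemma coord_eq_zero (h : IsIsotropicStep κ p y) (a : Fin N) : ∑ z, p z * y z a = 0 := by
  simpa using h.mean_eq_zero (Pi.single a 1)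

lemma mean_sum_sq_le (h : IsIsotropicStep κ p y) (x : Fin N → ℝ) :
    ∑ z, p z * ((y z + x) ⬝ᵥ (y z + x)) ≤ x ⬝ᵥ x + 1 := by
  have e : ∀ z, p z * ((y z + x) ⬝ᵥ (y z + x)) =
      p z * (x ⬝ᵥ x + 2 * (y z ⬝ᵥ x)) + p z * (y z ⬝ᵥ y z) := by
    intro z
    simp only [add_dotProduct, dotProduct_add, dotProduct_comm x (y z)]
    ring
  simp only [e, Finset.sum_add_distrib]
  rw [h.mean_affine]
  linarith [h.mean_le_of_le h.norm_le]

/-- In each old term the new vector adds a centred variable of second moment at most `κ`. The one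
new term is at most `2⟨y, x⟩² + 2`, with `x` the old sum. -/
lemma mean_alignSum_le (h : IsIsotropicStep κ p y) (hκ : 0 ≤ κ) {l : List (Fin N → ℝ)}
    (hl : ∀ v ∈ l, v ⬝ᵥ v ≤ 1) :
    ∑ z, p z * alignSum (y z :: l) ≤
      alignSum l + κ * l.length + 2 * κ * (l.sum ⬝ᵥ l.sum) + 2 := by
  have h1 : ∀ (x : Fin N → ℝ) (l' : List (Fin N → ℝ)), (∀ v ∈ l', v ⬝ᵥ v ≤ 1) →
      ∑ z, p z * (l'.map fun v => ((y z + x) ⬝ᵥ v) ^ 2).sum ≤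
        (l'.map fun v => (x ⬝ᵥ v) ^ 2).sum + κ * l'.length := by
    intro x l' hl'
    induction l' with
    | nil => simp
    | cons v l' ih =>
      have ih' := ih fun v hv => hl' v (by simp [hv])
      have hv := mul_le_mul_of_nonneg_left (hl' v (by simp)) hκ
      have := h.mean_affine_sq_le (x ⬝ᵥ v) v
      simp only [List.map_cons, List.sum_cons, mul_add, Finset.sum_add_distrib, add_dotProduct,
        List.length_cons, Nat.cast_add, Nat.cast_one] at ih' ⊢
      simp only [add_comm (_ ⬝ᵥ v) (x ⬝ᵥ v)] at ih' ⊢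
      linarith
  have h2 : ∑ z, p z * ((y z + l.sum) ⬝ᵥ y z) ^ 2 ≤ 2 * κ * (l.sum ⬝ᵥ l.sum) + 2 := by
    have a : ∀ z, p z * ((y z + l.sum) ⬝ᵥ y z) ^ 2 ≤
        2 * (p z * (y z ⬝ᵥ l.sum) ^ 2) + p z * 2 := by
      intro z
      have hn := h.norm_le z
      have hn0 := dotProduct_self_nonneg' (y z)
      have : ((y z + l.sum) ⬝ᵥ y z) ^ 2 ≤ 2 * (y z ⬝ᵥ l.sum) ^ 2 + 2 := by
        rw [add_dotProduct, dotProduct_comm l.sum]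
        nlinarith [sq_nonneg (y z ⬝ᵥ y z - y z ⬝ᵥ l.sum)]
      nlinarith [h.nonneg z]
    refine (Finset.sum_le_sum fun z _ => a z).trans ?_
    rw [Finset.sum_add_distrib, ← Finset.mul_sum, ← Finset.sum_mul, h.sum_eq_one]
    linarith [h.cov_le l.sum]
  have := h1 l.sum l hl
  simp only [alignSum, List.sum_cons, List.map_cons, mul_add, Finset.sum_add_distrib]
  linarith

/-- Rests on `(x + y)⁴ ≤ x⁴ + 4x³y + 8x²y² + 3y⁴`, which is `2y²(x - y)² ≥ 0`; the term linear in
`y` has mean zero. -/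
lemma mean_quarticSum_le (h : IsIsotropicStep κ p y) (l : List (Fin N → ℝ)) :
    ∑ z, p z * quarticSum (y z :: l) ≤ quarticSum l + 8 * κ * (l.sum ⬝ᵥ l.sum) + 3 := by
  set x := l.sum with hx
  have a : ∀ z, p z * quarticSum (y z :: l) ≤ ∑ a, (x a ^ 4 * p z + 4 * x a ^ 3 * (p z * y z a) +
      8 * x a ^ 2 * (p z * y z a ^ 2)) + p z * 3 := by
    intro z
    have hq : ∑ a, y z a ^ 4 ≤ 1 := by
      have h0 : ∀ a, y z a ^ 2 ≤ 1 := fun a => by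
        have := Finset.single_le_sum (f := fun a => y z a * y z a)
          (fun a _ => mul_self_nonneg _) (Finset.mem_univ a)
        have h1 := h.norm_le z
        simp only [dotProduct] at h1
        nlinarith
      calc ∑ a, y z a ^ 4 ≤ ∑ a, y z a * y z a :=
            Finset.sum_le_sum fun a _ => by nlinarith [h0 a, sq_nonneg (y z a)]
        _ ≤ 1 := h.norm_le z
    have : quarticSum (y z :: l) ≤ ∑ a, (x a ^ 4 + 4 * x a ^ 3 * y z a +
        8 * x a ^ 2 * y z a ^ 2) + 3 := by
      have : quarticSum (y z :: l) ≤ ∑ a, (x a ^ 4 + 4 * x a ^ 3 * y z a +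
          8 * x a ^ 2 * y z a ^ 2 + 3 * y z a ^ 4) := by
        refine Finset.sum_le_sum fun a _ => ?_
        simp only [List.sum_cons, Pi.add_apply, ← hx]
        nlinarith [mul_nonneg (sq_nonneg (y z a)) (sq_nonneg (x a - y z a))]
      rw [Finset.sum_add_distrib, ← Finset.mul_sum] at this
      linarith
    refine (mul_le_mul_of_nonneg_left this (h.nonneg z)).trans (le_of_eq ?_)
    rw [mul_add, Finset.mul_sum]
    congr 1
    exact Finset.sum_congr rfl fun a _ => by ring
  refine (Finset.sum_le_sum fun z _ => a z).trans ?_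
  rw [Finset.sum_add_distrib, Finset.sum_comm, ← Finset.sum_mul, h.sum_eq_one]
  simp only [Finset.sum_add_distrib (s := (Finset.univ : Finset (Fin k))), ← Finset.mul_sum,
    h.sum_eq_one, h.coord_eq_zero]
  have : ∑ a, (x a ^ 4 * 1 + 4 * x a ^ 3 * 0 + 8 * x a ^ 2 * ∑ z, p z * y z a ^ 2) ≤
      ∑ a, (x a ^ 4 + 8 * κ * (x a * x a)) := by
    refine Finset.sum_le_sum fun a _ => ?_
    nlinarith [mul_le_mul_of_nonneg_left (h.coord_sq_le a) (sq_nonneg (x a))]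
  rw [Finset.sum_add_distrib (f := fun a => x a ^ 4), ← Finset.mul_sum] at this
  simp only [quarticSum, dotProduct]
  rw [← hx]
  linarith

end IsIsotropicStep

/-- The statistic of a list of vectors that controls the likelihood ratio. -/
noncomputable def potential (l : List (Fin N → ℝ)) : ℝ :=
  pairSum l ^ 2 + alignSum l + quarticSum l

lemma potential_nonneg (l : List (Fin N → ℝ)) : 0 ≤ potential l :=
  add_nonneg (add_nonneg (sq_nonneg _) (alignSum_nonneg l)) (quarticSum_nonneg l)

lemma potential_nil : potential ([] : List (Fin N → ℝ)) = 0 := by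
  simp [potential, pairSum, alignSum, quarticSum]

/-- The pair sum is a martingale whose increment has second moment at most `κ|x|²`, with `x` the
current sum. The coefficient 11 is `1 + 2 + 8`, one summand for each part of the potential. -/
lemma IsIsotropicStep.mean_potential_le {k : ℕ} {κ : ℝ} {p : Fin k → ℝ} {y : Fin k → Fin N → ℝ}
    (h : IsIsotropicStep κ p y) (hκ : 0 ≤ κ) {l : List (Fin N → ℝ)}
    (hl : ∀ v ∈ l, v ⬝ᵥ v ≤ 1) :
    ∑ z, p z * potential (y z :: l) ≤
      potential l + 11 * κ * (l.sum ⬝ᵥ l.sum) + κ * l.length + 5 := by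
  have h1 := h.mean_affine_sq_le (pairSum l) l.sum
  have h2 := h.mean_alignSum_le hκ hl
  have h3 := h.mean_quarticSum_le l
  simp only [potential, pairSum, mul_add, Finset.sum_add_distrib] at h1 h2 h3 ⊢
  linarith

end MixednessTesting

namespace MixednessTesting

open Matrix

variable {m : ℕ}

/-! ### Random sign matrices -/

/-- The sign matrix with the given array of signs. -/
noncomputable def signMatrix (w : Fin (m * m) → Bool) (i j : Fin m) : ℝ :=
  sg (w (finProdFinEquiv (i, j)))

/-- The outer product of two vectors, as a vector indexed by `Fin (m * m)`. -/
noncomputable def outer (u v : Fin m → ℝ) (a : Fin (m * m)) : ℝ :=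
  u (finProdFinEquiv.symm a).1 * v (finProdFinEquiv.symm a).2

lemma sum_fin_mul (f : Fin (m * m) → ℝ) : ∑ a, f a = ∑ i, ∑ j, f (finProdFinEquiv (i, j)) := by
  rw [← finProdFinEquiv.sum_comp, Fintype.sum_prod_type]

lemma outer_dotProduct_outer (u v : Fin m → ℝ) :
    outer u v ⬝ᵥ outer u v = (u ⬝ᵥ u) * (v ⬝ᵥ v) := by
  simp only [dotProduct, sum_fin_mul, outer, Equiv.symm_apply_apply, Finset.sum_mul_sum]
  exact Finset.sum_congr rfl fun i _ => Finset.sum_congr rfl fun j _ => by ring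

lemma linForm_outer (u v : Fin m → ℝ) (w : Fin (m * m) → Bool) :
    linForm (outer u v) w = ∑ i, ∑ j, u i * v j * signMatrix w i j := by
  simp only [linForm, sum_fin_mul, outer, Equiv.symm_apply_apply, signMatrix]

lemma outer_add_left (u u' v : Fin m → ℝ) : outer (u + u') v = outer u v + outer u' v := by
  ext a; simp [outer, add_mul]

lemma outer_add_right (u v v' : Fin m → ℝ) : outer u (v + v') = outer u v + outer u v' := by
  ext a; simp [outer, mul_add]

lemma outer_smul_left (c : ℝ) (u v : Fin m → ℝ) : outer (c • u) v = c • outer u v := by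
  ext a; simp [outer, mul_assoc]

lemma outer_smul_right (c : ℝ) (u v : Fin m → ℝ) : outer u (c • v) = c • outer u v := by
  ext a; simp [outer, mul_left_comm]

lemma linForm_add {N : ℕ} (x y : Fin N → ℝ) (w : Fin N → Bool) :
    linForm (x + y) w = linForm x w + linForm y w := by
  simp [linForm, add_mul, Finset.sum_add_distrib]

lemma linForm_smul {N : ℕ} (c : ℝ) (x : Fin N → ℝ) (w : Fin N → Bool) :
    linForm (c • x) w = c * linForm x w := by
  simp [linForm, Finset.mul_sum, mul_assoc]

lemma linForm_sq_le {N : ℕ} (x : Fin N → ℝ) (w : Fin N → Bool) :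
    linForm x w ^ 2 ≤ (x ⬝ᵥ x) * N := by
  have := Finset.sum_mul_sq_le_sq_mul_sq Finset.univ x (fun a => sg (w a))
  simpa [linForm, dotProduct, sg_sq, ← sq] using this

/-- Hoeffding's inequality. -/
lemma cubeMean_ite_lt_linForm_le {N : ℕ} {x : Fin N → ℝ} (hx : x ⬝ᵥ x ≤ 1) {t : ℝ} (ht : 0 ≤ t) :
    cubeMean 0 (fun w => if t < linForm x w then (1 : ℝ) else 0) ≤ Real.exp (-t ^ 2 / 2) := by
  calc cubeMean 0 (fun w => if t < linForm x w then (1 : ℝ) else 0)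
      ≤ cubeMean 0 (fun w => Real.exp (-t ^ 2) * Real.exp (∑ a, (t * x a) * sg (w a))) := by
        refine cubeMean_mono abs_zero_apply_le fun w => ?_
        split_ifs with h
        · rw [← Real.exp_add]
          apply Real.one_le_exp
          have : ∑ a, (t * x a) * sg (w a) = t * linForm x w := by
            simp [linForm, Finset.mul_sum, mul_assoc]
          rw [this]
          nlinarith
        · positivity
    _ ≤ Real.exp (-t ^ 2) * Real.exp ((∑ a, (t * x a) ^ 2) / 2) := by
        rw [cubeMean_const_mul]
        exact mul_le_mul_of_nonneg_left (cubeMean_exp_le _) (Real.exp_pos _).le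
    _ ≤ _ := by
        rw [← Real.exp_add]
        apply Real.exp_le_exp.2
        have : ∑ a, (t * x a) ^ 2 = t ^ 2 * (x ⬝ᵥ x) := by
          simp only [dotProduct, Finset.mul_sum]
          exact Finset.sum_congr rfl fun a _ => by ring
        rw [this]
        nlinarith [sq_nonneg t]

/-! ### A net of lattice points in the unit ball -/

/-- The integer points of the ball of radius `10 √m`. -/
noncomputable def latticeBall (m : ℕ) : Finset (Fin m → ℤ) :=
  (Fintype.piFinset fun _ => Finset.Icc (-(10 * m : ℤ)) (10 * m)).filter
    fun k => ∑ i, k i ^ 2 ≤ 100 * m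

lemma mem_latticeBall {k : Fin m → ℤ} : k ∈ latticeBall m ↔ ∑ i, k i ^ 2 ≤ 100 * m := by
  simp only [latticeBall, Finset.mem_filter, Fintype.mem_piFinset, Finset.mem_Icc,
    and_iff_right_iff_imp]
  intro h i
  have hm : (1 : ℤ) ≤ m := by exact_mod_cast i.pos
  have h1 : k i ^ 2 ≤ 100 * m :=
    (Finset.single_le_sum (f := fun i => k i ^ 2) (fun _ _ => sq_nonneg _)
      (Finset.mem_univ i)).trans h
  exact abs_le.1 (abs_le_of_sq_le_sq (by nlinarith) (by positivity))

lemma sum_Icc_pow_natAbs_le (B : ℕ) :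
    ∑ j ∈ Finset.Icc (-(B : ℤ)) B, (9 / 10 : ℝ) ^ j.natAbs ≤ 20 := by
  have hg : ∑ n ∈ Finset.range (B + 1), (9 / 10 : ℝ) ^ n ≤ 10 := by
    rw [geom_sum_eq (by norm_num), div_le_iff_of_neg (by norm_num)]
    have : (0 : ℝ) ≤ (9 / 10) ^ (B + 1) := by positivity
    linarith
  have hsub : Finset.Icc (-(B : ℤ)) B ⊆
      (Finset.range (B + 1)).image (fun n : ℕ => (n : ℤ)) ∪
        (Finset.range (B + 1)).image (fun n : ℕ => -(n : ℤ)) := by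
    intro j hj
    simp only [Finset.mem_Icc, Finset.mem_union, Finset.mem_image, Finset.mem_range] at hj ⊢
    rcases le_total 0 j with h | h
    · exact Or.inl ⟨j.natAbs, by omega, by omega⟩
    · exact Or.inr ⟨j.natAbs, by omega, by omega⟩
  calc _ ≤ ∑ j ∈ (Finset.range (B + 1)).image (fun n : ℕ => (n : ℤ)) ∪
        (Finset.range (B + 1)).image (fun n : ℕ => -(n : ℤ)), (9 / 10 : ℝ) ^ j.natAbs :=
        Finset.sum_le_sum_of_subset_of_nonneg hsub fun _ _ _ => by positivity
    _ ≤ ∑ j ∈ (Finset.range (B + 1)).image (fun n : ℕ => (n : ℤ)), (9 / 10 : ℝ) ^ j.natAbs +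
        ∑ j ∈ (Finset.range (B + 1)).image (fun n : ℕ => -(n : ℤ)), (9 / 10 : ℝ) ^ j.natAbs := by
        rw [← Finset.sum_union_inter]
        exact le_add_of_nonneg_right (Finset.sum_nonneg fun _ _ => by positivity)
    _ ≤ _ := by
        rw [Finset.sum_image (by intro a _ b _ h; simpa using h),
          Finset.sum_image (by intro a _ b _ h; simpa using h)]
        simp only [Int.natAbs_neg, Int.natAbs_natCast]
        linarith

/-- A generating function bound. By Cauchy–Schwarz a lattice point of the ball has `ℓ¹` norm at most
`10m`, so the weight `(10/9)^(10m) ∏ (9/10)^|kᵢ|` is at least one on it. Summing over all points of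
a box factorises, and `20 · (10/9)^10 ≤ 58`. -/
lemma card_latticeBall_le (m : ℕ) : ((latticeBall m).card : ℝ) ≤ 58 ^ m := by
  have h1 : ∀ k ∈ latticeBall m, (1 : ℝ) ≤ ((10 / 9) ^ 10) ^ m * ∏ i, (9 / 10 : ℝ) ^ (k i).natAbs := by
    intro k hk
    rw [mem_latticeBall] at hk
    rw [Finset.prod_pow_eq_pow_sum, ← pow_mul]
    have hle : ∑ i, (k i).natAbs ≤ 10 * m := by
      have hcs := Finset.sum_mul_sq_le_sq_mul_sq Finset.univ (fun i => ((k i).natAbs : ℤ))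
        (fun _ => (1 : ℤ))
      simp only [mul_one, Int.natCast_natAbs, sq_abs, one_pow, Finset.sum_const, Finset.card_univ,
        Fintype.card_fin, nsmul_eq_mul] at hcs
      have : (∑ i, |k i|) ≤ 10 * m := by
        refine (abs_le_of_sq_le_sq' ?_ (by positivity)).2
        nlinarith
      have e : ((∑ i, (k i).natAbs : ℕ) : ℤ) = ∑ i, |k i| := by simp
      omega
    calc (1 : ℝ) = (10 / 9) ^ (10 * m) * (9 / 10) ^ (10 * m) := by
          rw [← mul_pow]; norm_num
      _ ≤ _ := by
          gcongr ?_ * ?_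
          exact pow_le_pow_of_le_one (by norm_num) (by norm_num) hle
  calc ((latticeBall m).card : ℝ) = ∑ k ∈ latticeBall m, (1 : ℝ) := by simp
    _ ≤ ∑ k ∈ latticeBall m, ((10 / 9) ^ 10) ^ m * ∏ i, (9 / 10 : ℝ) ^ (k i).natAbs :=
        Finset.sum_le_sum h1
    _ ≤ ∑ k ∈ Fintype.piFinset fun _ : Fin m => Finset.Icc (-(10 * m : ℤ)) (10 * m),
          ((10 / 9) ^ 10) ^ m * ∏ i, (9 / 10 : ℝ) ^ (k i).natAbs :=
        Finset.sum_le_sum_of_subset_of_nonneg (Finset.filter_subset _ _) fun _ _ _ => by positivity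
    _ = ((10 / 9) ^ 10) ^ m *
          ∏ _i : Fin m, ∑ j ∈ Finset.Icc (-(10 * m : ℤ)) (10 * m), (9 / 10 : ℝ) ^ j.natAbs := by
        rw [Finset.prod_univ_sum, Finset.mul_sum]
    _ ≤ ((10 / 9) ^ 10) ^ m * 20 ^ m := by
        have := sum_Icc_pow_natAbs_le (10 * m)
        push_cast at this
        rw [Finset.prod_const, Finset.card_univ, Fintype.card_fin]
        gcongr
    _ ≤ 58 ^ m := by
        rw [← mul_pow]
        exact pow_le_pow_left₀ (by norm_num) (by norm_num) m

/-- The point of the net with the given integer coordinates. -/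
noncomputable def netPoint (k : Fin m → ℤ) (i : Fin m) : ℝ := k i / (10 * √m)

lemma netPoint_dotProduct_le {k : Fin m → ℤ} (hk : k ∈ latticeBall m) :
    netPoint k ⬝ᵥ netPoint k ≤ 1 := by
  rw [mem_latticeBall] at hk
  rcases Nat.eq_zero_or_pos m with rfl | hm
  · simp [dotProduct]
  have hk' : ∑ i, (k i : ℝ) ^ 2 ≤ 100 * m := by exact_mod_cast hk
  have hm' : (0 : ℝ) < m := by exact_mod_cast hm
  have e : netPoint k ⬝ᵥ netPoint k = (∑ i, (k i : ℝ) ^ 2) / (100 * m) := by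
    simp only [dotProduct, netPoint, Finset.sum_div]
    refine Finset.sum_congr rfl fun i _ => ?_
    rw [div_mul_div_comm, ← sq, mul_mul_mul_comm, Real.mul_self_sqrt hm'.le]
    norm_num
  rw [e, div_le_one (by positivity)]
  exact hk'

/-- Rounding towards zero: absolute values do not grow, so rounding the coordinates of a vector of
the ball stays in the ball. -/
lemma exists_int_abs_le (x : ℝ) : ∃ k : ℤ, |(k : ℝ)| ≤ |x| ∧ |x - k| ≤ 1 := by
  rcases le_total 0 x with h | h
  · refine ⟨⌊x⌋, ?_, ?_⟩
    · rw [abs_of_nonneg h, abs_of_nonneg (by exact_mod_cast Int.floor_nonneg.2 h)]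
      exact Int.floor_le x
    · rw [abs_le]; constructor <;> linarith [Int.floor_le x, Int.lt_floor_add_one x]
  · refine ⟨⌈x⌉, ?_, ?_⟩
    · have : (⌈x⌉ : ℝ) ≤ 0 := by exact_mod_cast Int.ceil_nonpos.2 h
      rw [abs_of_nonpos h, abs_of_nonpos this]
      linarith [Int.le_ceil x]
    · rw [abs_le]; constructor <;> linarith [Int.le_ceil x, Int.ceil_lt_add_one x]

/-- Every vector of the unit ball is within `1 / 10` of a point of the net. -/
lemma exists_netPoint_near (hm : 0 < m) {u : Fin m → ℝ} (hu : u ⬝ᵥ u ≤ 1) :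
    ∃ k ∈ latticeBall m, ∃ r : Fin m → ℝ, r ⬝ᵥ r ≤ 1 ∧ u = netPoint k + (1 / 10 : ℝ) • r := by
  have hm' : (0 : ℝ) < m := by exact_mod_cast hm
  have hs : 0 < √(m : ℝ) := Real.sqrt_pos.2 hm'
  have hss := Real.sq_sqrt hm'.le
  choose k hk1 hk2 using fun i => exists_int_abs_le (10 * √m * u i)
  refine ⟨k, ?_, fun i => 10 * (u i - netPoint k i), ?_, ?_⟩
  · rw [mem_latticeBall]
    have : ∑ i, (k i : ℝ) ^ 2 ≤ 100 * m := by
      calc _ ≤ ∑ i, (100 * m) * (u i * u i) := by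
            refine Finset.sum_le_sum fun i _ => ?_
            have := sq_le_sq.2 (hk1 i)
            rw [mul_pow, mul_pow, hss] at this
            nlinarith
        _ = 100 * m * (u ⬝ᵥ u) := by rw [← Finset.mul_sum]; rfl
        _ ≤ _ := mul_le_of_le_one_right (by positivity) hu
    exact_mod_cast this
  · calc _ ≤ ∑ _i : Fin m, (1 / m : ℝ) := by
          refine Finset.sum_le_sum fun i _ => ?_
          have e : 10 * (u i - netPoint k i) = (10 * √m * u i - k i) / √m := by
            simp only [netPoint]; field_simp
          have h2 : (10 * √m * u i - k i) ^ 2 ≤ 1 := (sq_le_one_iff_abs_le_one _).2 (hk2 i)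
          rw [← sq]
          beta_reduce
          rw [e, div_pow, hss]
          gcongr
      _ = 1 := by simp [hm'.ne']
  · ext i
    simp

/-! ### The operator norm of a random sign matrix -/

/-- The operator norm of the sign matrix is at most `11/2 √m`. -/
def OpBounded (w : Fin (m * m) → Bool) : Prop :=
  ∀ u v : Fin m → ℝ, u ⬝ᵥ u ≤ 1 → v ⬝ᵥ v ≤ 1 → linForm (outer u v) w ≤ 11 / 2 * √m

lemma opBounded_of_net (hm : 0 < m) {w : Fin (m * m) → Bool}
    (h : ∀ k ∈ latticeBall m, ∀ k' ∈ latticeBall m,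
      linForm (outer (netPoint k) (netPoint k')) w ≤ 22 / 5 * √m) : OpBounded w := by
  set S : Set ℝ := {x | ∃ u v : Fin m → ℝ, u ⬝ᵥ u ≤ 1 ∧ v ⬝ᵥ v ≤ 1 ∧ x = linForm (outer u v) w}
  have hne : S.Nonempty := ⟨0, 0, 0, by simp, by simp, by simp [linForm, outer]⟩
  have hbdd : BddAbove S := by
    refine ⟨m, ?_⟩
    rintro _ ⟨u, v, hu, hv, rfl⟩
    have h1 := linForm_sq_le (outer u v) w
    have h2 := dotProduct_self_nonneg' u
    have h3 := dotProduct_self_nonneg' v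
    rw [outer_dotProduct_outer] at h1
    refine (abs_le_of_sq_le_sq' (h1.trans ?_) (by positivity)).2
    push_cast
    have : (u ⬝ᵥ u) * (v ⬝ᵥ v) ≤ 1 := by nlinarith
    nlinarith [mul_self_nonneg (m : ℝ)]
  have hle : ∀ u v : Fin m → ℝ, u ⬝ᵥ u ≤ 1 → v ⬝ᵥ v ≤ 1 → linForm (outer u v) w ≤ sSup S :=
    fun u v hu hv => le_csSup hbdd ⟨u, v, hu, hv, rfl⟩
  -- Each of the two vectors is replaced by a net point at a cost of a tenth of the supremum, so `S
  -- ≤ 22/5 √m + S/5`, whence the constant `11/2`.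
  have hstep : sSup S ≤ 22 / 5 * √m + sSup S / 5 := by
    refine csSup_le hne ?_
    rintro _ ⟨u, v, hu, hv, rfl⟩
    obtain ⟨k, hk, r, hr, rfl⟩ := exists_netPoint_near hm hu
    obtain ⟨k', hk', r', hr', hv'⟩ := exists_netPoint_near hm hv
    rw [outer_add_left, linForm_add, outer_smul_left, linForm_smul]
    have a1 := hle r v hr hv
    have a2 := hle (netPoint k) r' (netPoint_dotProduct_le hk) hr'
    have a3 := h k hk k' hk'
    have e : linForm (outer (netPoint k) v) w =
        linForm (outer (netPoint k) (netPoint k')) w +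
          1 / 10 * linForm (outer (netPoint k) r') w := by
      rw [hv', outer_add_right, linForm_add, outer_smul_right, linForm_smul]
    rw [e]
    linarith
  intro u v hu hv
  linarith [hle u v hu hv]

-- Union bound over the at most `58^(2m)` pairs of net points, with Hoeffding's inequality for each.
-- The result is written as a square because Cauchy–Schwarz will later take its root.
open Classical in
lemma cubeMean_not_opBounded_le (hm : 0 < m) :
    cubeMean 0 (fun w : Fin (m * m) → Bool => if OpBounded w then (0 : ℝ) else 1) ≤
      Real.exp (-(m / 2)) ^ 2 := by
  have hm' : (0 : ℝ) < m := by exact_mod_cast hm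
  calc _ ≤ cubeMean 0 (fun w : Fin (m * m) → Bool => ∑ k ∈ latticeBall m, ∑ k' ∈ latticeBall m,
        if 22 / 5 * √m < linForm (outer (netPoint k) (netPoint k')) w then (1 : ℝ) else 0) := by
        refine cubeMean_mono abs_zero_apply_le fun w => ?_
        have h0 : ∀ k k' : Fin m → ℤ, (0 : ℝ) ≤
          if 22 / 5 * √m < linForm (outer (netPoint k) (netPoint k')) w then (1 : ℝ) else 0 :=
          fun k k' => by split_ifs <;> norm_num
        split_ifs with hw
        · exact Finset.sum_nonneg fun k _ => Finset.sum_nonneg fun k' _ => h0 k k'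
        · have := mt (opBounded_of_net hm) hw
          push Not at this
          obtain ⟨k, hk, k', hk', hlt⟩ := this
          calc (1 : ℝ) = if 22 / 5 * √m < linForm (outer (netPoint k) (netPoint k')) w
                then (1 : ℝ) else 0 := by rw [if_pos hlt]
            _ ≤ _ := Finset.single_le_sum (fun k' _ => h0 k k') hk'
            _ ≤ _ := Finset.single_le_sum
                (f := fun k => ∑ k' ∈ latticeBall m, if 22 / 5 * √m <
                  linForm (outer (netPoint k) (netPoint k')) w then (1 : ℝ) else 0)
                (fun k _ => Finset.sum_nonneg fun k' _ => h0 k k') hk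
    _ ≤ ∑ k ∈ latticeBall m, ∑ k' ∈ latticeBall m, Real.exp (-(22 / 5 * √m) ^ 2 / 2) := by
        rw [cubeMean_sum]
        refine Finset.sum_le_sum fun k hk => ?_
        rw [cubeMean_sum]
        refine Finset.sum_le_sum fun k' hk' => cubeMean_ite_lt_linForm_le ?_ (by positivity)
        rw [outer_dotProduct_outer]
        have h1 := netPoint_dotProduct_le hk
        have h2 := netPoint_dotProduct_le hk'
        have h3 := dotProduct_self_nonneg' (netPoint k)
        have h4 := dotProduct_self_nonneg' (netPoint k')
        nlinarith
    _ = ((latticeBall m).card : ℝ) ^ 2 * Real.exp (-(242 / 25)) ^ m := by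
        simp only [Finset.sum_const, nsmul_eq_mul, ← Real.exp_nat_mul]
        rw [← mul_assoc, ← sq]
        congr 2
        rw [mul_pow, Real.sq_sqrt hm'.le]
        ring
    _ ≤ (58 ^ m) ^ 2 * Real.exp (-(242 / 25)) ^ m := by
        gcongr
        exact card_latticeBall_le m
    _ = (3364 * Real.exp (-(242 / 25))) ^ m := by
        rw [mul_pow, ← pow_mul, mul_comm m 2, pow_mul]; norm_num
    _ ≤ Real.exp (-1) ^ m := by
        gcongr
        -- Here `3364 = 58²` and `217/25 = 242/25 - 1`, so the Hoeffding exponent beats the entropy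
        -- of the net by at least one per dimension.
        have h8 : (3364 : ℝ) ≤ Real.exp (217 / 25) := by
          have h1 : (2.7182818283 : ℝ) < Real.exp 1 := Real.exp_one_gt_d9
          have h2 : Real.exp (217 / 25) = Real.exp 1 ^ 8 * Real.exp (17 / 25) := by
            rw [← Real.exp_nat_mul, ← Real.exp_add]; norm_num
          have h3 : (17 / 25 : ℝ) + 1 ≤ Real.exp (17 / 25) := Real.add_one_le_exp _
          have h4 : (2.7 : ℝ) ^ 8 ≤ Real.exp 1 ^ 8 := by gcongr; linarith
          rw [h2]
          calc (3364 : ℝ) ≤ 2.7 ^ 8 * (17 / 25 + 1) := by norm_num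
            _ ≤ _ := by gcongr
        calc 3364 * Real.exp (-(242 / 25)) ≤ Real.exp (217 / 25) * Real.exp (-(242 / 25)) := by
              gcongr
          _ = Real.exp (-1) := by rw [← Real.exp_add]; norm_num
    _ = _ := by
        rw [← Real.exp_nat_mul, ← Real.exp_nat_mul]
        congr 1; push_cast; ring

/-! ### The fourth moment of the singular values of a random sign matrix -/

/-- `Tr ((W Wᵀ)²)` for the sign matrix `W`. -/
noncomputable def quarticTrace (w : Fin (m * m) → Bool) : ℝ :=
  ∑ i, ∑ k, (∑ j, signMatrix w i j * signMatrix w k j) ^ 2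

/-- After expanding the square, a product with distinct columns contains the sign at `(i, j)`
exactly once, so flipping it shows that the mean vanishes; the `m` diagonal products equal one. -/
lemma cubeMean_row_inner_sq {i k : Fin m} (hik : i ≠ k) :
    cubeMean 0 (fun w : Fin (m * m) → Bool =>
      (∑ j, signMatrix w i j * signMatrix w k j) ^ 2) = m := by
  have e : (fun w : Fin (m * m) → Bool => (∑ j, signMatrix w i j * signMatrix w k j) ^ 2) =
      fun w => ∑ j, ∑ j', signMatrix w i j * signMatrix w k j *
        (signMatrix w i j' * signMatrix w k j') := by
    funext w; rw [sq, Finset.sum_mul_sum]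
  rw [e, cubeMean_sum]
  have h : ∀ j j' : Fin m, cubeMean 0 (fun w : Fin (m * m) → Bool =>
      signMatrix w i j * signMatrix w k j * (signMatrix w i j' * signMatrix w k j')) =
      if j = j' then 1 else 0 := by
    intro j j'
    split_ifs with hj
    · subst hj
      have : (fun w : Fin (m * m) → Bool =>
          signMatrix w i j * signMatrix w k j * (signMatrix w i j * signMatrix w k j)) =
          fun _ => 1 := by
        funext w
        rw [mul_mul_mul_comm]
        simp [signMatrix, sg_mul_self]
      rw [this, cubeMean_const]
    · apply cubeMean_eq_zero_of_flip (finProdFinEquiv (i, j))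
      intro w
      have n1 : ∀ p : Fin m × Fin m, p ≠ (i, j) →
          Function.update w (finProdFinEquiv (i, j)) (!w (finProdFinEquiv (i, j)))
            (finProdFinEquiv p) = w (finProdFinEquiv p) := fun p hp =>
        Function.update_of_ne (fun hh => hp (finProdFinEquiv.injective hh)) _ _
      have hn : ∀ b : Bool, sg (!b) = -sg b := by intro b; cases b <;> simp
      simp only [signMatrix, Function.update_self]
      rw [n1 (k, j) (by simp [hik.symm]), n1 (i, j') (by simp [Ne.symm hj]),
        n1 (k, j') (by simp [hik.symm]), hn]
      ring
  simp only [cubeMean_sum, h]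
  simp

/-- The diagonal pairs of rows give `m³` deterministically and the others at most `m³` on average.
Markov's inequality is applied only to the random part, at the level `29/10 m³`. -/
lemma cubeMean_ite_quarticTrace_le (hm : 0 < m) :
    cubeMean 0 (fun w : Fin (m * m) → Bool =>
      if 39 / 10 * (m : ℝ) ^ 3 < quarticTrace w then (1 : ℝ) else 0) ≤ 10 / 29 := by
  have hm' : (0 : ℝ) < m := by exact_mod_cast hm
  set f : (Fin (m * m) → Bool) → ℝ := fun w => ∑ i, ∑ k, if i = k then 0 else
    (∑ j, signMatrix w i j * signMatrix w k j) ^ 2 with hf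
  have hf0 : ∀ w, 0 ≤ f w := fun w => Finset.sum_nonneg fun i _ => Finset.sum_nonneg fun k _ => by
    split_ifs <;> positivity
  have hq : ∀ w, quarticTrace w = m ^ 3 + f w := by
    intro w
    have : ∀ i k : Fin m, (∑ j, signMatrix w i j * signMatrix w k j) ^ 2 =
        (if i = k then (m : ℝ) ^ 2 else 0) + if i = k then 0 else
          (∑ j, signMatrix w i j * signMatrix w k j) ^ 2 := by
      intro i k
      split_ifs with h
      · subst h; simp [signMatrix, sg_mul_self]
      · simp
    simp only [quarticTrace, hf]
    rw [Finset.sum_congr rfl fun i _ => Finset.sum_congr rfl fun k _ => this i k]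
    simp only [Finset.sum_add_distrib]
    simp
    ring
  have hE : cubeMean 0 f ≤ m ^ 3 := by
    simp only [hf, cubeMean_sum]
    calc _ ≤ ∑ _i : Fin m, ∑ _k : Fin m, (m : ℝ) := by
          refine Finset.sum_le_sum fun i _ => Finset.sum_le_sum fun k _ => ?_
          split_ifs with h
          · rw [cubeMean_const]; positivity
          · rw [cubeMean_row_inner_sq h]
      _ = m ^ 3 := by simp; ring
  have e : (fun w : Fin (m * m) → Bool =>
      if 39 / 10 * (m : ℝ) ^ 3 < quarticTrace w then (1 : ℝ) else 0) =
      fun w => if 29 / 10 * (m : ℝ) ^ 3 < f w then (1 : ℝ) else 0 := by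
    funext w
    congr 1
    rw [hq, eq_iff_iff]
    constructor <;> intro h <;> linarith
  rw [e]
  refine (cubeMean_ite_lt_le hf0 (by positivity)).trans ?_
  rw [div_le_iff₀ (by positivity)]
  linarith

end MixednessTesting

namespace MixednessTesting

open Matrix
open scoped ComplexOrder

variable {d m : ℕ}

/-! ### Positive semidefinite matrices -/

lemma re_trace_conj_nonneg {M : Matrix (Fin d) (Fin d) ℂ} (hM : M.PosSemidef)
    (X : Matrix (Fin d) (Fin d) ℂ) : 0 ≤ (Xᴴ * M * X).trace.re :=
  (Complex.nonneg_iff.1 (hM.conjTranspose_mul_mul_same X).trace_nonneg).1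

lemma re_trace_nonneg {M : Matrix (Fin d) (Fin d) ℂ} (hM : M.PosSemidef) : 0 ≤ M.trace.re :=
  (Complex.nonneg_iff.1 hM.trace_nonneg).1

lemma trace_eq_ofReal_re {M : Matrix (Fin d) (Fin d) ℂ} (hM : M.PosSemidef) :
    M.trace = (M.trace.re : ℂ) := by
  apply Complex.ext
  · simp
  · simpa using (Complex.nonneg_iff.1 hM.trace_nonneg).2.symm

lemma eq_zero_of_re_trace_eq_zero {M : Matrix (Fin d) (Fin d) ℂ} (hM : M.PosSemidef)
    (h : M.trace.re = 0) : M = 0 :=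
  hM.trace_eq_zero_iff.1 (by rw [trace_eq_ofReal_re hM, h]; simp)

open scoped MatrixOrder in
lemma re_trace_mul_nonneg {A B : Matrix (Fin d) (Fin d) ℂ} (hA : A.PosSemidef)
    (hB : B.PosSemidef) : 0 ≤ (A * B).trace.re := by
  obtain ⟨C, rfl⟩ := CStarAlgebra.nonneg_iff_eq_star_mul_self.mp hA.nonneg
  have := re_trace_conj_nonneg hB Cᴴ
  rw [star_eq_conjTranspose]
  rwa [conjTranspose_conjTranspose, trace_mul_comm, ← mul_assoc] at this

/-- Cauchy–Schwarz for the form `(X, Y) ↦ Tr (Xᴴ M Y)`: the quadratic `Tr ((t - V)ᴴ M (t - V))` in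
real `t` is nonnegative, so its discriminant is not positive. -/
lemma re_trace_mul_sq_le {M : Matrix (Fin d) (Fin d) ℂ} (hM : M.PosSemidef)
    (V : Matrix (Fin d) (Fin d) ℂ) :
    (M * V).trace.re ^ 2 ≤ M.trace.re * (Vᴴ * M * V).trace.re := by
  have key : ∀ t : ℝ, 0 ≤ M.trace.re * (t * t) + (-2 * (M * V).trace.re) * t +
      (Vᴴ * M * V).trace.re := by
    intro t
    have h := re_trace_conj_nonneg hM ((t : ℂ) • 1 - V)
    have e : ((t : ℂ) • (1 : Matrix (Fin d) (Fin d) ℂ) - V)ᴴ * M * ((t : ℂ) • 1 - V) =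
        (t : ℂ) • (t : ℂ) • M - (t : ℂ) • (M * V) - (t : ℂ) • (M * V)ᴴ + Vᴴ * M * V := by
      rw [conjTranspose_mul, hM.1.eq]
      simp only [conjTranspose_sub, conjTranspose_smul, conjTranspose_one, sub_mul, mul_sub,
        smul_mul_assoc, mul_smul_comm, one_mul, mul_one, RCLike.star_def, Complex.conj_ofReal, smul_sub]
      abel
    rw [e] at h
    simp only [trace_add, trace_sub, trace_smul, trace_conjTranspose, Complex.add_re,
      Complex.sub_re, smul_eq_mul, Complex.re_ofReal_mul, RCLike.star_def, Complex.conj_re] at h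
    linarith
  have := discrim_le_zero key
  rw [discrim] at this
  nlinarith

/-- Nonnegativity of the `2 × 2` principal minor. -/
lemma re_apply_sq_le {M : Matrix (Fin d) (Fin d) ℂ} (hM : M.PosSemidef) (a b : Fin d) :
    (M a b).re ^ 2 ≤ (M a a).re * (M b b).re := by
  have h := (Complex.nonneg_iff.1 (hM.submatrix ![a, b]).det_nonneg).1
  have e : M b a = star (M a b) := (hM.1.apply b a).symm
  have ia : (M a a).im = 0 := (Complex.nonneg_iff.1 (hM.diag_nonneg (i := a))).2.symm
  rw [det_fin_two] at h
  simp [e, ia] at h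
  nlinarith [sq_nonneg (M a b).im]

lemma re_diag_nonneg {M : Matrix (Fin d) (Fin d) ℂ} (hM : M.PosSemidef) (a : Fin d) :
    0 ≤ (M a a).re := (Complex.nonneg_iff.1 (hM.diag_nonneg (i := a))).1

lemma sum_re_diag_le {M : Matrix (Fin d) (Fin d) ℂ} (hM : M.PosSemidef) {f : Fin m → Fin d}
    (hf : Function.Injective f) : ∑ i, (M (f i) (f i)).re ≤ M.trace.re := by
  rw [trace, Complex.re_sum, ← Finset.sum_image (f := fun a => (M a a).re) (g := f)
    (fun _ _ _ _ h => hf h)]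
  exact Finset.sum_le_sum_of_subset_of_nonneg (Finset.subset_univ _)
    fun a _ _ => re_diag_nonneg hM a

/-! ### The trace norm -/

lemma re_trace_sq_eq_sum_eigenvalues {H : Matrix (Fin d) (Fin d) ℂ} (hH : H.IsHermitian) :
    (H * H).trace.re = ∑ i, hH.eigenvalues i ^ 2 := by
  have h := hH.spectral_theorem
  set D : Matrix (Fin d) (Fin d) ℂ := diagonal (RCLike.ofReal ∘ hH.eigenvalues)
  have h2 : H * H = Unitary.conjStarAlgAut ℂ _ hH.eigenvectorUnitary (D * D) := by
    rw [map_mul, ← h]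
  rw [h2, Unitary.conjStarAlgAut_apply, trace_mul_comm, ← mul_assoc]
  simp only [Unitary.coe_star_mul_self, one_mul, D, diagonal_mul_diagonal, trace_diagonal,
    Complex.re_sum]
  refine Finset.sum_congr rfl fun i _ => ?_
  simp [← Complex.ofReal_mul, sq]

lemma re_trace_eq_sum_eigenvalues {H : Matrix (Fin d) (Fin d) ℂ} (hH : H.IsHermitian) :
    H.trace.re = ∑ i, hH.eigenvalues i := by
  rw [hH.trace_eq_sum_eigenvalues, Complex.re_sum]
  simp

/-- The trace norm is bounded below by means of the second and the fourth Schatten norm. -/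
lemma le_traceNorm (A : Matrix (Fin d) (Fin d) ℂ) {v : ℝ} (hv : 0 < v) :
    3 / (2 * v) * (Aᴴ * A).trace.re - 1 / (2 * v ^ 3) * (Aᴴ * A * (Aᴴ * A)).trace.re ≤
      traceNorm A := by
  have hH := isHermitian_conjTranspose_mul_self A
  have h0 : ∀ i, 0 ≤ hH.eigenvalues i := (posSemidef_conjTranspose_mul_self A).eigenvalues_nonneg
  rw [re_trace_sq_eq_sum_eigenvalues hH, re_trace_eq_sum_eigenvalues hH, traceNorm,
    Finset.mul_sum, Finset.mul_sum, ← Finset.sum_sub_distrib]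
  refine Finset.sum_le_sum fun i _ => ?_
  set u := √(hH.eigenvalues i) with hu
  have hu0 : 0 ≤ u := Real.sqrt_nonneg _
  rw [← Real.sq_sqrt (h0 i), ← hu]
  -- The scalar inequality is tangent to the identity at `u = v` and vanishes at zero; the
  -- difference factorises with a double root at `v`.
  have e : u - (3 / (2 * v) * u ^ 2 - 1 / (2 * v ^ 3) * (u ^ 2) ^ 2) =
      u * ((u - v) ^ 2 * (u + 2 * v)) / (2 * v ^ 3) := by
    field_simp
    ring
  have : 0 ≤ u * ((u - v) ^ 2 * (u + 2 * v)) / (2 * v ^ 3) := by positivity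
  linarith

/-- The trace norm is at most `√d` times the Frobenius norm. -/
lemma traceNorm_sq_le (A : Matrix (Fin d) (Fin d) ℂ) :
    traceNorm A ^ 2 ≤ d * (Aᴴ * A).trace.re := by
  have hH := isHermitian_conjTranspose_mul_self A
  have h0 : ∀ i, 0 ≤ hH.eigenvalues i := (posSemidef_conjTranspose_mul_self A).eigenvalues_nonneg
  have := Finset.sum_mul_sq_le_sq_mul_sq Finset.univ (fun _ => (1 : ℝ))
    (fun i => √(hH.eigenvalues i))
  simp only [one_mul, one_pow, Finset.sum_const, Finset.card_univ, Fintype.card_fin, nsmul_eq_mul,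
    mul_one, Real.sq_sqrt (h0 _)] at this
  rwa [re_trace_eq_sum_eigenvalues hH]

/-! ### Off-diagonal blocks -/

/-- The `i`-th coordinate of the first block. -/
def lo (h : 2 * m ≤ d) (i : Fin m) : Fin d := ⟨i, by omega⟩

/-- The `i`-th coordinate of the second block. -/
def hi (h : 2 * m ≤ d) (i : Fin m) : Fin d := ⟨m + i, by omega⟩

lemma lo_injective (h : 2 * m ≤ d) : Function.Injective (lo h) := fun i j hij => by
  simpa [lo, Fin.ext_iff] using hij

lemma hi_injective (h : 2 * m ≤ d) : Function.Injective (hi h) := fun i j hij => by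
  simpa [hi, Fin.ext_iff] using hij

lemma lo_ne_hi (h : 2 * m ≤ d) (i j : Fin m) : lo h i ≠ hi h j := by
  simp only [lo, hi, ne_eq, Fin.ext_iff]
  omega

/-- The inclusion of the coordinates in the range of `f`. -/
noncomputable def inclusion (f : Fin m → Fin d) : Matrix (Fin d) (Fin m) ℂ :=
  (1 : Matrix (Fin d) (Fin d) ℂ).submatrix id f

lemma inclusion_conj_mul_mul (f g : Fin m → Fin d) (M : Matrix (Fin d) (Fin d) ℂ) :
    (inclusion f)ᴴ * M * inclusion g = M.submatrix f g := by
  ext i j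
  simp [inclusion, mul_apply, one_apply, Finset.sum_ite_eq]

lemma inclusion_conj_mul_self {f : Fin m → Fin d} (hf : Function.Injective f) :
    (inclusion f)ᴴ * inclusion f = 1 := by
  have := inclusion_conj_mul_mul f f 1
  rw [Matrix.mul_one] at this
  rw [this]
  exact submatrix_one f hf

lemma inclusion_conj_mul_of_ne {f g : Fin m → Fin d} (h : ∀ i j, f i ≠ g j) :
    (inclusion f)ᴴ * inclusion g = 0 := by
  have := inclusion_conj_mul_mul f g 1
  rw [Matrix.mul_one] at this
  rw [this]
  ext i j
  simp [h i j]

/-- A real vector indexed by `Fin (m * m)` as a complex matrix. -/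
noncomputable def toMatrix (v : Fin (m * m) → ℝ) : Matrix (Fin m) (Fin m) ℂ :=
  Matrix.of fun i j => (v (finProdFinEquiv (i, j)) : ℂ)

lemma toMatrix_conjTranspose (v : Fin (m * m) → ℝ) : (toMatrix v)ᴴ = (toMatrix v)ᵀ := by
  ext i j; simp [toMatrix]

/-- The matrix with the transpose of the given array as its lower left block. -/
noncomputable def corner (h : 2 * m ≤ d) (v : Fin (m * m) → ℝ) : Matrix (Fin d) (Fin d) ℂ :=
  inclusion (hi h) * (toMatrix v)ᵀ * (inclusion (lo h))ᴴ

lemma corner_conjTranspose (h : 2 * m ≤ d) (v : Fin (m * m) → ℝ) :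
    (corner h v)ᴴ = inclusion (lo h) * toMatrix v * (inclusion (hi h))ᴴ := by
  simp only [corner, conjTranspose_mul, conjTranspose_conjTranspose, ← toMatrix_conjTranspose,
    Matrix.mul_assoc]

lemma trace_mul_corner (h : 2 * m ≤ d) (v : Fin (m * m) → ℝ) (M : Matrix (Fin d) (Fin d) ℂ) :
    (M * corner h v).trace =
      ∑ i, ∑ j, (v (finProdFinEquiv (i, j)) : ℂ) * M (lo h i) (hi h j) := by
  rw [corner, ← Matrix.mul_assoc, trace_mul_comm, ← Matrix.mul_assoc, ← Matrix.mul_assoc, inclusion_conj_mul_mul]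
  simp only [trace, diag_apply, mul_apply, transpose_apply, submatrix_apply, toMatrix, of_apply]
  exact Finset.sum_congr rfl fun i _ => Finset.sum_congr rfl fun j _ => mul_comm _ _

lemma trace_corner_mul_conjTranspose (h : 2 * m ≤ d) (v : Fin (m * m) → ℝ) :
    (corner h v * (corner h v)ᴴ).trace.re = v ⬝ᵥ v := by
  have e : corner h v * (corner h v)ᴴ =
      inclusion (hi h) * ((toMatrix v)ᵀ * toMatrix v * (inclusion (hi h))ᴴ) := by
    rw [corner_conjTranspose, corner]
    simp only [Matrix.mul_assoc]
    rw [← Matrix.mul_assoc (inclusion (lo h))ᴴ, inclusion_conj_mul_self (lo_injective h), Matrix.one_mul]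
  rw [e, trace_mul_comm, Matrix.mul_assoc, inclusion_conj_mul_self (hi_injective h), Matrix.mul_one,
    dotProduct, sum_fin_mul]
  simp only [trace, diag_apply, mul_apply, transpose_apply, toMatrix, of_apply,
    ← Complex.ofReal_mul, ← Complex.ofReal_sum, Complex.ofReal_re]
  exact Finset.sum_comm

/-- The vector of the normalized off-diagonal block of a positive semidefinite matrix. -/
noncomputable def blockVec (h : 2 * m ≤ d) (M : Matrix (Fin d) (Fin d) ℂ) (a : Fin (m * m)) : ℝ :=
  (M (lo h (finProdFinEquiv.symm a).1) (hi h (finProdFinEquiv.symm a).2)).re / M.trace.re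

lemma blockVec_dotProduct (h : 2 * m ≤ d) (M : Matrix (Fin d) (Fin d) ℂ)
    (v : Fin (m * m) → ℝ) :
    blockVec h M ⬝ᵥ v = (M * corner h v).trace.re / M.trace.re := by
  rw [trace_mul_corner, dotProduct, sum_fin_mul]
  simp only [blockVec, Equiv.symm_apply_apply, Complex.re_sum, Complex.re_ofReal_mul,
    Finset.sum_div]
  exact Finset.sum_congr rfl fun i _ => Finset.sum_congr rfl fun j _ => by ring

lemma trace_mul_blockVec_dotProduct (h : 2 * m ≤ d) {M : Matrix (Fin d) (Fin d) ℂ}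
    (hM : M.PosSemidef) (v : Fin (m * m) → ℝ) :
    M.trace.re * (blockVec h M ⬝ᵥ v) = (M * corner h v).trace.re := by
  rw [blockVec_dotProduct]
  -- When the trace vanishes the quotient takes the default value zero, which is harmless because
  -- the matrix itself is zero.
  by_cases h0 : M.trace.re = 0
  · rw [eq_zero_of_re_trace_eq_zero hM h0]; simp
  · field_simp

/-- Each squared entry is at most a product of two diagonal entries, and the two blocks each have
trace at most `Tr M`. -/
lemma blockVec_norm_le (h : 2 * m ≤ d) {M : Matrix (Fin d) (Fin d) ℂ} (hM : M.PosSemidef) :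
    blockVec h M ⬝ᵥ blockVec h M ≤ 1 := by
  have hb : blockVec h M ⬝ᵥ blockVec h M =
      (∑ i, ∑ j, (M (lo h i) (hi h j)).re ^ 2) / M.trace.re ^ 2 := by
    rw [dotProduct, sum_fin_mul]
    simp only [blockVec, Equiv.symm_apply_apply, Finset.sum_div]
    exact Finset.sum_congr rfl fun i _ => Finset.sum_congr rfl fun j _ => by ring
  rw [hb]
  refine div_le_one_of_le₀ ?_ (sq_nonneg _)
  calc _ ≤ ∑ i, ∑ j, (M (lo h i) (lo h i)).re * (M (hi h j) (hi h j)).re :=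
        Finset.sum_le_sum fun i _ => Finset.sum_le_sum fun j _ => re_apply_sq_le hM _ _
    _ = (∑ i, (M (lo h i) (lo h i)).re) * ∑ j, (M (hi h j) (hi h j)).re := by
        rw [Finset.sum_mul_sum]
    _ ≤ M.trace.re * M.trace.re :=
        mul_le_mul (sum_re_diag_le hM (lo_injective h)) (sum_re_diag_le hM (hi_injective h))
          (Finset.sum_nonneg fun j _ => re_diag_nonneg hM _) (re_trace_nonneg hM)
    _ = _ := (sq _).symm

lemma POVM.sum_re_trace {k : ℕ} (M : POVM d k) : ∑ z, (M.effect z).trace.re = d := by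
  rw [← Complex.re_sum, ← trace_sum, M.sum_eq_one]
  simp

/-- The effects sum to the identity. Its off-diagonal block is zero, hence the mean. For the
covariance, Cauchy–Schwarz bounds each outcome by `Tr (Vᴴ M_z V) / d`, and these add up to `Tr (V
Vᴴ) / d = |v|²/d`. This `1/d` is the source of the exponent `3/2`. -/
lemma POVM.isIsotropicStep {k : ℕ} (hd : 0 < d) (h : 2 * m ≤ d) (M : POVM d k) :
    IsIsotropicStep (1 / d : ℝ) (fun z => (M.effect z).trace.re / d)
      (fun z => blockVec h (M.effect z)) where
  nonneg z := div_nonneg (re_trace_nonneg (M.posSemidef z)) (Nat.cast_nonneg _)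
  sum_eq_one := by
    rw [← Finset.sum_div, M.sum_re_trace, div_self (by positivity)]
  norm_le z := blockVec_norm_le h (M.posSemidef z)
  mean_eq_zero v := by
    simp only [div_mul_eq_mul_div, trace_mul_blockVec_dotProduct h (M.posSemidef _)]
    rw [← Finset.sum_div, ← Complex.re_sum, ← trace_sum, ← Finset.sum_mul, M.sum_eq_one,
      trace_mul_corner]
    simp [one_apply, lo_ne_hi]
  cov_le v := by
    have hz : ∀ z, (M.effect z).trace.re / d * (blockVec h (M.effect z) ⬝ᵥ v) ^ 2 ≤
        ((corner h v)ᴴ * M.effect z * corner h v).trace.re / d := by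
      intro z
      have hM := M.posSemidef z
      rw [div_mul_eq_mul_div]
      gcongr
      rcases (re_trace_nonneg hM).eq_or_lt with h0 | h0
      · rw [← h0, zero_mul]
        exact re_trace_conj_nonneg hM _
      · have h1 := re_trace_mul_sq_le hM (corner h v)
        rw [← trace_mul_blockVec_dotProduct h hM] at h1
        refine le_of_mul_le_mul_left (le_trans (le_of_eq ?_) h1) h0
        ring
    refine (Finset.sum_le_sum fun z _ => hz z).trans (le_of_eq ?_)
    rw [← Finset.sum_div, ← Complex.re_sum, ← trace_sum, ← Finset.sum_mul, ← Finset.mul_sum,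
      M.sum_eq_one, mul_one, trace_mul_comm, trace_corner_mul_conjTranspose]
    ring

end MixednessTesting

namespace MixednessTesting

open Matrix
open scoped ComplexOrder

variable {d m : ℕ}

/-! ### The hard states -/

/-- The vector of signs of a point of the cube. -/
noncomputable def signVec {N : ℕ} (w : Fin N → Bool) (a : Fin N) : ℝ := sg (w a)

/-- The Hermitian matrix with the sign matrix of `w` as its upper right block. -/
noncomputable def signPerturbation (h : 2 * m ≤ d) (w : Fin (m * m) → Bool) :
    Matrix (Fin d) (Fin d) ℂ := corner h (signVec w) + (corner h (signVec w))ᴴ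

/-- The perturbation of the maximally mixed state in the direction of a random sign matrix. -/
noncomputable def hardState (h : 2 * m ≤ d) (t : ℝ) (w : Fin (m * m) → Bool) :
    Matrix (Fin d) (Fin d) ℂ :=
  (d : ℂ)⁻¹ • (1 + ((t / √m : ℝ) : ℂ) • signPerturbation h w)

lemma signPerturbation_isHermitian (h : 2 * m ≤ d) (w : Fin (m * m) → Bool) :
    (signPerturbation h w).IsHermitian := by
  rw [IsHermitian, signPerturbation, conjTranspose_add, conjTranspose_conjTranspose, add_comm]

lemma re_trace_signPerturbation_mul (h : 2 * m ≤ d) (w : Fin (m * m) → Bool)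
    {M : Matrix (Fin d) (Fin d) ℂ} (hM : M.IsHermitian) :
    (signPerturbation h w * M).trace.re = 2 * (M * corner h (signVec w)).trace.re := by
  rw [signPerturbation, add_mul, trace_add, Complex.add_re, trace_mul_comm (corner h _) M]
  have : ((corner h (signVec w))ᴴ * M).trace = star ((M * corner h (signVec w)).trace) := by
    rw [← trace_conjTranspose, conjTranspose_mul, hM.eq]
  rw [this, RCLike.star_def, Complex.conj_re]
  ring

lemma re_trace_hardState_mul_aux (h : 2 * m ≤ d) (t : ℝ) (w : Fin (m * m) → Bool)
    {M : Matrix (Fin d) (Fin d) ℂ} (hM : M.IsHermitian) :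
    (hardState h t w * M).trace.re =
      (M.trace.re + t / √m * (2 * (M * corner h (signVec w)).trace.re)) / d := by
  rw [← re_trace_signPerturbation_mul h w hM, hardState, smul_mul_assoc, add_mul, one_mul,
    smul_mul_assoc, trace_smul, trace_add, trace_smul, smul_eq_mul, smul_eq_mul,
    show ((d : ℂ)⁻¹) = (((d : ℝ)⁻¹ : ℝ) : ℂ) by push_cast; rfl, Complex.re_ofReal_mul,
    Complex.add_re, Complex.re_ofReal_mul]
  ring

lemma re_trace_hardState_mul (h : 2 * m ≤ d) (t : ℝ) (w : Fin (m * m) → Bool)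
    {M : Matrix (Fin d) (Fin d) ℂ} (hM : M.PosSemidef) :
    (hardState h t w * M).trace.re =
      M.trace.re / d * (1 + 2 * t / √m * linForm (blockVec h M) w) := by
  rw [re_trace_hardState_mul_aux h t w hM.1, ← trace_mul_blockVec_dotProduct h hM]
  change _ = M.trace.re / d * (1 + 2 * t / √m * (blockVec h M ⬝ᵥ signVec w))
  ring

lemma linForm_neg {N : ℕ} (x : Fin N → ℝ) (w : Fin N → Bool) :
    linForm (-x) w = -linForm x w := by
  simp [linForm]

/-- Homogeneity, then AM–GM on `|u||v|`. -/
lemma OpBounded.abs_linForm_le {w : Fin (m * m) → Bool} (hw : OpBounded w) (u v : Fin m → ℝ) :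
    |linForm (outer u v) w| ≤ 11 / 4 * √m * (u ⬝ᵥ u + v ⬝ᵥ v) := by
  have key : ∀ u : Fin m → ℝ, linForm (outer u v) w ≤ 11 / 4 * √m * (u ⬝ᵥ u + v ⬝ᵥ v) := by
    intro u
    have hu0 := dotProduct_self_nonneg' u
    have hv0 := dotProduct_self_nonneg' v
    have hs : 0 ≤ √(m : ℝ) := Real.sqrt_nonneg _
    rcases hu0.eq_or_lt with hu | hu
    · have : u = 0 := dotProduct_self_eq_zero.1 hu.symm
      subst this
      have : linForm (outer 0 v) w = 0 := by simp [linForm, outer]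
      rw [this]
      positivity
    rcases hv0.eq_or_lt with hv | hv
    · have : v = 0 := dotProduct_self_eq_zero.1 hv.symm
      subst this
      have : linForm (outer u 0) w = 0 := by simp [linForm, outer]
      rw [this]
      positivity
    have h1 := hw ((√(u ⬝ᵥ u))⁻¹ • u) ((√(v ⬝ᵥ v))⁻¹ • v)
      (by rw [smul_dotProduct, dotProduct_smul, smul_eq_mul, smul_eq_mul, ← mul_assoc, ← sq,
            inv_pow, Real.sq_sqrt hu0, inv_mul_cancel₀ hu.ne'])
      (by rw [smul_dotProduct, dotProduct_smul, smul_eq_mul, smul_eq_mul, ← mul_assoc, ← sq,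
            inv_pow, Real.sq_sqrt hv0, inv_mul_cancel₀ hv.ne'])
    rw [outer_smul_left, outer_smul_right, linForm_smul, linForm_smul, ← mul_assoc] at h1
    have hu' : 0 < √(u ⬝ᵥ u) := Real.sqrt_pos.2 hu
    have hv' : 0 < √(v ⬝ᵥ v) := Real.sqrt_pos.2 hv
    have h2 : linForm (outer u v) w ≤ √(u ⬝ᵥ u) * √(v ⬝ᵥ v) * (11 / 2 * √m) := by
      have := mul_le_mul_of_nonneg_left h1 (mul_pos hu' hv').le
      refine le_trans (le_of_eq ?_) this
      field_simp
    have h3 := Real.sq_sqrt hu0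
    have h4 := Real.sq_sqrt hv0
    have h5 : √(u ⬝ᵥ u) * √(v ⬝ᵥ v) ≤ (u ⬝ᵥ u + v ⬝ᵥ v) / 2 := by
      nlinarith [sq_nonneg (√(u ⬝ᵥ u) - √(v ⬝ᵥ v))]
    nlinarith [mul_le_mul_of_nonneg_right h5 hs]
  rw [abs_le]
  refine ⟨?_, key u⟩
  have h1 := key (-u)
  have e : outer (-u) v = -outer u v := by ext a; simp [outer]
  rw [e, linForm_neg, neg_dotProduct_neg] at h1
  linarith

lemma sum_comp_add_sum_comp_le (h : 2 * m ≤ d) {f : Fin d → ℝ} (hf : ∀ a, 0 ≤ f a) :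
    ∑ i, f (lo h i) + ∑ j, f (hi h j) ≤ ∑ a, f a := by
  rw [← Finset.sum_image (f := f) (g := lo h) (fun _ _ _ _ h' => lo_injective h h'),
    ← Finset.sum_image (f := f) (g := hi h) (fun _ _ _ _ h' => hi_injective h h'),
    ← Finset.sum_union]
  · exact Finset.sum_le_sum_of_subset_of_nonneg (Finset.subset_univ _) fun a _ _ => hf a
  · rw [Finset.disjoint_left]
    simp only [Finset.mem_image, Finset.mem_univ, true_and, not_exists]
    rintro _ ⟨i, rfl⟩ j hj
    exact lo_ne_hi h i j hj.symm

/-- The bound `2/11` is the reciprocal of the norm constant `11/2`. The quadratic form at a complex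
vector splits into the bilinear forms of its real and imaginary parts, since the sign matrix is
real. -/
lemma hardState_isState (hd : 0 < d) (h : 2 * m ≤ d) {t : ℝ} (ht : |t| ≤ 2 / 11)
    {w : Fin (m * m) → Bool} (hw : OpBounded w) : IsState (hardState h t w) := by
  have hherm : (hardState h t w).IsHermitian := by
    rw [IsHermitian, hardState, conjTranspose_smul, conjTranspose_add, conjTranspose_smul,
      (signPerturbation_isHermitian h w).eq]
    simp
  refine ⟨posSemidef_iff_dotProduct_mulVec.2 ⟨hherm, fun x => ?_⟩, ?_⟩
  · have e : star x ⬝ᵥ hardState h t w *ᵥ x =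
        (hardState h t w * vecMulVec x (star x)).trace := by
      rw [mul_vecMulVec, trace_vecMulVec, dotProduct_comm]
    have hx : (vecMulVec x (star x)).PosSemidef := posSemidef_vecMulVec_self_star x
    rw [Complex.nonneg_iff]
    constructor
    · rw [e, re_trace_hardState_mul_aux h t w hx.1, trace_mul_corner]
      refine div_nonneg ?_ (Nat.cast_nonneg _)
      set a : Fin d → ℝ := fun i => (x i).re
      set b : Fin d → ℝ := fun i => (x i).im
      have e1 : (∑ i, ∑ j, ((signVec w (finProdFinEquiv (i, j)) : ℝ) : ℂ) *
          vecMulVec x (star x) (lo h i) (hi h j)).re =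
          linForm (outer (a ∘ lo h) (a ∘ hi h)) w + linForm (outer (b ∘ lo h) (b ∘ hi h)) w := by
        rw [linForm_outer, linForm_outer]
        simp only [Complex.re_sum, Complex.re_ofReal_mul, ← Finset.sum_add_distrib]
        refine Finset.sum_congr rfl fun i _ => Finset.sum_congr rfl fun j _ => ?_
        simp [vecMulVec_apply, signVec, signMatrix, a, b]
        ring
      have e2 : (vecMulVec x (star x)).trace.re = ∑ i, (a i * a i + b i * b i) := by
        rw [trace_vecMulVec, dotProduct, Complex.re_sum]
        refine Finset.sum_congr rfl fun i _ => ?_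
        simp [a, b]
      have h1 := hw.abs_linForm_le (a ∘ lo h) (a ∘ hi h)
      have h2 := hw.abs_linForm_le (b ∘ lo h) (b ∘ hi h)
      have h3 := sum_comp_add_sum_comp_le h (f := fun i => a i * a i + b i * b i)
        (fun i => add_nonneg (mul_self_nonneg _) (mul_self_nonneg _))
      rw [e1, e2]
      simp only [Finset.sum_add_distrib] at h3 ⊢
      set X := linForm (outer (a ∘ lo h) (a ∘ hi h)) w + linForm (outer (b ∘ lo h) (b ∘ hi h)) w
      have h4 : |X| ≤ 11 / 4 * √m * (∑ i, a i * a i + ∑ i, b i * b i) := by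
        have hs : 0 ≤ 11 / 4 * √(m : ℝ) := by positivity
        refine (abs_add_le _ _).trans ((add_le_add h1 h2).trans ?_)
        rw [← mul_add]
        refine mul_le_mul_of_nonneg_left ?_ hs
        simp only [dotProduct, Function.comp]
        linarith
      set S := ∑ i, a i * a i + ∑ i, b i * b i
      have h5 : |t / √m * (2 * X)| ≤ S := by
        have hS : 0 ≤ S := add_nonneg (Finset.sum_nonneg fun i _ => mul_self_nonneg _)
          (Finset.sum_nonneg fun i _ => mul_self_nonneg _)
        rw [abs_mul, abs_div, abs_mul, abs_of_nonneg (Real.sqrt_nonneg _), abs_two]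
        rcases (Real.sqrt_nonneg (m : ℝ)).eq_or_lt with h0 | h0
        · rw [← h0]; simpa using hS
        · calc |t| / √m * (2 * |X|) ≤ (2 / 11) / √m * (2 * (11 / 4 * √m * S)) := by gcongr
            _ = S := by field_simp; norm_num
      linarith [(abs_le.1 h5).1]
    · exact (hherm.im_star_dotProduct_mulVec_self x).symm
  · have e : (signPerturbation h w).trace = 0 := by
      have h1 : (corner h (signVec w)).trace = 0 := by
        have := trace_mul_corner h (signVec w) 1
        rw [one_mul] at this
        rw [this]
        simp [one_apply, lo_ne_hi]
      rw [signPerturbation, trace_add, trace_conjTranspose, h1]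
      simp
    rw [hardState, trace_smul, trace_add, trace_smul, e]
    simp [hd.ne']

/-- No norm estimate for the block is needed: outcome probabilities are nonnegative on the hard
states with parameters `±2/11`, and these two inequalities are the claim. -/
lemma OpBounded.abs_linForm_blockVec_le (hd : 0 < d) (h : 2 * m ≤ d) {w : Fin (m * m) → Bool}
    (hw : OpBounded w) {M : Matrix (Fin d) (Fin d) ℂ} (hM : M.PosSemidef) :
    |2 / √m * linForm (blockVec h M) w| ≤ 11 / 2 := by
  rcases (re_trace_nonneg hM).eq_or_lt with h0 | h0
  · have : linForm (blockVec h M) w = 0 := by simp [linForm, blockVec, ← h0]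
    rw [this]
    norm_num
  have key : ∀ t : ℝ, |t| ≤ 2 / 11 → 0 ≤ 1 + 2 * t / √m * linForm (blockVec h M) w := by
    intro t ht
    have h1 := re_trace_mul_nonneg (hardState_isState hd h ht hw).posSemidef hM
    rw [re_trace_hardState_mul h t w hM] at h1
    exact nonneg_of_mul_nonneg_right h1 (by positivity)
  have h1 := key (2 / 11) (by norm_num [abs_of_pos])
  have h2 := key (-(2 / 11)) (by norm_num [abs_of_pos])
  set x := linForm (blockVec h M) w
  have e1 : 2 * (2 / 11) / √m * x = 2 / 11 * (2 / √m * x) := by ring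
  have e2 : 2 * (-(2 / 11)) / √m * x = -(2 / 11 * (2 / √m * x)) := by ring
  rw [e1] at h1
  rw [e2] at h2
  rw [abs_le]
  constructor <;> linarith

lemma signPerturbation_mul_self (h : 2 * m ≤ d) (w : Fin (m * m) → Bool) :
    signPerturbation h w * signPerturbation h w =
      inclusion (hi h) * ((toMatrix (signVec w))ᵀ * toMatrix (signVec w)) * (inclusion (hi h))ᴴ +
      inclusion (lo h) * (toMatrix (signVec w) * (toMatrix (signVec w))ᵀ) *
        (inclusion (lo h))ᴴ := by
  rw [signPerturbation, corner_conjTranspose, corner]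
  set E := inclusion (lo h)
  set F := inclusion (hi h)
  set U := toMatrix (signVec w)
  have hEE : Eᴴ * E = 1 := inclusion_conj_mul_self (lo_injective h)
  have hFF : Fᴴ * F = 1 := inclusion_conj_mul_self (hi_injective h)
  have hEF : Eᴴ * F = 0 := inclusion_conj_mul_of_ne (lo_ne_hi h)
  have hFE : Fᴴ * E = 0 := inclusion_conj_mul_of_ne fun i j => (lo_ne_hi h j i).symm
  have k : ∀ (A B C D : Matrix (Fin d) (Fin m) ℂ) (V V' : Matrix (Fin m) (Fin m) ℂ),
      A * V * Bᴴ * (C * V' * Dᴴ) = A * (V * (Bᴴ * C) * V') * Dᴴ := by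
    intros; simp only [Matrix.mul_assoc]
  simp only [add_mul, mul_add, k, hEE, hFF, hEF, hFE, Matrix.mul_zero,
    Matrix.zero_mul, add_zero, zero_add, mul_one, mul_zero, zero_mul]
  exact add_comm _ _

lemma trace_inclusion_mul {f : Fin m → Fin d} (hf : Function.Injective f)
    (V : Matrix (Fin m) (Fin m) ℂ) :
    (inclusion f * V * (inclusion f)ᴴ).trace = V.trace := by
  rw [trace_mul_comm, ← Matrix.mul_assoc, inclusion_conj_mul_self hf, Matrix.one_mul]

lemma toMatrix_signVec_apply (w : Fin (m * m) → Bool) (i j : Fin m) :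
    toMatrix (signVec w) i j = (signMatrix w i j : ℂ) := rfl

lemma re_trace_signPerturbation_sq (h : 2 * m ≤ d) (w : Fin (m * m) → Bool) :
    (signPerturbation h w * signPerturbation h w).trace.re = 2 * (m : ℝ) ^ 2 := by
  rw [signPerturbation_mul_self, trace_add, trace_inclusion_mul (hi_injective h),
    trace_inclusion_mul (lo_injective h), trace_mul_comm, Complex.add_re, ← two_mul]
  congr 1
  simp only [trace, diag_apply, mul_apply, transpose_apply, toMatrix_signVec_apply,
    ← Complex.ofReal_mul, ← Complex.ofReal_sum, Complex.ofReal_re]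
  simp [signMatrix, sg_mul_self]
  ring

lemma re_trace_signPerturbation_pow_four (h : 2 * m ≤ d) (w : Fin (m * m) → Bool) :
    (signPerturbation h w * signPerturbation h w *
      (signPerturbation h w * signPerturbation h w)).trace.re = 2 * quarticTrace w := by
  rw [signPerturbation_mul_self]
  set E := inclusion (lo h)
  set F := inclusion (hi h)
  set U := toMatrix (signVec w)
  have hEE : Eᴴ * E = 1 := inclusion_conj_mul_self (lo_injective h)
  have hFF : Fᴴ * F = 1 := inclusion_conj_mul_self (hi_injective h)
  have hEF : Eᴴ * F = 0 := inclusion_conj_mul_of_ne (lo_ne_hi h)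
  have hFE : Fᴴ * E = 0 := inclusion_conj_mul_of_ne fun i j => (lo_ne_hi h j i).symm
  have k : ∀ (A B C D : Matrix (Fin d) (Fin m) ℂ) (V V' : Matrix (Fin m) (Fin m) ℂ),
      A * V * Bᴴ * (C * V' * Dᴴ) = A * (V * (Bᴴ * C) * V') * Dᴴ := by
    intros; simp only [Matrix.mul_assoc]
  have e : (F * (Uᵀ * U) * Fᴴ + E * (U * Uᵀ) * Eᴴ) * (F * (Uᵀ * U) * Fᴴ + E * (U * Uᵀ) * Eᴴ) =
      F * (Uᵀ * U * (Uᵀ * U)) * Fᴴ + E * (U * Uᵀ * (U * Uᵀ)) * Eᴴ := by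
    simp only [add_mul, mul_add, k, hEE, hFF, hEF, hFE, mul_one, mul_zero,
      Matrix.mul_zero, zero_mul, Matrix.zero_mul, add_zero, zero_add]
  have e2 : (Uᵀ * U * (Uᵀ * U)).trace = (U * Uᵀ * (U * Uᵀ)).trace := by
    rw [Matrix.mul_assoc, trace_mul_comm]
    simp only [Matrix.mul_assoc]
  rw [e, trace_add, trace_inclusion_mul (hi_injective h), trace_inclusion_mul (lo_injective h),
    e2, Complex.add_re, ← two_mul]
  congr 1
  simp only [trace, diag_apply, mul_apply, transpose_apply, U, toMatrix_signVec_apply,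
    ← Complex.ofReal_mul, ← Complex.ofReal_sum, Complex.ofReal_re, quarticTrace]
  refine Finset.sum_congr rfl fun i _ => Finset.sum_congr rfl fun k _ => ?_
  rw [sq]
  simp only [mul_comm]

/-- The hard states are far from the maximally mixed state in trace norm. -/
lemma lt_traceNorm_hardState (h : 2 * m ≤ d) (hmd : d ≤ 2 * m + 1) (hd : 90 ≤ d) {ε : ℝ}
    (hε : 0 < ε) {w : Fin (m * m) → Bool} (hw : quarticTrace w ≤ 39 / 10 * (m : ℝ) ^ 3) :
    ε < traceNorm (hardState h (2 * ε) w - maximallyMixed d) := by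
  have hm : 0 < m := by omega
  have hm' : (0 : ℝ) < m := by exact_mod_cast hm
  have hd' : (0 : ℝ) < d := by exact_mod_cast (show 0 < d by omega)
  set s := √(m : ℝ) with hs
  have hs0 : 0 < s := Real.sqrt_pos.2 hm'
  have hss : s ^ 2 = m := Real.sq_sqrt hm'.le
  set c : ℝ := 2 * ε / (d * s) with hc
  have hc0 : 0 < c := by positivity
  set G := signPerturbation h w with hG
  have e : hardState h (2 * ε) w - maximallyMixed d = (c : ℂ) • G := by
    rw [hardState, maximallyMixed, smul_add, add_sub_cancel_left, smul_smul, hc]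
    congr 1
    push_cast
    field_simp
    rfl
  rw [e]
  -- The best `v` is the root of the ratio of fourth to second moment, `c √(39/10 · m)`, and
  -- `197/100` approximates `√(39/10)`.
  refine lt_of_lt_of_le ?_ (le_traceNorm _ (v := 197 / 100 * c * s) (by positivity))
  have eGG : ((c : ℂ) • G)ᴴ * ((c : ℂ) • G) = ((c ^ 2 : ℝ) : ℂ) • (G * G) := by
    rw [conjTranspose_smul, (signPerturbation_isHermitian h w).eq, smul_mul_smul_comm]
    congr 1
    simp [sq]
  rw [eGG, smul_mul_smul_comm, trace_smul, trace_smul, smul_eq_mul, smul_eq_mul,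
    ← Complex.ofReal_mul, Complex.re_ofReal_mul, Complex.re_ofReal_mul,
    re_trace_signPerturbation_sq, re_trace_signPerturbation_pow_four]
  have h1 : 1 / (2 * (197 / 100 * c * s) ^ 3) * (c ^ 2 * c ^ 2 * (2 * quarticTrace w)) ≤
      1 / (2 * (197 / 100 * c * s) ^ 3) * (c ^ 2 * c ^ 2 * (2 * (39 / 10 * (m : ℝ) ^ 3))) := by
    gcongr
  have h2 : 3 / (2 * (197 / 100 * c * s)) * (c ^ 2 * (2 * (m : ℝ) ^ 2)) -
      1 / (2 * (197 / 100 * c * s) ^ 3) * (c ^ 2 * c ^ 2 * (2 * (39 / 10 * (m : ℝ) ^ 3))) =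
      (300 / 197 - 3900000 / 197 ^ 3) * (2 * ε * m / d) := by
    rw [hc, ← hss]
    field_simp
    ring
  -- The numerical factor is about `1.0127`; it absorbs the loss `2m/d ≥ 1 - 1/d` caused by odd `d`,
  -- which is why `d` must not be small.
  have h3 : ε < (300 / 197 - 3900000 / 197 ^ 3) * (2 * ε * m / d) := by
    have hmd' : (d : ℝ) ≤ 2 * m + 1 := by exact_mod_cast hmd
    have hd90 : (90 : ℝ) ≤ d := by exact_mod_cast hd
    rw [← mul_div_assoc, lt_div_iff₀ hd']
    have : (d : ℝ) < (300 / 197 - 3900000 / 197 ^ 3) * (2 * m) := by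
      norm_num
      linarith
    nlinarith
  linarith

end MixednessTesting

namespace MixednessTesting

open Matrix
open scoped ComplexOrder

variable {d m : ℕ}

/-! ### Algorithms run on the maximally mixed state -/

/-- The expectation of `φ` over the leaves of the algorithm run on the maximally mixed state, where
`φ` depends on the answer and on the list of the normalized off-diagonal blocks of the effects
along the path, which is appended to `l`. -/
noncomputable def nullMean (h : 2 * m ≤ d) (φ : List (Fin (m * m) → ℝ) → Answer → ℝ) :
    {n : ℕ} → IncoherentAlgorithm d n → List (Fin (m * m) → ℝ) → ℝ
  | _, .output a, l => φ l a
  | _, .measure M next, l =>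
      ∑ z, (M.effect z).trace.re / d * nullMean h φ (next z) (blockVec h (M.effect z) :: l)

lemma answerProb_nonneg {n : ℕ} (A : IncoherentAlgorithm d n) {ρ : Matrix (Fin d) (Fin d) ℂ}
    (hρ : IsState ρ) (a : Answer) : 0 ≤ A.answerProb ρ a := by
  induction A with
  | output b => simp only [IncoherentAlgorithm.answerProb]; split_ifs <;> norm_num
  | measure M next ih =>
    exact Finset.sum_nonneg fun z _ =>
      mul_nonneg (re_trace_mul_nonneg hρ.posSemidef (M.posSemidef z)) (ih z)

lemma POVM.sum_prob {k : ℕ} (M : POVM d k) {ρ : Matrix (Fin d) (Fin d) ℂ} (hρ : IsState ρ) :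
    ∑ z, M.prob ρ z = 1 := by
  simp only [POVM.prob]
  rw [← Complex.re_sum, ← trace_sum, ← Finset.mul_sum, M.sum_eq_one, mul_one, hρ.trace_eq_one]
  simp

lemma answerProb_add {n : ℕ} (A : IncoherentAlgorithm d n) {ρ : Matrix (Fin d) (Fin d) ℂ}
    (hρ : IsState ρ) : A.answerProb ρ .mixed + A.answerProb ρ .far = 1 := by
  induction A with
  | output b => cases b <;> simp [IncoherentAlgorithm.answerProb]
  | measure M next ih =>
    simp only [IncoherentAlgorithm.answerProb]
    rw [← Finset.sum_add_distrib]
    simp only [← mul_add, ih, mul_one, M.sum_prob hρ]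

lemma POVM.prob_maximallyMixed {k : ℕ} (M : POVM d k) (z : Fin k) :
    M.prob (maximallyMixed d) z = (M.effect z).trace.re / d := by
  rw [POVM.prob, maximallyMixed, smul_mul_assoc, one_mul, trace_smul, smul_eq_mul,
    show ((d : ℂ)⁻¹) = (((d : ℝ)⁻¹ : ℝ) : ℂ) by push_cast; rfl, Complex.re_ofReal_mul,
    div_eq_inv_mul]

lemma nullMean_ite (h : 2 * m ≤ d) {n : ℕ} (A : IncoherentAlgorithm d n) (a : Answer)
    (l : List (Fin (m * m) → ℝ)) :
    nullMean h (fun _ b => if b = a then 1 else 0) A l =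
      A.answerProb (maximallyMixed d) a := by
  induction A generalizing l with
  | output b => rfl
  | measure M next ih =>
    simp only [nullMean, ih, IncoherentAlgorithm.answerProb, M.prob_maximallyMixed]

/-- Likelihood ratios multiply along a path. The identity is purely algebraic, so it also holds for
sign matrices whose perturbation is not positive semidefinite. -/
lemma nullMean_prod (h : 2 * m ≤ d) {n : ℕ} (A : IncoherentAlgorithm d n) (a : Answer) (t : ℝ)
    (w : Fin (m * m) → Bool) (l : List (Fin (m * m) → ℝ)) :
    nullMean h (fun l b => if b = a then
      (l.map fun y => 1 + 2 * t / √m * linForm y w).prod else 0) A l =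
      (l.map fun y => 1 + 2 * t / √m * linForm y w).prod *
        A.answerProb (hardState h t w) a := by
  induction A generalizing l with
  | output b => simp [nullMean, IncoherentAlgorithm.answerProb]
  | measure M next ih =>
    simp only [nullMean, ih, IncoherentAlgorithm.answerProb, Finset.mul_sum, POVM.prob,
      re_trace_hardState_mul h t w (M.posSemidef _), List.map_cons, List.prod_cons]
    exact Finset.sum_congr rfl fun z _ => by ring

lemma cubeMean_nullMean (h : 2 * m ≤ d) {n : ℕ} (A : IncoherentAlgorithm d n) {N : ℕ}
    (φ : (Fin N → Bool) → List (Fin (m * m) → ℝ) → Answer → ℝ) (l : List (Fin (m * m) → ℝ)) :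
    cubeMean 0 (fun w => nullMean h (φ w) A l) =
      nullMean h (fun l a => cubeMean 0 fun w => φ w l a) A l := by
  induction A generalizing l with
  | output b => rfl
  | measure M next ih => simp only [nullMean, cubeMean_sum, cubeMean_const_mul, ih]

lemma nullMean_sub (h : 2 * m ≤ d) {n : ℕ} (A : IncoherentAlgorithm d n)
    (φ ψ : List (Fin (m * m) → ℝ) → Answer → ℝ) (l : List (Fin (m * m) → ℝ)) :
    nullMean h (fun l a => φ l a - ψ l a) A l = nullMean h φ A l - nullMean h ψ A l := by
  induction A generalizing l with
  | output b => rfl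
  | measure M next ih => simp only [nullMean, ih, mul_sub, Finset.sum_sub_distrib]

lemma nullMean_const_mul (h : 2 * m ≤ d) {n : ℕ} (A : IncoherentAlgorithm d n) (c : ℝ)
    (φ : List (Fin (m * m) → ℝ) → Answer → ℝ) (l : List (Fin (m * m) → ℝ)) :
    nullMean h (fun l a => c * φ l a) A l = c * nullMean h φ A l := by
  induction A generalizing l with
  | output b => rfl
  | measure M next ih => simp only [nullMean, ih, Finset.mul_sum, mul_left_comm c]

/-- A list all of whose entries come from positive semidefinite matrices. -/
def IsBlockList (h : 2 * m ≤ d) (l : List (Fin (m * m) → ℝ)) : Prop :=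
  ∀ y ∈ l, ∃ M : Matrix (Fin d) (Fin d) ℂ, M.PosSemidef ∧ y = blockVec h M

lemma IsBlockList.norm_le {h : 2 * m ≤ d} {l : List (Fin (m * m) → ℝ)} (hl : IsBlockList h l) :
    ∀ y ∈ l, y ⬝ᵥ y ≤ 1 := by
  intro y hy
  obtain ⟨M, hM, rfl⟩ := hl y hy
  exact blockVec_norm_le h hM

lemma IsBlockList.cons {h : 2 * m ≤ d} {l : List (Fin (m * m) → ℝ)} (hl : IsBlockList h l)
    {M : Matrix (Fin d) (Fin d) ℂ} (hM : M.PosSemidef) : IsBlockList h (blockVec h M :: l) := by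
  intro y hy
  rcases List.mem_cons.1 hy with rfl | hy
  · exact ⟨M, hM, rfl⟩
  · exact hl y hy

lemma nullMean_mono {h : 2 * m ≤ d} {n : ℕ} (A : IncoherentAlgorithm d n)
    {φ ψ : List (Fin (m * m) → ℝ) → Answer → ℝ} {l : List (Fin (m * m) → ℝ)}
    (hl : IsBlockList h l)
    (hφ : ∀ l', IsBlockList h l' → l'.length = l.length + n → ∀ a, φ l' a ≤ ψ l' a) :
    nullMean h φ A l ≤ nullMean h ψ A l := by
  induction A generalizing l with
  | output b => exact hφ l hl rfl b
  | measure M next ih =>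
    refine Finset.sum_le_sum fun z _ => mul_le_mul_of_nonneg_left ?_
      (div_nonneg (re_trace_nonneg (M.posSemidef z)) (Nat.cast_nonneg _))
    refine ih z (hl.cons (M.posSemidef z)) fun l' h1 h2 a => hφ l' h1 ?_ a
    rw [h2, List.length_cons]
    ring

/-- Induction on the tree, with the bound generalised over the starting list. The squared norm of
the sum grows on average by at most one per step, so the drifts `11|x|²/d` and `length/d` accumulate
to at most `(11/2 + 1/2)n²/d` from the empty list. -/
lemma nullMean_potential_le (hd : 0 < d) (h : 2 * m ≤ d) {n : ℕ} (A : IncoherentAlgorithm d n)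
    {l : List (Fin (m * m) → ℝ)} (hl : IsBlockList h l) :
    nullMean h (fun l _ => potential l) A l ≤ potential l +
      (11 * n * (l.sum ⬝ᵥ l.sum) + n * l.length + 6 * (n : ℝ) ^ 2) / d + 5 * n := by
  have hd' : (0 : ℝ) < d := by exact_mod_cast hd
  induction A generalizing l with
  | output b => simp [nullMean]
  | @measure n k M next ih =>
    have hs := M.isIsotropicStep hd h
    set p : Fin k → ℝ := fun z => (M.effect z).trace.re / d
    set y : Fin k → Fin (m * m) → ℝ := fun z => blockVec h (M.effect z)
    have h1 : ∀ z, p z * nullMean h (fun l _ => potential l) (next z) (y z :: l) ≤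
        p z * potential (y z :: l) +
          11 * n / d * (p z * ((y z + l.sum) ⬝ᵥ (y z + l.sum))) +
          p z * ((n * (l.length + 1) + 6 * (n : ℝ) ^ 2) / d + 5 * n) := by
      intro z
      have := mul_le_mul_of_nonneg_left (ih z (hl.cons (M.posSemidef z))) (hs.nonneg z)
      refine this.trans (le_of_eq ?_)
      simp only [List.sum_cons, List.length_cons, Nat.cast_add, Nat.cast_one]
      ring
    have h2 := Finset.sum_le_sum fun z (_ : z ∈ Finset.univ) => h1 z
    rw [Finset.sum_add_distrib, Finset.sum_add_distrib, ← Finset.mul_sum, ← Finset.sum_mul,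
      hs.sum_eq_one] at h2
    have h3 := hs.mean_potential_le (by positivity) hl.norm_le
    have h4 := mul_le_mul_of_nonneg_left (hs.mean_sum_sq_le l.sum)
      (show (0 : ℝ) ≤ 11 * n / d by positivity)
    refine h2.trans ((add_le_add (add_le_add h3 h4) le_rfl).trans ?_)
    have e : potential l + (11 * ((n + 1 : ℕ) : ℝ) * (l.sum ⬝ᵥ l.sum) +
        ((n + 1 : ℕ) : ℝ) * l.length + 6 * ((n + 1 : ℕ) : ℝ) ^ 2) / d + 5 * ((n + 1 : ℕ) : ℝ) -
        (potential l + 11 * (1 / (d : ℝ)) * (l.sum ⬝ᵥ l.sum) + 1 / (d : ℝ) * l.length + 5 +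
          11 * n / d * (l.sum ⬝ᵥ l.sum + 1) +
          1 * ((n * (l.length + 1) + 6 * (n : ℝ) ^ 2) / d + 5 * n)) = 6 / d := by
      push_cast
      field_simp
      ring
    have : (0 : ℝ) ≤ 6 / d := by positivity
    linarith

/-! ### The lower bound -/

open Classical in
/-- The averaged likelihood ratio of the hard states is close to one at a typical leaf. -/
lemma likelihood_ratio_ge (h : 2 * m ≤ d) (hmd : d ≤ 2 * m + 1) (hd : 1000 ≤ d) {ε : ℝ}
    (hε : 0 < ε) (hε' : ε ≤ 1 / 12) {l : List (Fin (m * m) → ℝ)} (hl : IsBlockList h l)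
    (hn : l.length * ε ^ 2 ≤ 1 / 10 ^ 8 * √d ^ 3)
    (hpot : (16 * ε ^ 2 / m) ^ 2 * potential l ≤ 1 / 10 ^ 4) :
    9 / 10 ≤ cubeMean 0 (fun w : Fin (m * m) → Bool => if OpBounded w then
      (l.map fun y => 1 + 2 * (2 * ε) / √m * linForm y w).prod else 0) := by
  have hm : 0 < m := by omega
  have hm' : (0 : ℝ) < m := by exact_mod_cast hm
  have hd' : (1000 : ℝ) ≤ d := by exact_mod_cast hd
  have hmd' : (d : ℝ) ≤ 2 * m + 1 := by exact_mod_cast hmd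
  have hmd3 : (d : ℝ) / 3 ≤ m := by linarith
  set D := √(d : ℝ) with hD
  have hDD : D ^ 2 = d := Real.sq_sqrt (by linarith)
  have hD30 : 30 ≤ D := Real.le_sqrt_of_sq_le (by linarith)
  have hD0 : 0 < D := by linarith
  set β := 2 * (2 * ε) / √m with hβ
  set B := 16 * ε ^ 2 / (m : ℝ) with hB
  have hβB : β ^ 2 = B := by
    rw [hβ, div_pow, Real.sq_sqrt hm'.le, hB]; ring
  have hβB4 : β ^ 4 = B ^ 2 := by rw [← hβB]; ring
  have hB0 : 0 < B := by positivity
  -- From `m ≥ d/3`, the squared coupling `B = β²` is at most `48ε²/d`.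
  have hBD : B * D ^ 2 ≤ 48 * ε ^ 2 := by
    rw [hB, div_mul_eq_mul_div, div_le_iff₀ hm', hDD]
    have := mul_le_mul_of_nonneg_left hmd3 (show 0 ≤ 48 * ε ^ 2 by positivity)
    linarith
  have hε2 : ε ^ 2 ≤ 1 / 144 := by nlinarith
  set n : ℝ := (l.length : ℝ) with hnn
  have hn0 : 0 ≤ n := Nat.cast_nonneg _
  have hBn : B * n ≤ 48 / 10 ^ 8 * D := by
    have : B * n * D ^ 2 ≤ 48 / 10 ^ 8 * D * D ^ 2 := by
      have := mul_le_mul_of_nonneg_left hBD hn0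
      linarith
    exact le_of_mul_le_mul_right this (by positivity)
  have hBD' : B * D ≤ 1 / (3 * D) := by
    rw [le_div_iff₀ (by positivity)]; linarith
  replace hpot : (B * pairSum l) ^ 2 + B ^ 2 * alignSum l + B ^ 2 * quarticSum l ≤ 1 / 10 ^ 4 :=
    le_trans (le_of_eq (by rw [potential]; ring)) hpot
  have hR0 := alignSum_nonneg l
  have hQ0 := quarticSum_nonneg l
  have hBR0 : 0 ≤ B ^ 2 * alignSum l := by positivity
  have hBQ0 : 0 ≤ B ^ 2 * quarticSum l := by positivity
  have hR : B ^ 2 * alignSum l ≤ 1 / 10 ^ 4 := by linarith [sq_nonneg (B * pairSum l)]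
  have hQ : B ^ 2 * quarticSum l ≤ 1 / 10 ^ 4 := by linarith [sq_nonneg (B * pairSum l)]
  have hM : |B * pairSum l| ≤ 1 / 100 := by
    apply abs_le_of_sq_le_sq _ (by norm_num)
    linarith
  obtain ⟨hM1, hM2⟩ := abs_le.1 hM
  have hX : B * (l.sum ⬝ᵥ l.sum) ≤ 48 / 10 ^ 8 * D + 1 / 50 := by
    have h1 := sum_dotProduct_self l
    have h2 := list_sum_map_le_length hl.norm_le
    have h3 : l.sum ⬝ᵥ l.sum ≤ n + 2 * pairSum l := by rw [h1]; linarith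
    have h4 := mul_le_mul_of_nonneg_left h3 hB0.le
    linarith
  have hX0 := dotProduct_self_nonneg' l.sum
  have hθ : ∀ a, |β * l.sum a| ≤ 1 / 2 := by
    intro a
    have h1 : l.sum a ^ 4 ≤ quarticSum l :=
      Finset.single_le_sum (f := fun a => l.sum a ^ 4) (fun _ _ => by positivity)
        (Finset.mem_univ a)
    have h2 : |β * l.sum a| ^ 4 ≤ (1 / 2) ^ 4 := by
      rw [show |β * l.sum a| ^ 4 = (|β * l.sum a| ^ 2) ^ 2 by ring, sq_abs,
        show ((β * l.sum a) ^ 2) ^ 2 = β ^ 4 * l.sum a ^ 4 by ring, hβB4]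
      linarith [mul_le_mul_of_nonneg_left h1 (sq_nonneg B)]
    exact le_of_pow_le_pow_left₀ (by norm_num) (by norm_num) h2
  have hgood : ∀ w : Fin (m * m) → Bool, OpBounded w → ∀ y ∈ l, |β * linForm y w| ≤ 11 / 12 := by
    intro w hw y hy
    obtain ⟨M, hM, rfl⟩ := hl y hy
    have h1 := hw.abs_linForm_blockVec_le (by omega) h hM
    have e : β * linForm (blockVec h M) w = 2 * ε * (2 / √m * linForm (blockVec h M) w) := by
      rw [hβ]; ring
    rw [e, abs_mul, abs_of_pos (by positivity)]
    calc _ ≤ 2 * (1 / 12 : ℝ) * (11 / 2) := by gcongr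
      _ = 11 / 12 := by norm_num
  -- The choice `δ = 1/√d` balances the error terms: `B n` is at most a tiny multiple of `√d`, while
  -- `B √d` is at most `1/(3√d)`. The restriction `ε ≤ 1/12` enters through `11ε ≤ 11/12`, which
  -- keeps the factors away from zero.
  have key := exp_sub_le_cubeMean_prod (l := l) (β := β) (δ := 1 / D) (by positivity)
    (Real.exp_pos (-(m / 2))).le hl.norm_le hθ OpBounded hgood (cubeMean_not_opBounded_le hm)
  refine le_trans ?_ key
  rw [hβB, hβB4, ← hnn]
  have t1 : 6 * (1 / D) * (B * n + B ^ 2 * alignSum l) ≤ 1 / 1000 := by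
    rw [mul_one_div, div_mul_eq_mul_div, div_le_iff₀ hD0]
    linarith
  have t2 : 48 / (1 / D) * (B ^ 2 * (4 * n + B ^ 2 * (l.sum ⬝ᵥ l.sum) * alignSum l)) ≤
      1 / 1000 := by
    have e : 48 / (1 / D) * (B ^ 2 * (4 * n + B ^ 2 * (l.sum ⬝ᵥ l.sum) * alignSum l)) =
        48 * (B * D) * (4 * (B * n) + (B * (l.sum ⬝ᵥ l.sum)) * (B ^ 2 * alignSum l)) := by
      field_simp
    have h1 : (B * (l.sum ⬝ᵥ l.sum)) * (B ^ 2 * alignSum l) ≤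
        (48 / 10 ^ 8 * D + 1 / 50) * (1 / 10 ^ 4) :=
      mul_le_mul hX hR (by positivity) (by positivity)
    have h2 : 4 * (B * n) + (B * (l.sum ⬝ᵥ l.sum)) * (B ^ 2 * alignSum l) ≤
        1 / 10 ^ 5 * D := by linarith
    rw [e]
    calc _ ≤ 48 * (1 / (3 * D)) * (1 / 10 ^ 5 * D) := by gcongr
      _ ≤ 1 / 1000 := by field_simp; norm_num
  have t3 : Real.exp (-(m / 2)) * Real.exp (B * (l.sum ⬝ᵥ l.sum)) ≤ 1 / 15 := by
    rw [← Real.exp_add]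
    -- The norm `B|∑ y|²` is at most of order `√d`, so the exponentially small bad event wins.
    have h1 : -((m : ℝ) / 2) + B * (l.sum ⬝ᵥ l.sum) ≤ -14 := by
      have : 30 * D ≤ D ^ 2 := by nlinarith
      linarith
    have h2 : (15 : ℝ) ≤ Real.exp 14 := by linarith [Real.add_one_le_exp (14 : ℝ)]
    calc _ ≤ Real.exp (-14) := Real.exp_le_exp.2 h1
      _ ≤ 1 / 15 := by rw [Real.exp_neg, one_div]; gcongr
  have t4 := Real.add_one_le_exp (B * pairSum l - 3 * (B ^ 2 * quarticSum l) -
    B ^ 2 * alignSum l / 2 - 6 * (1 / D) * (B * n + B ^ 2 * alignSum l) -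
    48 / (1 / D) * (B ^ 2 * (4 * n + B ^ 2 * (l.sum ⬝ᵥ l.sum) * alignSum l)))
  linarith

open Classical in
theorem lower_bound (hd : 1000 ≤ d) {ε : ℝ} (hε : 0 < ε) (hε' : ε ≤ 1 / 12) {n : ℕ}
    (A : IncoherentAlgorithm d n) (hA : A.TestsMixedness ε) :
    1 / 10 ^ 8 * √d ^ 3 ≤ n * ε ^ 2 := by
  by_contra! hn
  obtain ⟨m, h, hmd⟩ : ∃ m, 2 * m ≤ d ∧ d ≤ 2 * m + 1 := ⟨d / 2, by omega, by omega⟩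
  have hm : 0 < m := by omega
  have hm' : (0 : ℝ) < m := by exact_mod_cast hm
  have hd' : (1000 : ℝ) ≤ d := by exact_mod_cast hd
  have hmd' : (d : ℝ) ≤ 2 * m + 1 := by exact_mod_cast hmd
  have ht : |2 * ε| ≤ 2 / 11 := by rw [abs_of_pos (by positivity)]; linarith
  set U := cubeMean 0 (fun w : Fin (m * m) → Bool => if OpBounded w then
    A.answerProb (hardState h (2 * ε) w) .mixed else 0) with hU
  -- the answers on the hard states
  have hupper : U ≤ 1 / 3 + 2 / 3 * (10 / 29) := by
    calc U ≤ cubeMean 0 (fun w : Fin (m * m) → Bool => 1 / 3 + 2 / 3 *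
          (if 39 / 10 * (m : ℝ) ^ 3 < quarticTrace w then (1 : ℝ) else 0)) := by
          -- For a bounded sign matrix the state is either far, and answered "mixed" with
          -- probability at most `1/3`, or has a large fourth moment, where the trivial bound one is
          -- used; other sign matrices contribute zero.
          refine cubeMean_mono abs_zero_apply_le fun w => ?_
          by_cases hw : OpBounded w
          · have hst := hardState_isState (by omega) h ht hw
            have h1 := answerProb_add A hst
            have h2 := answerProb_nonneg A hst .far
            rw [if_pos hw]
            split_ifs with hq
            · linarith
            · have := hA.2 _ hst (lt_traceNorm_hardState h hmd (by omega) hε (not_lt.1 hq))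
              linarith
          · rw [if_neg hw]
            split_ifs <;> norm_num
      _ ≤ _ := by
          rw [cubeMean_add, cubeMean_const, cubeMean_const_mul]
          linarith [cubeMean_ite_quarticTrace_le hm]
  -- comparison with the answers on the maximally mixed state
  set B := 16 * ε ^ 2 / (m : ℝ) with hB
  have hB0 : 0 < B := by positivity
  set φ : List (Fin (m * m) → ℝ) → Answer → ℝ := fun l b =>
    cubeMean 0 (fun w : Fin (m * m) → Bool => if OpBounded w then (if b = .mixed then
      (l.map fun y => 1 + 2 * (2 * ε) / √m * linForm y w).prod else 0) else 0) with hφ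
  have hUφ : U = nullMean h φ A [] := by
    rw [hφ, ← cubeMean_nullMean, hU]
    congr 1
    funext w
    have := nullMean_prod h A .mixed (2 * ε) w []
    split_ifs with hw
    · simpa using this.symm
    · have := nullMean_const_mul h A 0 (fun _ _ => 0) []
      simpa using this.symm
  -- Markov's inequality in pointwise form: at a leaf with small potential the ratio is at least
  -- `9/10`, and at any other leaf the left integrand is negative while the ratio is nonnegative.
  have hlower : 9 / 10 * (A.answerProb (maximallyMixed d) .mixed -
      10 ^ 4 * B ^ 2 * nullMean h (fun l _ => potential l) A []) ≤ U := by
    rw [hUφ, ← nullMean_ite h A .mixed [], ← nullMean_const_mul, ← nullMean_sub,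
      ← nullMean_const_mul]
    refine nullMean_mono A (by simp [IsBlockList]) fun l hl hlen b => ?_
    have hlen' : (l.length : ℝ) = n := by simp [hlen]
    have hpot0 : 0 ≤ 10 ^ 4 * B ^ 2 * potential l :=
      mul_nonneg (by positivity) (potential_nonneg l)
    have hφ0 : 0 ≤ φ l b := by
      refine cubeMean_nonneg abs_zero_apply_le fun w => ?_
      split_ifs with hw hb
      · refine List.prod_nonneg fun x hx => ?_
        obtain ⟨y, hy, rfl⟩ := List.mem_map.1 hx
        obtain ⟨M, hM, rfl⟩ := hl y hy
        have h1 := (abs_le.1 (hw.abs_linForm_blockVec_le (by omega) h hM)).1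
        have e : 2 * (2 * ε) / √m * linForm (blockVec h M) w =
          2 * ε * (2 / √m * linForm (blockVec h M) w) := by ring
        rw [e]
        nlinarith
      · exact le_rfl
      · exact le_rfl
    by_cases hb : b = .mixed
    · rw [if_pos hb]
      by_cases hp : B ^ 2 * potential l ≤ 1 / 10 ^ 4
      · have := likelihood_ratio_ge h hmd hd hε hε' hl (by rw [hlen']; exact hn.le) hp
        have e : φ l b = cubeMean 0 (fun w : Fin (m * m) → Bool => if OpBounded w then
            (l.map fun y => 1 + 2 * (2 * ε) / √m * linForm y w).prod else 0) := by
          simp only [hφ, if_pos hb]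
        rw [e]
        linarith
      · rw [not_le] at hp
        nlinarith
    · rw [if_neg hb]
      linarith
  have hpot := nullMean_potential_le (by omega) h A (l := []) (by simp [IsBlockList])
  rw [potential_nil] at hpot
  simp only [List.sum_nil, dotProduct_zero, mul_zero, List.length_nil, Nat.cast_zero, zero_add]
    at hpot
  -- Here the hypothesis on `n` is used: `B n` is at most `48/10⁸ · √d`, which bounds both the
  -- `n²/d` and the `n` part of the mean potential.
  have hsmall : 10 ^ 4 * B ^ 2 * nullMean h (fun l _ => potential l) A [] ≤ 1 / 100 := by
    refine (mul_le_mul_of_nonneg_left hpot (by positivity)).trans ?_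
    have hBd : B * d ≤ 48 * ε ^ 2 := by
      rw [hB, div_mul_eq_mul_div, div_le_iff₀ hm']
      nlinarith [sq_nonneg ε]
    set D := √(d : ℝ) with hD
    have hDD : D ^ 2 = d := Real.sq_sqrt (by linarith)
    have hD30 : 30 ≤ D := Real.le_sqrt_of_sq_le (by linarith)
    have hε2 : ε ^ 2 ≤ 1 / 144 := by nlinarith
    rw [← hDD] at hBd ⊢
    have hn0 : (0 : ℝ) ≤ n := Nat.cast_nonneg n
    have a1 : B * n ≤ 48 / 10 ^ 8 * D := by
      have : B * n * D ^ 2 ≤ 48 / 10 ^ 8 * D * D ^ 2 := by nlinarith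
      exact le_of_mul_le_mul_right this (by positivity)
    have a2 : (B * n) ^ 2 ≤ (48 / 10 ^ 8 * D) ^ 2 := by gcongr
    have a3 : B * D ≤ 1 / 3 := by nlinarith
    have e : 10 ^ 4 * B ^ 2 * (6 * (n : ℝ) ^ 2 / D ^ 2 + 5 * n) =
        10 ^ 4 * (6 * ((B * n) ^ 2 / D ^ 2) + 5 * (B * (B * n))) := by ring
    have a4 : (B * n) ^ 2 / D ^ 2 ≤ (48 / 10 ^ 8) ^ 2 := by
      rw [div_le_iff₀ (by positivity)]; linarith [a2]
    have a5 : B * (B * n) ≤ 48 / 10 ^ 8 * (1 / 3) := by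
      calc B * (B * n) ≤ B * (48 / 10 ^ 8 * D) := by gcongr
        _ = 48 / 10 ^ 8 * (B * D) := by ring
        _ ≤ _ := by gcongr
    rw [e]
    linarith
  -- The contradiction is `9/10 · (2/3 - 1/100) = 0.591` against `1/3 + 20/87 < 0.564`.
  have := hA.1
  linarith

end MixednessTesting

namespace MixednessTesting

/-! ### Hypercontractivity for quadratic forms in random signs -/

section Chaos

variable {E : Type*} [NormedAddCommGroup E] [InnerProductSpace ℝ E] {N : ℕ}

/-- A vector-valued linear form in signs. -/
noncomputable def linChaos (c : Fin N → E) (w : Fin N → Bool) : E := ∑ a, sg (w a) • c a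

/-- A vector-valued quadratic form in signs. -/
noncomputable def quadChaos (q : Fin N → Fin N → E) (w : Fin N → Bool) : E :=
  ∑ a, ∑ b, (sg (w a) * sg (w b)) • q a b

lemma cubeMean_zero_succ (f : (Fin (N + 1) → Bool) → ℝ) :
    cubeMean 0 f = cubeMean 0 (fun w => (f (Fin.cons true w) + f (Fin.cons false w)) / 2) := by
  have h0 : Fin.tail (0 : Fin (N + 1) → ℝ) = 0 := rfl
  have e : (fun w : Fin N → Bool => (f (Fin.cons true w) + f (Fin.cons false w)) / 2) =
      fun w => 1 / 2 * f (Fin.cons true w) + 1 / 2 * f (Fin.cons false w) := by funext w; ring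
  rw [cubeMean_succ, h0, e, cubeMean_add, cubeMean_const_mul, cubeMean_const_mul]
  simp

lemma cubeMean_norm_sq_step {F : (Fin (N + 1) → Bool) → E} {f g : (Fin N → Bool) → E}
    (h : ∀ b w, F (Fin.cons b w) = f w + sg b • g w) :
    cubeMean 0 (fun w => ‖F w‖ ^ 2) =
      cubeMean 0 (fun w => ‖f w‖ ^ 2) + cubeMean 0 (fun w => ‖g w‖ ^ 2) := by
  rw [cubeMean_zero_succ, ← cubeMean_add]
  congr 1
  funext w
  simp only [h, sg_true, sg_false, one_smul, neg_smul, ← sub_eq_add_neg, norm_add_sq_real,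
    norm_sub_sq_real]
  ring

/-- Averaging over the new sign removes odd powers; the mixed term is handled by Cauchy–Schwarz
pointwise for the inner product and then for the mean. -/
lemma cubeMean_norm_pow_four_step {F : (Fin (N + 1) → Bool) → E} {f g : (Fin N → Bool) → E}
    (h : ∀ b w, F (Fin.cons b w) = f w + sg b • g w) {K G H : ℝ} (hG : 0 ≤ G) (hH : 0 ≤ H)
    (hK : 0 ≤ K) (hf : cubeMean 0 (fun w => ‖f w‖ ^ 4) ≤ K ^ 2 * G ^ 2)
    (hg : cubeMean 0 (fun w => ‖g w‖ ^ 4) ≤ H ^ 2) :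
    cubeMean 0 (fun w => ‖F w‖ ^ 4) ≤ K ^ 2 * G ^ 2 + 6 * (K * G * H) + H ^ 2 := by
  have h1 : cubeMean 0 (fun w => ‖F w‖ ^ 4) ≤ cubeMean 0 (fun w => ‖f w‖ ^ 4) +
      6 * cubeMean 0 (fun w => ‖f w‖ ^ 2 * ‖g w‖ ^ 2) + cubeMean 0 (fun w => ‖g w‖ ^ 4) := by
    rw [cubeMean_zero_succ, ← cubeMean_const_mul, ← cubeMean_add, ← cubeMean_add]
    refine cubeMean_mono abs_zero_apply_le fun w => ?_
    have e : ∀ x : E, ‖x‖ ^ 4 = (‖x‖ ^ 2) ^ 2 := fun x => by ring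
    simp only [h, sg_true, sg_false, one_smul, neg_smul, ← sub_eq_add_neg, e, norm_add_sq_real,
      norm_sub_sq_real]
    have hc : inner ℝ (f w) (g w) ^ 2 ≤ ‖f w‖ ^ 2 * ‖g w‖ ^ 2 := by
      rw [← mul_pow, ← sq_abs]
      gcongr
      exact abs_real_inner_le_norm _ _
    nlinarith
  have h2 : cubeMean 0 (fun w => ‖f w‖ ^ 2 * ‖g w‖ ^ 2) ≤ K * G * H := by
    refine (abs_le_of_sq_le_sq' ?_ (by positivity)).2
    refine (cubeMean_mul_sq_le abs_zero_apply_le _ _).trans ?_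
    simp only [← pow_mul]
    rw [mul_pow, mul_pow]
    exact mul_le_mul hf hg (cubeMean_nonneg abs_zero_apply_le fun w => by positivity)
      (by positivity)
  linarith

lemma linChaos_cons (c : Fin (N + 1) → E) (b : Bool) (w : Fin N → Bool) :
    linChaos c (Fin.cons b w) = linChaos (Fin.tail c) w + sg b • c 0 := by
  simp [linChaos, Fin.sum_univ_succ, Fin.tail, add_comm]

lemma cubeMean_linChaos_sq (c : Fin N → E) :
    cubeMean 0 (fun w => ‖linChaos c w‖ ^ 2) = ∑ a, ‖c a‖ ^ 2 := by
  induction N with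
  | zero => simp [cubeMean_fin_zero, linChaos]
  | succ N ih =>
    rw [cubeMean_norm_sq_step (g := fun _ => c 0) (linChaos_cons c), ih, cubeMean_const,
      Fin.sum_univ_succ, add_comm]
    rfl

lemma cubeMean_linChaos_pow_four_le (c : Fin N → E) :
    cubeMean 0 (fun w => ‖linChaos c w‖ ^ 4) ≤ 3 * (∑ a, ‖c a‖ ^ 2) ^ 2 := by
  induction N with
  | zero => simp [cubeMean_fin_zero, linChaos]
  | succ N ih =>
    have hA : 0 ≤ ∑ a, ‖Fin.tail c a‖ ^ 2 := Finset.sum_nonneg fun _ _ => by positivity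
    set A := ∑ a, ‖Fin.tail c a‖ ^ 2
    have h1 : cubeMean 0 (fun w => ‖linChaos c w‖ ^ 4) ≤
        cubeMean 0 (fun w => ‖linChaos (Fin.tail c) w‖ ^ 4) + 6 * (‖c 0‖ ^ 2 * A) +
          ‖c 0‖ ^ 4 := by
      rw [show A = _ from (cubeMean_linChaos_sq (Fin.tail c)).symm, ← cubeMean_const_mul, ← cubeMean_const_mul,
        ← cubeMean_add, ← cubeMean_const 0 (‖c 0‖ ^ 4), ← cubeMean_add, cubeMean_zero_succ]
      refine cubeMean_mono abs_zero_apply_le fun w => ?_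
      have e : ∀ x : E, ‖x‖ ^ 4 = (‖x‖ ^ 2) ^ 2 := fun x => by ring
      have hc : inner ℝ (linChaos (Fin.tail c) w) (c 0) ^ 2 ≤
          ‖linChaos (Fin.tail c) w‖ ^ 2 * ‖c 0‖ ^ 2 := by
        rw [← mul_pow, ← sq_abs]
        gcongr
        exact abs_real_inner_le_norm _ _
      simp only [linChaos_cons, sg_true, sg_false, one_smul, neg_smul, ← sub_eq_add_neg, e,
        norm_add_sq_real, norm_sub_sq_real]
      nlinarith
    have h2 := ih (Fin.tail c)
    rw [Fin.sum_univ_succ]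
    change _ ≤ 3 * (‖c 0‖ ^ 2 + A) ^ 2
    change _ ≤ 3 * A ^ 2 at h2
    nlinarith [sq_nonneg (‖c 0‖ ^ 2)]

/-- With zero diagonal the square of the new sign never occurs, so the form is affine in that sign;
symmetry merges its row and column into the factor 2. -/
lemma quadChaos_cons {q : Fin (N + 1) → Fin (N + 1) → E} (hsymm : ∀ a b, q a b = q b a)
    (hdiag : ∀ a, q a a = 0) (b : Bool) (w : Fin N → Bool) :
    quadChaos q (Fin.cons b w) = quadChaos (fun a b => q a.succ b.succ) w +
      sg b • linChaos (fun a => (2 : ℝ) • q 0 a.succ) w := by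
  simp only [quadChaos, linChaos, Fin.sum_univ_succ, Fin.cons_zero, Fin.cons_succ, hdiag,
    smul_zero, zero_add, Finset.sum_add_distrib, Finset.smul_sum, smul_smul]
  rw [← add_assoc, ← Finset.sum_add_distrib, add_comm]
  congr 1
  refine Finset.sum_congr rfl fun a _ => ?_
  rw [hsymm a.succ 0, ← add_smul]
  congr 1
  ring

lemma cubeMean_quadChaos_sq {q : Fin N → Fin N → E} (hsymm : ∀ a b, q a b = q b a)
    (hdiag : ∀ a, q a a = 0) :
    cubeMean 0 (fun w => ‖quadChaos q w‖ ^ 2) = 2 * ∑ a, ∑ b, ‖q a b‖ ^ 2 := by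
  induction N with
  | zero => simp [cubeMean_fin_zero, quadChaos]
  | succ N ih =>
    rw [cubeMean_norm_sq_step (quadChaos_cons hsymm hdiag), cubeMean_linChaos_sq,
      ih (fun a b => hsymm _ _) (fun a => hdiag _)]
    simp only [Fin.sum_univ_succ, hdiag, norm_zero, norm_smul, Finset.sum_add_distrib,
      mul_pow, ← Finset.mul_sum, hsymm (Fin.succ _) 0]
    norm_num
    ring

/-- The fourth moment of the norm of a quadratic form in signs is bounded by the square of the
second moment. -/
lemma cubeMean_quadChaos_pow_four_le {q : Fin N → Fin N → E} (hsymm : ∀ a b, q a b = q b a)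
    (hdiag : ∀ a, q a a = 0) :
    cubeMean 0 (fun w => ‖quadChaos q w‖ ^ 4) ≤
      27 * cubeMean 0 (fun w => ‖quadChaos q w‖ ^ 2) ^ 2 := by
  induction N with
  | zero => simp [cubeMean_fin_zero, quadChaos]
  | succ N ih =>
    have h3 : √3 ^ 2 = (3 : ℝ) := Real.sq_sqrt (by norm_num)
    have hcons := quadChaos_cons hsymm hdiag
    rw [cubeMean_norm_sq_step hcons]
    set G := cubeMean 0 (fun w => ‖quadChaos (fun a b => q a.succ b.succ) w‖ ^ 2)
    set H := cubeMean 0 (fun w => ‖linChaos (fun a : Fin N => (2 : ℝ) • q 0 a.succ) w‖ ^ 2) with hH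
    have hG0 : 0 ≤ G := cubeMean_nonneg abs_zero_apply_le fun w => by positivity
    have hH0 : 0 ≤ H := cubeMean_nonneg abs_zero_apply_le fun w => by positivity
    have h1 := ih (q := fun a b => q a.succ b.succ) (fun a b => hsymm _ _) (fun a => hdiag _)
    have h2 := cubeMean_linChaos_pow_four_le (fun a : Fin N => (2 : ℝ) • q 0 a.succ)
    rw [← cubeMean_linChaos_sq, ← hH] at h2
    -- The constant `27 = K²` comes from `K = 3√3`: linear forms cost `√3`, and `6K√3 = 2K²` makes
    -- the cross term fit exactly.
    have h4 := cubeMean_norm_pow_four_step hcons (K := 3 * √3) (G := G) (H := √3 * H) hG0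
      (by positivity) (by positivity) (h1.trans (le_of_eq (by rw [mul_pow, h3]; ring)))
      (h2.trans (le_of_eq (by rw [mul_pow, h3])))
    refine h4.trans ?_
    have e : (3 * √3) ^ 2 * G ^ 2 + 6 * (3 * √3 * G * (√3 * H)) + (√3 * H) ^ 2 =
        27 * G ^ 2 + 54 * (G * H) + 3 * H ^ 2 := by
      rw [mul_pow, mul_pow, h3]
      linear_combination (18 * G * H) * h3
    rw [e]
    nlinarith [sq_nonneg H]

open Classical in
/-- Paley–Zygmund inequality for quadratic forms in signs. -/
lemma le_cubeMean_ite_quadChaos {q : Fin N → Fin N → E} (hsymm : ∀ a b, q a b = q b a)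
    (hdiag : ∀ a, q a a = 0) :
    1 / 108 ≤ cubeMean 0 (fun w =>
      if ∑ a, ∑ b, ‖q a b‖ ^ 2 ≤ ‖quadChaos q w‖ ^ 2 then (1 : ℝ) else 0) := by
  have h2 := cubeMean_quadChaos_sq hsymm hdiag
  have h4 := cubeMean_quadChaos_pow_four_le hsymm hdiag
  rw [h2] at h4
  set S := ∑ a, ∑ b, ‖q a b‖ ^ 2
  set P := cubeMean 0 (fun w => if S ≤ ‖quadChaos q w‖ ^ 2 then (1 : ℝ) else 0) with hP
  have hS0 : 0 ≤ S := Finset.sum_nonneg fun a _ => Finset.sum_nonneg fun b _ => by positivity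
  rcases hS0.eq_or_lt with hS | hS
  · have : P = 1 := by
      have e : ∀ w, S ≤ ‖quadChaos q w‖ ^ 2 := fun w => by rw [← hS]; positivity
      simp only [hP, e, if_true, cubeMean_const]
    rw [this]; norm_num
  -- The mean is `2S` and values below the threshold `S` contribute at most `S`. Squaring and
  -- Cauchy–Schwarz then give `S² ≤ 27 (2S)² P`, hence `1/108`.
  have h1 : S ≤ cubeMean 0 (fun w => ‖quadChaos q w‖ ^ 2 *
      if S ≤ ‖quadChaos q w‖ ^ 2 then (1 : ℝ) else 0) := by
    have : cubeMean 0 (fun w => ‖quadChaos q w‖ ^ 2) ≤ cubeMean 0 (fun w => S +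
        ‖quadChaos q w‖ ^ 2 * if S ≤ ‖quadChaos q w‖ ^ 2 then (1 : ℝ) else 0) := by
      refine cubeMean_mono abs_zero_apply_le fun w => ?_
      split_ifs with h
      · linarith
      · linarith [not_le.1 h]
    rw [h2, cubeMean_add, cubeMean_const] at this
    linarith
  have hcs := cubeMean_mul_sq_le (abs_zero_apply_le (N := N)) (fun w => ‖quadChaos q w‖ ^ 2)
    (fun w => if S ≤ ‖quadChaos q w‖ ^ 2 then (1 : ℝ) else 0)
  have e1 : cubeMean 0 (fun w => (‖quadChaos q w‖ ^ 2) ^ 2) =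
      cubeMean 0 (fun w => ‖quadChaos q w‖ ^ 4) := by
    congr 1; funext w; ring
  have e2 : cubeMean 0 (fun w => (if S ≤ ‖quadChaos q w‖ ^ 2 then (1 : ℝ) else 0) ^ 2) = P := by
    rw [hP]; congr 1; funext w; split_ifs <;> simp
  rw [e1, e2] at hcs
  have hP0 : 0 ≤ P := cubeMean_nonneg abs_zero_apply_le fun w => by split_ifs <;> norm_num
  have h5 : S ^ 2 ≤ 27 * (2 * S) ^ 2 * P :=
    (pow_le_pow_left₀ hS0 h1 2).trans (hcs.trans (mul_le_mul_of_nonneg_right h4 hP0))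
  have h6 : 0 < S ^ 2 := by positivity
  nlinarith

end Chaos

end MixednessTesting

namespace MixednessTesting

open Matrix
open scoped ComplexOrder ComplexConjugate

variable {d : ℕ}

/-! ### Measurements in a random basis -/

/-- The measurement in the computational basis. -/
noncomputable def standardPOVM (d : ℕ) : POVM d d where
  effect z := vecMulVec (Pi.single z 1) (star (Pi.single z 1))
  posSemidef z := posSemidef_vecMulVec_self_star _
  sum_eq_one := by
    ext i j
    rw [Matrix.sum_apply]
    simp only [vecMulVec_apply, Pi.star_apply, one_apply, Pi.single_apply]
    rcases eq_or_ne i j with rfl | hij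
    · simp
    · rw [if_neg hij]
      refine Finset.sum_eq_zero fun z _ => ?_
      by_cases h : i = z
      · subst h; simp [hij.symm]
      · simp [h]

lemma standardPOVM_prob (ρ : Matrix (Fin d) (Fin d) ℂ) (z : Fin d) :
    (standardPOVM d).prob ρ z = (ρ z z).re := by
  simp only [POVM.prob, standardPOVM, mul_vecMulVec, trace_vecMulVec]
  simp [dotProduct, Pi.single_apply]

/-- The random phase `(±1 ± i) / √2`. -/
noncomputable def phase (w : Fin (d + d) → Bool) (j : Fin d) : ℂ :=
  ((sg (w (Fin.castAdd d j)) : ℂ) + (sg (w (Fin.natAdd d j)) : ℂ) * Complex.I) / (√2 : ℝ)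

/-- The entries `ω^(zj)` of the Fourier matrix. -/
noncomputable def fourierEntry (z j : Fin d) : ℂ :=
  (Complex.exp (2 * Real.pi * Complex.I / d) ^ (j : ℕ)) ^ (z : ℕ)

/-- The vectors of the Fourier basis, multiplied by random phases. -/
noncomputable def fourierVec (w : Fin (d + d) → Bool) (z j : Fin d) : ℂ :=
  phase w j * fourierEntry z j / (√d : ℝ)

lemma sqrt_mul_sqrt_complex {x : ℝ} (hx : 0 ≤ x) : ((√x : ℝ) : ℂ) * ((√x : ℝ) : ℂ) = (x : ℂ) := by
  rw [← Complex.ofReal_mul, Real.mul_self_sqrt hx]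

lemma conj_phase_mul_phase (w : Fin (d + d) → Bool) (j k : Fin d) :
    conj (phase w j) * phase w k =
      (((sg (w (Fin.castAdd d j)) * sg (w (Fin.castAdd d k)) +
        sg (w (Fin.natAdd d j)) * sg (w (Fin.natAdd d k))) / 2 : ℝ) : ℂ) +
      (((sg (w (Fin.castAdd d j)) * sg (w (Fin.natAdd d k)) -
        sg (w (Fin.natAdd d j)) * sg (w (Fin.castAdd d k))) / 2 : ℝ) : ℂ) * Complex.I := by
  have h2 := sqrt_mul_sqrt_complex (x := 2) (by norm_num)
  simp only [phase, map_div₀, map_add, map_mul, Complex.conj_ofReal, Complex.conj_I]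
  rw [div_mul_div_comm, h2]
  push_cast
  ring_nf
  rw [Complex.I_sq]
  ring

lemma phase_mul_conj (w : Fin (d + d) → Bool) (j : Fin d) : phase w j * conj (phase w j) = 1 := by
  rw [mul_comm, conj_phase_mul_phase, sg_mul_self, sg_mul_self]
  push_cast
  ring

lemma fourierEntry_mul_conj (hd : 0 < d) (z j : Fin d) :
    fourierEntry z j * conj (fourierEntry z j) = 1 := by
  rw [Complex.mul_conj, Complex.normSq_eq_norm_sq, fourierEntry, norm_pow, norm_pow,
    (Complex.isPrimitiveRoot_exp d hd.ne').norm'_eq_one hd.ne']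
  simp

/-- A geometric sum whose ratio is a `d`-th root of unity different from one. -/
lemma sum_fourierEntry_mul_conj (hd : 0 < d) {j k : Fin d} (hjk : j ≠ k) :
    ∑ z, fourierEntry z j * conj (fourierEntry z k) = 0 := by
  have hω := Complex.isPrimitiveRoot_exp d hd.ne'
  set ω := Complex.exp (2 * Real.pi * Complex.I / d) with hωdef
  have hω1 : ∀ n : ℕ, ω ^ n * conj (ω ^ n) = 1 := by
    intro n
    rw [Complex.mul_conj, Complex.normSq_eq_norm_sq, norm_pow, hω.norm'_eq_one hd.ne']
    simp
  set r := ω ^ (j : ℕ) * conj (ω ^ (k : ℕ)) with hr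
  have hr1 : r ≠ 1 := by
    intro h
    apply hjk
    have h2 : ω ^ (j : ℕ) = ω ^ (k : ℕ) := by
      have h3 : r * ω ^ (k : ℕ) = ω ^ (j : ℕ) * (ω ^ (k : ℕ) * conj (ω ^ (k : ℕ))) := by
        rw [hr]; ring
      rw [hω1, h, one_mul, mul_one] at h3
      exact h3.symm
    exact Fin.ext (hω.pow_inj j.2 k.2 h2)
  have hrd : r ^ d = 1 := by
    rw [hr, mul_pow, ← map_pow, ← pow_mul, ← pow_mul, mul_comm (j : ℕ), mul_comm (k : ℕ), pow_mul, pow_mul,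
      hω.pow_eq_one]
    simp
  have e : ∀ z : Fin d, fourierEntry z j * conj (fourierEntry z k) = r ^ (z : ℕ) := by
    intro z
    simp only [fourierEntry, ← hωdef, hr, mul_pow, map_pow]
  rw [Finset.sum_congr rfl fun z _ => e z, Fin.sum_univ_eq_sum_range (fun n => r ^ n),
    geom_sum_eq hr1, hrd]
  simp

/-- The measurement in the Fourier basis with random phases. -/
noncomputable def fourierPOVM (hd : 0 < d) (w : Fin (d + d) → Bool) : POVM d d where
  effect z := vecMulVec (fourierVec w z) (star (fourierVec w z))
  posSemidef z := posSemidef_vecMulVec_self_star _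
  sum_eq_one := by
    have hdd := sqrt_mul_sqrt_complex (x := (d : ℝ)) (Nat.cast_nonneg d)
    have hd' : (d : ℂ) ≠ 0 := by exact_mod_cast hd.ne'
    ext j k
    rw [Matrix.sum_apply]
    have e : ∀ z, vecMulVec (fourierVec w z) (star (fourierVec w z)) j k =
        phase w j * conj (phase w k) / d * (fourierEntry z j * conj (fourierEntry z k)) := by
      intro z
      simp only [vecMulVec_apply, Pi.star_apply, fourierVec, RCLike.star_def, map_div₀, map_mul,
        Complex.conj_ofReal]
      rw [div_mul_div_comm, hdd]
      push_cast
      ring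
    rw [Finset.sum_congr rfl fun z _ => e z, ← Finset.mul_sum, one_apply]
    split_ifs with hjk
    · subst hjk
      simp only [fourierEntry_mul_conj hd, phase_mul_conj]
      simp [hd']
    · rw [sum_fourierEntry_mul_conj hd hjk, mul_zero]

/-- The coefficients of the probability of the outcome `z`, as a quadratic form in the phases. -/
noncomputable def phaseCoeff (ρ : Matrix (Fin d) (Fin d) ℂ) (z j k : Fin d) : ℂ :=
  if j = k then 0 else ρ j k * (fourierEntry z k * conj (fourierEntry z j)) / d

/-- All entries of the basis vectors have squared modulus `1/d`, so the diagonal of a state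
contributes exactly `1/d` and only the off-diagonal entries meet the phases. -/
lemma fourierPOVM_prob_eq (hd : 0 < d) (w : Fin (d + d) → Bool) {ρ : Matrix (Fin d) (Fin d) ℂ}
    (hρ : IsState ρ) (z : Fin d) :
    (fourierPOVM hd w).prob ρ z - 1 / d =
      ∑ j, ∑ k, (phaseCoeff ρ z j k * (conj (phase w j) * phase w k)).re := by
  have hdd := sqrt_mul_sqrt_complex (x := (d : ℝ)) (Nat.cast_nonneg d)
  have hd' : (d : ℂ) ≠ 0 := by exact_mod_cast hd.ne'
  have e1 : (ρ * (fourierPOVM hd w).effect z).trace =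
      ∑ j, ∑ k, ρ j k * (fourierVec w z k * conj (fourierVec w z j)) := by
    simp only [fourierPOVM, trace, diag_apply, mul_apply, vecMulVec_apply, Pi.star_apply,
      RCLike.star_def]
  have e2 : ∀ j k, ρ j k * (fourierVec w z k * conj (fourierVec w z j)) =
      (if j = k then ρ j j / d else 0) +
        phaseCoeff ρ z j k * (conj (phase w j) * phase w k) := by
    intro j k
    have e3 : fourierVec w z k * conj (fourierVec w z j) =
        (phase w k * conj (phase w j)) * (fourierEntry z k * conj (fourierEntry z j)) / d := by
      simp only [fourierVec, map_div₀, map_mul, Complex.conj_ofReal]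
      rw [div_mul_div_comm, hdd]
      push_cast
      ring
    rw [e3, phaseCoeff]
    split_ifs with hjk
    · subst hjk
      rw [phase_mul_conj, fourierEntry_mul_conj hd]
      ring
    · ring
  have e4 : ∑ j, ρ j j / (d : ℂ) = ((1 / d : ℝ) : ℂ) := by
    have := hρ.trace_eq_one
    rw [← Finset.sum_div]
    simp only [trace, diag_apply] at this
    rw [this]
    push_cast
    rfl
  rw [POVM.prob, e1, Finset.sum_congr rfl fun j _ => Finset.sum_congr rfl fun k _ => e2 j k]
  simp only [Finset.sum_add_distrib, Finset.sum_ite_eq, Finset.mem_univ, if_true]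
  rw [Complex.add_re, e4, Complex.ofReal_re, add_sub_cancel_left]
  simp only [Complex.re_sum]

/-- The coefficients of the outcome probabilities, as a quadratic form in the signs. -/
noncomputable def signCoeff (ρ : Matrix (Fin d) (Fin d) ℂ) (a b : Fin (d + d)) :
    EuclideanSpace ℝ (Fin d) :=
  WithLp.toLp 2 fun z => Fin.addCases
    (fun j => Fin.addCases (fun k => (phaseCoeff ρ z j k).re / 2)
      (fun k => -(phaseCoeff ρ z j k).im / 2) b)
    (fun j => Fin.addCases (fun k => (phaseCoeff ρ z j k).im / 2)
      (fun k => (phaseCoeff ρ z j k).re / 2) b) a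

lemma phaseCoeff_conj {ρ : Matrix (Fin d) (Fin d) ℂ} (hρ : ρ.IsHermitian) (z j k : Fin d) :
    phaseCoeff ρ z k j = conj (phaseCoeff ρ z j k) := by
  simp only [phaseCoeff, eq_comm (a := k)]
  split_ifs
  · simp
  · have : ρ k j = conj (ρ j k) := (hρ.apply k j).symm
    simp only [map_div₀, map_mul, Complex.conj_conj, this, map_natCast]
    ring

lemma signCoeff_symm {ρ : Matrix (Fin d) (Fin d) ℂ} (hρ : ρ.IsHermitian) (a b : Fin (d + d)) :
    signCoeff ρ a b = signCoeff ρ b a := by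
  have hre : ∀ z j k, (phaseCoeff ρ z k j).re = (phaseCoeff ρ z j k).re := fun z j k => by
    rw [phaseCoeff_conj hρ, Complex.conj_re]
  have him : ∀ z j k, (phaseCoeff ρ z k j).im = -(phaseCoeff ρ z j k).im := fun z j k => by
    rw [phaseCoeff_conj hρ, Complex.conj_im]
  ext z
  induction a using Fin.addCases with
  | left j =>
    induction b using Fin.addCases with
    | left k => simp only [signCoeff, Fin.addCases_left, hre z j k]
    | right k => simp only [signCoeff, Fin.addCases_left, Fin.addCases_right, him z j k]
  | right j =>
    induction b using Fin.addCases with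
    | left k => simp only [signCoeff, Fin.addCases_left, Fin.addCases_right, him z j k, neg_neg]
    | right k => simp only [signCoeff, Fin.addCases_right, hre z j k]

lemma signCoeff_diag (ρ : Matrix (Fin d) (Fin d) ℂ) (a : Fin (d + d)) : signCoeff ρ a a = 0 := by
  ext z
  induction a using Fin.addCases <;>
    simp only [signCoeff, phaseCoeff, Fin.addCases_left, Fin.addCases_right, if_true] <;> simp

lemma quadChaos_signCoeff_apply (hd : 0 < d) (w : Fin (d + d) → Bool)
    {ρ : Matrix (Fin d) (Fin d) ℂ} (hρ : IsState ρ) (z : Fin d) :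
    quadChaos (signCoeff ρ) w z = (fourierPOVM hd w).prob ρ z - 1 / d := by
  rw [fourierPOVM_prob_eq hd w hρ]
  simp only [quadChaos, Fin.sum_univ_add, PiLp.add_apply, WithLp.ofLp_sum, Finset.sum_apply,
    WithLp.ofLp_add, WithLp.ofLp_smul, Pi.add_apply, Pi.smul_apply, smul_eq_mul, signCoeff,
    Fin.addCases_left, Fin.addCases_right]
  rw [← Finset.sum_add_distrib]
  refine Finset.sum_congr rfl fun j _ => ?_
  simp only [← Finset.sum_add_distrib]
  refine Finset.sum_congr rfl fun k _ => ?_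
  rw [conj_phase_mul_phase, Complex.mul_re]
  simp
  ring

lemma norm_quadChaos_signCoeff_sq (hd : 0 < d) (w : Fin (d + d) → Bool)
    {ρ : Matrix (Fin d) (Fin d) ℂ} (hρ : IsState ρ) :
    ‖quadChaos (signCoeff ρ) w‖ ^ 2 = ∑ z, ((fourierPOVM hd w).prob ρ z - 1 / d) ^ 2 := by
  rw [EuclideanSpace.norm_sq_eq]
  simp only [quadChaos_signCoeff_apply hd w hρ, Real.norm_eq_abs, sq_abs]

/-- The Fourier entries are unimodular, so every outcome carries the same weight. The four-valued
phases make both the real and the imaginary part of each coefficient appear twice, with factor one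
half, which recovers the full squared modulus. -/
lemma sum_norm_signCoeff_sq (hd : 0 < d) (ρ : Matrix (Fin d) (Fin d) ℂ) :
    ∑ a, ∑ b, ‖signCoeff ρ a b‖ ^ 2 =
      (∑ j, ∑ k, if j = k then 0 else Complex.normSq (ρ j k)) / (2 * d) := by
  have hd' : (d : ℝ) ≠ 0 := by exact_mod_cast hd.ne'
  have hn : ∀ z j k, (phaseCoeff ρ z j k).re ^ 2 + (phaseCoeff ρ z j k).im ^ 2 =
      (if j = k then 0 else Complex.normSq (ρ j k)) / d ^ 2 := by
    intro z j k
    have : (phaseCoeff ρ z j k).re ^ 2 + (phaseCoeff ρ z j k).im ^ 2 =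
        Complex.normSq (phaseCoeff ρ z j k) := by rw [Complex.normSq_apply]; ring
    rw [this, phaseCoeff]
    split_ifs
    · simp
    · have h1 : ∀ i : Fin d, Complex.normSq (fourierEntry z i) = 1 := by
        intro i
        have := fourierEntry_mul_conj hd z i
        rw [Complex.mul_conj] at this
        exact_mod_cast this
      rw [map_div₀, map_mul, map_mul, Complex.normSq_conj, h1, h1, Complex.normSq_natCast]
      ring
  simp only [EuclideanSpace.norm_sq_eq, Real.norm_eq_abs, sq_abs, Fin.sum_univ_add, signCoeff,
    Fin.addCases_left, Fin.addCases_right, ← Finset.sum_add_distrib]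
  rw [Finset.sum_div]
  refine Finset.sum_congr rfl fun j _ => ?_
  rw [Finset.sum_div]
  refine Finset.sum_congr rfl fun k _ => ?_
  calc _ = ∑ z : Fin d, ((phaseCoeff ρ z j k).re ^ 2 + (phaseCoeff ρ z j k).im ^ 2) / 2 :=
        Finset.sum_congr rfl fun z _ => by ring
    _ = _ := by
        simp only [hn, Finset.sum_const, Finset.card_univ, Fintype.card_fin, nsmul_eq_mul]
        field_simp

/-- The measurement in a basis that is chosen with the given random bits. -/
noncomputable def basisPOVM (hd : 0 < d) : Bool × (Fin (d + d) → Bool) → POVM d d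
  | (true, _) => standardPOVM d
  | (false, w) => fourierPOVM hd w

lemma basisPOVM_prob_maximallyMixed (hd : 0 < d) (i : Bool × (Fin (d + d) → Bool)) (z : Fin d) :
    (basisPOVM hd i).prob (maximallyMixed d) z = 1 / d := by
  rw [POVM.prob_maximallyMixed]
  congr 1
  have hd' : (d : ℂ) ≠ 0 := by exact_mod_cast hd.ne'
  obtain ⟨b, w⟩ := i
  cases b with
  | true =>
    simp [basisPOVM, standardPOVM, trace_vecMulVec, dotProduct, Pi.single_apply]
  | false =>
    have hdd := sqrt_mul_sqrt_complex (x := (d : ℝ)) (Nat.cast_nonneg d)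
    have e : ∀ j, fourierVec w z j * conj (fourierVec w z j) = 1 / d := by
      intro j
      have : fourierVec w z j * conj (fourierVec w z j) = (phase w j * conj (phase w j)) *
          (fourierEntry z j * conj (fourierEntry z j)) / d := by
        simp only [fourierVec, map_div₀, map_mul, Complex.conj_ofReal]
        rw [div_mul_div_comm, hdd]
        push_cast
        ring
      rw [this, phase_mul_conj, fourierEntry_mul_conj hd, one_mul]
    simp only [basisPOVM, fourierPOVM, trace_vecMulVec, dotProduct, Pi.star_apply,
      RCLike.star_def, e]
    simp [hd']

open Classical in
/-- A positive fraction of the bases distinguishes a given state from the maximally mixed one. -/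
lemma card_basisPOVM_ge (hd : 0 < d) {ε : ℝ} (hε : 0 < ε) {ρ : Matrix (Fin d) (Fin d) ℂ}
    (hρ : IsState ρ) (hfar : ε < traceNorm (ρ - maximallyMixed d)) :
    1 / 216 * (Fintype.card (Bool × (Fin (d + d) → Bool)) : ℝ) ≤
      ∑ i : Bool × (Fin (d + d) → Bool),
        if ε ^ 2 / (4 * d ^ 2) ≤ ∑ z, ((basisPOVM hd i).prob ρ z - 1 / d) ^ 2
          then (1 : ℝ) else 0 := by
  have hd' : (0 : ℝ) < d := by exact_mod_cast hd
  have hd1 : (1 : ℝ) ≤ d := by exact_mod_cast hd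
  set Δ := ρ - maximallyMixed d with hΔ
  set off := ∑ j, ∑ k, if j = k then 0 else Complex.normSq (ρ j k) with hoff
  set diag := ∑ j, ((ρ j j).re - 1 / d) ^ 2 with hdiag
  have hfrob : (Δᴴ * Δ).trace.re = diag + off := by
    have e1 : (Δᴴ * Δ).trace.re = ∑ k, ∑ j, Complex.normSq (Δ j k) := by
      simp only [trace, diag_apply, mul_apply, conjTranspose_apply, Complex.re_sum,
        RCLike.star_def]
      refine Finset.sum_congr rfl fun k _ => Finset.sum_congr rfl fun j _ => ?_
      rw [← Complex.normSq_eq_conj_mul_self, Complex.ofReal_re]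
    have e2 : ∀ j k, Complex.normSq (Δ j k) =
        (if j = k then ((ρ j j).re - 1 / d) ^ 2 else 0) +
          if j = k then 0 else Complex.normSq (ρ j k) := by
      intro j k
      rw [hΔ, maximallyMixed, Matrix.sub_apply, Matrix.smul_apply, one_apply]
      split_ifs with h
      · subst h
        have him : (ρ j j).im = 0 :=
          (Complex.nonneg_iff.1 (hρ.posSemidef.diag_nonneg (i := j))).2.symm
        rw [Complex.normSq_apply, smul_eq_mul, mul_one,
          show ((d : ℂ)⁻¹) = (((d : ℝ)⁻¹ : ℝ) : ℂ) by push_cast; rfl]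
        simp only [Complex.sub_re, Complex.sub_im, Complex.ofReal_re, Complex.ofReal_im, him]
        ring
      · simp
    rw [e1, Finset.sum_comm]
    simp only [e2, Finset.sum_add_distrib]
    simp [hdiag, hoff]
  have hsum : ε ^ 2 < d * (diag + off) := by
    rw [← hfrob]
    exact (pow_lt_pow_left₀ hfar hε.le two_ne_zero).trans_le (traceNorm_sq_le Δ)
  have h0 : ∀ i : Bool × (Fin (d + d) → Bool), (0 : ℝ) ≤
      if ε ^ 2 / (4 * d ^ 2) ≤ ∑ z, ((basisPOVM hd i).prob ρ z - 1 / d) ^ 2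
        then (1 : ℝ) else 0 := fun i => by split_ifs <;> norm_num
  rw [Fintype.sum_prod_type, Fintype.sum_bool, Fintype.card_prod, Fintype.card_bool]
  have hcard : (Fintype.card (Fin (d + d) → Bool) : ℝ) = 2 ^ (d + d) := by simp
  push_cast
  rw [hcard]
  -- The Frobenius mass exceeds `ε²/d`, so its diagonal or its off-diagonal part is at least half of
  -- that. Either case costs half of the bases, and `1/216` is half of `1/108`.
  rcases le_or_gt (ε ^ 2 / (2 * d)) diag with hcase | hcase
  · have h1 : ε ^ 2 / (4 * d ^ 2) ≤ ∑ z, ((standardPOVM d).prob ρ z - 1 / d) ^ 2 := by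
      simp only [standardPOVM_prob]
      refine le_trans ?_ hcase
      apply div_le_div_of_nonneg_left (sq_nonneg ε) (by positivity)
      nlinarith
    have h2 : ∑ w : Fin (d + d) → Bool,
        (if ε ^ 2 / (4 * d ^ 2) ≤ ∑ z, ((basisPOVM hd (true, w)).prob ρ z - 1 / d) ^ 2
          then (1 : ℝ) else 0) = 2 ^ (d + d) := by
      have h1' : ∀ w, ε ^ 2 / (4 * d ^ 2) ≤
          ∑ z, ((basisPOVM hd (true, w)).prob ρ z - 1 / d) ^ 2 := fun _ => h1
      rw [Finset.sum_congr rfl fun w _ => if_pos (h1' w), Finset.sum_const, Finset.card_univ,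
        nsmul_eq_mul, mul_one]
      exact hcard
    rw [h2]
    have h3 := Finset.sum_nonneg fun w (_ : w ∈ Finset.univ) => h0 (false, w)
    have h4 : (0 : ℝ) < 2 ^ (d + d) := by positivity
    linarith
  · have hcase' : ε ^ 2 / (2 * d) ≤ off := by
      rw [lt_div_iff₀ (by positivity)] at hcase
      rw [div_le_iff₀ (by positivity)]
      linarith
    have h1 := le_cubeMean_ite_quadChaos (signCoeff_symm hρ.posSemidef.1) (signCoeff_diag ρ)
    rw [sum_norm_signCoeff_sq hd, ← hoff] at h1
    have h2 : cubeMean 0 (fun w => if off / (2 * d) ≤ ‖quadChaos (signCoeff ρ) w‖ ^ 2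
        then (1 : ℝ) else 0) ≤ cubeMean 0 (fun w =>
        if ε ^ 2 / (4 * d ^ 2) ≤ ∑ z, ((basisPOVM hd (false, w)).prob ρ z - 1 / d) ^ 2
          then (1 : ℝ) else 0) := by
      refine cubeMean_mono abs_zero_apply_le fun w => ?_
      rw [norm_quadChaos_signCoeff_sq hd w hρ]
      by_cases h : off / (2 * d) ≤ ∑ z, ((fourierPOVM hd w).prob ρ z - 1 / d) ^ 2
      · have h3 : ε ^ 2 / (4 * d ^ 2) ≤ off / (2 * d) := by
          rw [le_div_iff₀ (by positivity)]
          refine le_trans (le_of_eq ?_) hcase'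
          field_simp
          norm_num
        have h5 : ε ^ 2 / (4 * d ^ 2) ≤
          ∑ z, ((basisPOVM hd (false, w)).prob ρ z - 1 / d) ^ 2 := h3.trans h
        rw [if_pos h, if_pos h5]
      · rw [if_neg h]
        exact h0 (false, w)
    rw [cubeMean_zero (fun w => if ε ^ 2 / (4 * d ^ 2) ≤
      ∑ z, ((basisPOVM hd (false, w)).prob ρ z - 1 / d) ^ 2 then (1 : ℝ) else 0)] at h2
    have h3 := Finset.sum_nonneg fun w (_ : w ∈ Finset.univ) => h0 (true, w)
    have h4 : (0 : ℝ) < 2 ^ (d + d) := by positivity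
    have h5 := h1.trans h2
    rw [inv_mul_eq_div, le_div_iff₀ h4] at h5
    linarith

end MixednessTesting

namespace MixednessTesting

open scoped ComplexOrder

/-! ### Independent samples and the collision statistic -/

section Samples

variable {k N : ℕ}

/-- The expectation of `f` over `N` independent samples from `p`. -/
noncomputable def iidMean (p : Fin k → ℝ) (N : ℕ) (f : (Fin N → Fin k) → ℝ) : ℝ :=
  ∑ a, (∏ i, p (a i)) * f a

lemma iidMean_zero (p : Fin k → ℝ) (f : (Fin 0 → Fin k) → ℝ) :
    iidMean p 0 f = f Fin.elim0 := by
  simp only [iidMean, Finset.univ_eq_empty, Finset.prod_empty, one_mul, Fintype.sum_unique]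
  congr 1

lemma iidMean_succ (p : Fin k → ℝ) (f : (Fin (N + 1) → Fin k) → ℝ) :
    iidMean p (N + 1) f = ∑ z, p z * iidMean p N (fun a => f (Fin.cons z a)) := by
  simp only [iidMean, sum_fin_succ_fun, Fin.prod_univ_succ, Fin.cons_zero, Fin.cons_succ,
    Finset.mul_sum, mul_assoc]

lemma iidMean_add (p : Fin k → ℝ) (f g : (Fin N → Fin k) → ℝ) :
    iidMean p N (fun a => f a + g a) = iidMean p N f + iidMean p N g := by
  simp [iidMean, mul_add, Finset.sum_add_distrib]

lemma iidMean_const_mul (p : Fin k → ℝ) (c : ℝ) (f : (Fin N → Fin k) → ℝ) :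
    iidMean p N (fun a => c * f a) = c * iidMean p N f := by
  simp only [iidMean, Finset.mul_sum]
  exact Finset.sum_congr rfl fun a _ => by ring

lemma iidMean_sum {ι : Type*} (s : Finset ι) (p : Fin k → ℝ) (f : ι → (Fin N → Fin k) → ℝ) :
    iidMean p N (fun a => ∑ i ∈ s, f i a) = ∑ i ∈ s, iidMean p N (f i) := by
  simp only [iidMean, Finset.mul_sum]
  exact Finset.sum_comm

lemma iidMean_const {p : Fin k → ℝ} (hp : ∑ z, p z = 1) (c : ℝ) :
    iidMean p N (fun _ => c) = c := by
  induction N with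
  | zero => rw [iidMean_zero]
  | succ N ih => rw [iidMean_succ]; simp [ih, ← Finset.sum_mul, hp]

lemma iidMean_mono {p : Fin k → ℝ} (hp0 : ∀ z, 0 ≤ p z) {f g : (Fin N → Fin k) → ℝ}
    (h : ∀ a, f a ≤ g a) : iidMean p N f ≤ iidMean p N g :=
  Finset.sum_le_sum fun a _ =>
    mul_le_mul_of_nonneg_left (h a) (Finset.prod_nonneg fun _ _ => hp0 _)

lemma iidMean_sum_apply {p : Fin k → ℝ} (hp : ∑ z, p z = 1) (g : Fin k → ℝ) :
    iidMean p N (fun a => ∑ i, g (a i)) = N * ∑ z, p z * g z := by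
  induction N with
  | zero => simp [iidMean_zero]
  | succ N ih =>
    rw [iidMean_succ]
    simp only [Fin.sum_univ_succ, Fin.cons_zero, Fin.cons_succ, iidMean_add, iidMean_const hp, ih,
      mul_add, Finset.sum_add_distrib, ← Finset.sum_mul, hp]
    push_cast
    ring

lemma iidMean_sum_apply_sq {p : Fin k → ℝ} (hp : ∑ z, p z = 1) (g : Fin k → ℝ) :
    iidMean p N (fun a => (∑ i, g (a i)) ^ 2) =
      N * ∑ z, p z * g z ^ 2 + N * (N - 1) * (∑ z, p z * g z) ^ 2 := by
  induction N with
  | zero => simp [iidMean_zero]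
  | succ N ih =>
    rw [iidMean_succ]
    have e : ∀ z, iidMean p N (fun a => (∑ i, g ((Fin.cons z a : Fin (N + 1) → Fin k) i)) ^ 2) =
        g z ^ 2 + (2 * (N * ∑ z, p z * g z)) * g z +
          (N * ∑ z, p z * g z ^ 2 + N * (N - 1) * (∑ z, p z * g z) ^ 2) := by
      intro z
      simp only [Fin.sum_univ_succ, Fin.cons_zero, Fin.cons_succ, add_sq, iidMean_add,
        iidMean_const hp, ih, iidMean_const_mul, iidMean_sum_apply hp]
      ring
    have e2 : ∀ z, p z * (g z ^ 2 + (2 * (N * ∑ z, p z * g z)) * g z +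
        (N * ∑ z, p z * g z ^ 2 + N * (N - 1) * (∑ z, p z * g z) ^ 2)) =
        p z * g z ^ 2 + (2 * (N * ∑ z, p z * g z)) * (p z * g z) +
          p z * (N * ∑ z, p z * g z ^ 2 + N * (N - 1) * (∑ z, p z * g z) ^ 2) :=
      fun z => by ring
    rw [Finset.sum_congr rfl fun z _ => by rw [e z, e2 z]]
    rw [Finset.sum_add_distrib, Finset.sum_add_distrib, ← Finset.mul_sum, ← Finset.sum_mul, hp]
    push_cast
    ring

/-- The centred collision kernel. -/
noncomputable def collisionKernel (k : ℕ) (x y : Fin k) : ℝ := (if x = y then 1 else 0) - 1 / k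

/-- The centred number of collisions between two samples. -/
noncomputable def collisions (a b : Fin N → Fin k) : ℝ := ∑ j, ∑ i, collisionKernel k (a i) (b j)

/-- The squared distance of `p` from the uniform distribution. -/
noncomputable def uniformDist (p : Fin k → ℝ) : ℝ := ∑ z, (p z - 1 / k) ^ 2

lemma uniformDist_nonneg (p : Fin k → ℝ) : 0 ≤ uniformDist p :=
  Finset.sum_nonneg fun _ _ => sq_nonneg _

variable {p : Fin k → ℝ}

lemma sum_mul_collisionKernel (hp : ∑ z, p z = 1) (x : Fin k) :
    ∑ y, p y * collisionKernel k x y = p x - 1 / k := by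
  simp only [collisionKernel, mul_sub, Finset.sum_sub_distrib, ← Finset.sum_mul, hp]
  simp

lemma collisionKernel_comm (x y : Fin k) : collisionKernel k x y = collisionKernel k y x := by
  simp only [collisionKernel, eq_comm]

lemma sum_mul_sub_uniform (hk : 0 < k) (hp : ∑ z, p z = 1) :
    ∑ x, p x * (p x - 1 / k) = uniformDist p := by
  have hk' : (k : ℝ) ≠ 0 := by exact_mod_cast hk.ne'
  have e : ∀ x, p x * (p x - 1 / k) = (p x - 1 / k) ^ 2 + 1 / k * (p x - 1 / k) :=
    fun x => by ring
  simp only [e, Finset.sum_add_distrib, ← Finset.mul_sum, Finset.sum_sub_distrib, hp, uniformDist]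
  simp [hk']

lemma sum_sq_eq (hk : 0 < k) (hp : ∑ z, p z = 1) :
    ∑ x, p x * p x = uniformDist p + 1 / k := by
  have := sum_mul_sub_uniform hk hp
  simp only [mul_sub, Finset.sum_sub_distrib, ← Finset.sum_mul, hp] at this
  linarith

lemma sum_mul_collisionKernel_sq_le (hk : 0 < k) (hp : ∑ z, p z = 1) :
    ∑ y, p y * ∑ x, p x * collisionKernel k x y ^ 2 ≤ uniformDist p + 1 / k := by
  have hk' : (k : ℝ) ≠ 0 := by exact_mod_cast hk.ne'
  have e : ∀ x y : Fin k, p x * collisionKernel k x y ^ 2 =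
      (if x = y then p x * (1 - 2 / k) else 0) + p x * (1 / k ^ 2) := by
    intro x y
    rw [collisionKernel]
    split_ifs <;> field_simp <;> ring
  simp only [e, Finset.sum_add_distrib, ← Finset.sum_mul, hp, Finset.sum_ite_eq',
    Finset.mem_univ, if_true, mul_add]
  simp only [← mul_assoc, ← Finset.sum_mul, sum_sq_eq hk hp]
  have h1 := uniformDist_nonneg p
  have h2 : (0 : ℝ) ≤ 1 / k := by positivity
  have h3 : (uniformDist p + 1 / k) * (1 - 2 / k) + 1 * 1 * (1 / (k : ℝ) ^ 2) =
      uniformDist p + 1 / k - 2 * (uniformDist p * (1 / k)) - (1 / k) ^ 2 := by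
    field_simp
    ring
  rw [one_mul] at h3 ⊢
  rw [h3]
  have := mul_nonneg h1 h2
  linarith [sq_nonneg (1 / (k : ℝ))]

/-- One factor `p x` is at most `1/k` plus the `ℓ²` deviation. This controls the cubic term in the
collision variance. -/
lemma sum_mul_sub_uniform_sq_le :
    ∑ x, p x * (p x - 1 / k) ^ 2 ≤ uniformDist p * (1 / k + √(uniformDist p)) := by
  have h : ∀ x, p x - 1 / k ≤ √(uniformDist p) := fun x =>
    Real.le_sqrt_of_sq_le (Finset.single_le_sum (f := fun x => (p x - 1 / k) ^ 2)
      (fun _ _ => sq_nonneg _) (Finset.mem_univ x))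
  rw [uniformDist, Finset.sum_mul]
  refine Finset.sum_le_sum fun x _ => ?_
  rw [← uniformDist, mul_comm]
  refine mul_le_mul_of_nonneg_left ?_ (sq_nonneg _)
  linarith [h x]

lemma iidMean_collisions (hk : 0 < k) (hp : ∑ z, p z = 1) :
    iidMean p N (fun a => iidMean p N (fun b => collisions a b)) = N ^ 2 * uniformDist p := by
  have e : ∀ a : Fin N → Fin k, iidMean p N (fun b => collisions a b) =
      N * ∑ i, (p (a i) - 1 / k) := by
    intro a
    simp only [collisions]
    rw [iidMean_sum_apply hp (fun y => ∑ i, collisionKernel k (a i) y)]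
    congr 1
    simp only [Finset.mul_sum]
    rw [Finset.sum_comm]
    exact Finset.sum_congr rfl fun i _ => sum_mul_collisionKernel hp _
  simp only [e]
  rw [iidMean_const_mul, iidMean_sum_apply hp (fun x => p x - 1 / k), sum_mul_sub_uniform hk hp]
  ring

/-- Collisions are counted between two independent batches, so conditionally on the first batch the
statistic is a sum of independent terms, and the formula for the square of such a sum is applied
twice. The three terms come from pairs of collisions sharing both samples, one sample, or none. -/
lemma iidMean_collisions_sq_le (hk : 0 < k) (hp : ∑ z, p z = 1) (hp0 : ∀ z, 0 ≤ p z) :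
    iidMean p N (fun a => iidMean p N (fun b => collisions a b ^ 2)) ≤
      N ^ 2 * (uniformDist p + 1 / k) +
      2 * N ^ 3 * (uniformDist p * (1 / k + √(uniformDist p))) + N ^ 4 * uniformDist p ^ 2 := by
  have e : ∀ a : Fin N → Fin k, iidMean p N (fun b => collisions a b ^ 2) =
      N * ∑ y, p y * (∑ i, collisionKernel k (a i) y) ^ 2 +
        N * (N - 1) * (∑ i, (p (a i) - 1 / k)) ^ 2 := by
    intro a
    simp only [collisions]
    rw [iidMean_sum_apply_sq hp (fun y => ∑ i, collisionKernel k (a i) y)]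
    congr 3
    simp only [Finset.mul_sum]
    rw [Finset.sum_comm]
    exact Finset.sum_congr rfl fun i _ => sum_mul_collisionKernel hp _
  simp only [e]
  rw [iidMean_add, iidMean_const_mul, iidMean_const_mul, iidMean_sum,
    iidMean_sum_apply_sq hp (fun x => p x - 1 / k), sum_mul_sub_uniform hk hp]
  have e2 : ∀ y, iidMean p N (fun a => p y * (∑ i, collisionKernel k (a i) y) ^ 2) =
      N * (p y * ∑ x, p x * collisionKernel k x y ^ 2) +
        N * (N - 1) * (p y * (p y - 1 / k) ^ 2) := by
    intro y
    rw [iidMean_const_mul, iidMean_sum_apply_sq hp (fun x => collisionKernel k x y)]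
    have : ∑ z, p z * collisionKernel k z y = p y - 1 / k := by
      simp only [collisionKernel_comm _ y]
      exact sum_mul_collisionKernel hp y
    rw [this]
    ring
  simp only [e2, Finset.sum_add_distrib, ← Finset.mul_sum]
  have h1 := sum_mul_collisionKernel_sq_le hk hp
  have h2 := sum_mul_sub_uniform_sq_le (p := p)
  have h20 : 0 ≤ ∑ x, p x * (p x - 1 / k) ^ 2 :=
    Finset.sum_nonneg fun x _ => mul_nonneg (hp0 x) (sq_nonneg _)
  set K := ∑ y, p y * ∑ x, p x * collisionKernel k x y ^ 2
  set R := ∑ x, p x * (p x - 1 / k) ^ 2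
  set X := uniformDist p
  have hX := uniformDist_nonneg p
  have hN0 : (0 : ℝ) ≤ N := Nat.cast_nonneg N
  have hN : (N : ℝ) * (N - 1) ≤ N * N := by nlinarith
  have e3 : (N : ℝ) * (N * K + N * (N - 1) * R) +
      N * (N - 1) * (N * R + N * (N - 1) * X ^ 2) =
      N ^ 2 * K + 2 * (N * (N * (N - 1))) * R + (N * (N - 1)) ^ 2 * X ^ 2 := by ring
  have hN1 : 0 ≤ (N : ℝ) * (N - 1) := by
    rcases Nat.eq_zero_or_pos N with h | h
    · simp [h]
    · have : (1 : ℝ) ≤ N := by exact_mod_cast h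
      nlinarith
  rw [e3]
  have k1 : (N : ℝ) ^ 2 * K ≤ N ^ 2 * (X + 1 / k) := by gcongr
  have k2 : 2 * (N * (N * ((N : ℝ) - 1))) * R ≤ 2 * N ^ 3 * (X * (1 / k + √X)) := by
    calc _ ≤ 2 * (N * ((N : ℝ) * N)) * R := by gcongr
      _ = 2 * (N : ℝ) ^ 3 * R := by ring
      _ ≤ _ := by gcongr
  have k3 : ((N : ℝ) * (N - 1)) ^ 2 * X ^ 2 ≤ N ^ 4 * X ^ 2 := by
    calc _ ≤ ((N : ℝ) * N) ^ 2 * X ^ 2 := by gcongr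
      _ = _ := by ring
  linarith

/-- The probability that the collision test with the threshold `t` accepts. -/
noncomputable def acceptProb (p : Fin k → ℝ) (N : ℕ) (t : ℝ) : ℝ :=
  iidMean p N (fun a => iidMean p N (fun b => if t < collisions a b then 0 else 1))

lemma iidMean_iidMean_mono (hp0 : ∀ z, 0 ≤ p z) {f g : (Fin N → Fin k) → (Fin N → Fin k) → ℝ}
    (h : ∀ a b, f a b ≤ g a b) :
    iidMean p N (fun a => iidMean p N (f a)) ≤ iidMean p N (fun a => iidMean p N (g a)) :=
  iidMean_mono hp0 fun a => iidMean_mono hp0 (h a)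

lemma acceptProb_le_one (hp : ∑ z, p z = 1) (hp0 : ∀ z, 0 ≤ p z) (t : ℝ) :
    acceptProb p N t ≤ 1 := by
  refine (iidMean_iidMean_mono hp0 (g := fun _ _ => 1) fun a b => ?_).trans ?_
  · split_ifs <;> norm_num
  · simp [iidMean_const hp]

lemma acceptProb_nonneg (hp : ∑ z, p z = 1) (hp0 : ∀ z, 0 ≤ p z) (t : ℝ) :
    0 ≤ acceptProb p N t := by
  refine le_trans ?_ (iidMean_iidMean_mono hp0 (f := fun _ _ => 0) fun a b => ?_)
  · simp [iidMean_const hp]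
  · split_ifs <;> norm_num

/-- The collision test accepts the uniform distribution. -/
lemma le_acceptProb_uniform (hk : 0 < k) (hp : ∀ z, p z = 1 / k) {t : ℝ} (ht : 0 < t) :
    1 - N ^ 2 / (k * t ^ 2) ≤ acceptProb p N t := by
  have hk' : (k : ℝ) ≠ 0 := by exact_mod_cast hk.ne'
  have hsum : ∑ z, p z = 1 := by simp [hp, hk']
  have hp0 : ∀ z, 0 ≤ p z := fun z => by rw [hp]; positivity
  have hX : uniformDist p = 0 := by simp [uniformDist, hp]
  have h2 := iidMean_collisions_sq_le (N := N) hk hsum hp0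
  rw [hX] at h2
  have h1 : iidMean p N (fun a => iidMean p N (fun b => 1 + -(1 / t ^ 2) * collisions a b ^ 2)) ≤
      acceptProb p N t := by
    refine iidMean_iidMean_mono hp0 fun a b => ?_
    split_ifs with h
    · have : 1 ≤ 1 / t ^ 2 * collisions a b ^ 2 := by
        rw [one_div_mul_eq_div, one_le_div (by positivity)]
        gcongr
      linarith
    · have : 0 ≤ 1 / t ^ 2 * collisions a b ^ 2 := by positivity
      linarith
  simp only [iidMean_add, iidMean_const hsum, iidMean_const_mul] at h1
  refine le_trans ?_ h1
  have h3 : 1 / t ^ 2 * iidMean p N (fun a => iidMean p N (fun b => collisions a b ^ 2)) ≤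
      1 / t ^ 2 * (N ^ 2 * (1 / k)) := by
    refine mul_le_mul_of_nonneg_left ?_ (by positivity)
    simpa using h2
  have e : 1 / t ^ 2 * ((N : ℝ) ^ 2 * (1 / k)) = N ^ 2 / (k * t ^ 2) := by field_simp
  linarith

/-- The collision test rejects distributions far from uniform. -/
lemma acceptProb_le_far (hk : 0 < k) (hp : ∑ z, p z = 1) (hp0 : ∀ z, 0 ≤ p z) {τ : ℝ}
    (hτ : 0 < τ) (hX : τ ≤ uniformDist p) (hN : 0 < N) :
    acceptProb p N (N ^ 2 * τ / 2) ≤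
      4 * (1 / (N ^ 2 * τ) + 1 / (k * (N * τ) ^ 2) + 2 / (k * (N * τ)) + 2 / (N * √τ)) := by
  have hk' : (0 : ℝ) < k := by exact_mod_cast hk
  have hN' : (0 : ℝ) < N := by exact_mod_cast hN
  have h2 := iidMean_collisions_sq_le (N := N) hk hp hp0
  have h1 := iidMean_collisions (N := N) hk hp
  set X := uniformDist p with hXdef
  have hX0 : 0 < X := hτ.trans_le hX
  have hle : acceptProb p N (N ^ 2 * τ / 2) ≤ iidMean p N (fun a => iidMean p N (fun b =>
      4 / (N ^ 2 * X) ^ 2 * (collisions a b ^ 2 + -(2 * (N ^ 2 * X)) * collisions a b +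
        (N ^ 2 * X) ^ 2))) := by
    -- Chebyshev's inequality: the threshold is at most half the mean `N²X`, so acceptance forces a
    -- deviation of at least half the mean.
    refine iidMean_iidMean_mono hp0 fun a b => ?_
    have e : collisions a b ^ 2 + -(2 * (N ^ 2 * X)) * collisions a b + (N ^ 2 * X) ^ 2 =
      (N ^ 2 * X - collisions a b) ^ 2 := by ring
    rw [e]
    split_ifs with h
    · positivity
    · have h3 : N ^ 2 * X / 2 ≤ N ^ 2 * X - collisions a b := by
        have : (N : ℝ) ^ 2 * τ ≤ N ^ 2 * X := by gcongr
        linarith [not_lt.1 h]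
      have h4 : (N ^ 2 * X / 2) ^ 2 ≤ (N ^ 2 * X - collisions a b) ^ 2 := by gcongr
      rw [div_mul_eq_mul_div, le_div_iff₀ (by positivity)]
      linarith
  simp only [iidMean_const_mul, iidMean_add, iidMean_const hp, h1] at hle
  refine hle.trans ?_
  have h3 : iidMean p N (fun a => iidMean p N (fun b => collisions a b ^ 2)) +
      -(2 * ((N : ℝ) ^ 2 * X)) * (N ^ 2 * X) + (N ^ 2 * X) ^ 2 ≤
      N ^ 2 * (X + 1 / k) + 2 * N ^ 3 * (X * (1 / k + √X)) := by
    have e : -(2 * ((N : ℝ) ^ 2 * X)) * (N ^ 2 * X) + (N ^ 2 * X) ^ 2 = -(N ^ 4 * X ^ 2) := by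
      ring
    linarith
  have h4 : 4 / ((N : ℝ) ^ 2 * X) ^ 2 * (N ^ 2 * (X + 1 / k) +
      2 * N ^ 3 * (X * (1 / k + √X))) =
      4 * (1 / (N ^ 2 * X) + 1 / (k * (N * X) ^ 2) + 2 / (k * (N * X)) + 2 / (N * √X)) := by
    have hs : √X ^ 2 = X := Real.sq_sqrt hX0.le
    have hs0 : 0 < √X := Real.sqrt_pos.2 hX0
    have e : 2 / ((N : ℝ) * √X) = 2 * √X / (N * X) := by
      rw [div_eq_div_iff (by positivity) (by positivity)]
      linear_combination (-2 * N : ℝ) * hs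
    rw [e]
    field_simp
    ring
  refine (mul_le_mul_of_nonneg_left h3 (by positivity)).trans (h4.le.trans ?_)
  -- Every term decreases in the distance, so the true distance may be replaced by its lower bound
  -- `τ`.
  gcongr

end Samples

/-! ### The tester -/

variable {d : ℕ}

/-- The measurement that ignores the state and returns a uniformly random outcome. -/
noncomputable def uniformPOVM (d : ℕ) {L : ℕ} (hL : 0 < L) : POVM d L where
  effect _ := ((L : ℂ)⁻¹) • 1
  posSemidef _ := by
    refine Matrix.PosSemidef.smul Matrix.PosSemidef.one ?_
    rw [show ((L : ℂ)⁻¹) = (((L : ℝ)⁻¹ : ℝ) : ℂ) by push_cast; rfl]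
    exact Complex.zero_le_real.2 (by positivity)
  sum_eq_one := by
    have : (L : ℂ) ≠ 0 := by exact_mod_cast hL.ne'
    rw [Finset.sum_const, Finset.card_univ, Fintype.card_fin, ← Nat.cast_smul_eq_nsmul ℂ,
      smul_smul, mul_inv_cancel₀ this, one_smul]

lemma uniformPOVM_prob {L : ℕ} (hL : 0 < L) {ρ : Matrix (Fin d) (Fin d) ℂ} (hρ : IsState ρ)
    (z : Fin L) : (uniformPOVM d hL).prob ρ z = 1 / L := by
  simp only [POVM.prob, uniformPOVM]
  rw [mul_smul_comm, mul_one, Matrix.trace_smul, hρ.trace_eq_one, smul_eq_mul, mul_one,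
    show ((L : ℂ)⁻¹) = (((L : ℝ)⁻¹ : ℝ) : ℂ) by push_cast; rfl, Complex.ofReal_re, one_div]

/-- The algorithm of depth `n` that always gives the same answer. -/
noncomputable def constAlgorithm (d : ℕ) (a : Answer) : (n : ℕ) → IncoherentAlgorithm d n
  | 0 => .output a
  | n + 1 => .measure (uniformPOVM d one_pos) fun _ => constAlgorithm d a n

lemma answerProb_constAlgorithm {ρ : Matrix (Fin d) (Fin d) ℂ} (hρ : IsState ρ) (a b : Answer)
    (n : ℕ) : (constAlgorithm d a n).answerProb ρ b = if a = b then 1 else 0 := by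
  induction n with
  | zero => rfl
  | succ n ih =>
    simp [constAlgorithm, IncoherentAlgorithm.answerProb, ih, uniformPOVM_prob one_pos hρ]

/-- Apply the same measurement `N` times and continue depending on the outcomes. -/
noncomputable def iterMeasure {k n : ℕ} (M : POVM d k) :
    (N : ℕ) → ((Fin N → Fin k) → IncoherentAlgorithm d n) → IncoherentAlgorithm d (n + N)
  | 0, next => next Fin.elim0
  | N + 1, next => .measure M fun z => iterMeasure M N fun a => next (Fin.cons z a)

lemma answerProb_iterMeasure {k n N : ℕ} (M : POVM d k)
    (next : (Fin N → Fin k) → IncoherentAlgorithm d n) (ρ : Matrix (Fin d) (Fin d) ℂ)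
    (c : Answer) :
    (iterMeasure M N next).answerProb ρ c =
      iidMean (M.prob ρ) N fun a => (next a).answerProb ρ c := by
  induction N with
  | zero => rw [iidMean_zero]; rfl
  | succ N ih =>
    rw [iidMean_succ]
    simp only [iterMeasure, IncoherentAlgorithm.answerProb, ih]

/-- Repeating a collision test with measurements from a random member of a family. -/
lemma exists_repeated_test {L k : ℕ} (hL : 0 < L) (M : Fin L → POVM d k) (N : ℕ) (t : ℝ) (K : ℕ) :
    ∃ n, n = K * (2 * N + 1) ∧ ∃ A : IncoherentAlgorithm d n, ∀ ρ, IsState ρ →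
      A.answerProb ρ .mixed = (∑ i, 1 / (L : ℝ) * acceptProb ((M i).prob ρ) N t) ^ K := by
  classical
  induction K with
  | zero => exact ⟨0, by simp, .output .mixed, fun ρ _ => by simp [IncoherentAlgorithm.answerProb]⟩
  | succ K ih =>
    obtain ⟨n, hn, A, hA⟩ := ih
    -- Each round spends one copy on a measurement that merely draws the basis, and two batches of
    -- `N` copies on the collision test. A rejection is padded by a constant tree to keep the depth
    -- fixed; acceptance continues with the remaining rounds, so the acceptance probabilities
    -- multiply.
    refine ⟨n + N + N + 1, by rw [hn]; ring, .measure (uniformPOVM d hL) fun i =>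
      iterMeasure (M i) N fun a => iterMeasure (M i) N fun b =>
        if t < collisions a b then constAlgorithm d .far n else A, fun ρ hρ => ?_⟩
    have e : ∀ a b : Fin N → Fin k, (if t < collisions a b then
        constAlgorithm d .far n else A).answerProb ρ .mixed =
        A.answerProb ρ .mixed * if t < collisions a b then 0 else 1 := by
      intro a b
      split_ifs
      · rw [answerProb_constAlgorithm hρ]; simp
      · simp
    simp only [IncoherentAlgorithm.answerProb, answerProb_iterMeasure, e, iidMean_const_mul,
      uniformPOVM_prob hL hρ]
    rw [pow_succ, ← hA ρ hρ, mul_comm, Finset.sum_mul]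
    refine Finset.sum_congr rfl fun i _ => ?_
    rw [acceptProb]
    ring

end MixednessTesting

/-! ### Correctness and cost of the tester -/

namespace MixednessTesting

open scoped ComplexOrder

variable {d : ℕ}

lemma maximallyMixed_isState (hd : 0 < d) : IsState (maximallyMixed d) where
  posSemidef := by
    refine Matrix.PosSemidef.smul Matrix.PosSemidef.one ?_
    rw [show ((d : ℂ)⁻¹) = (((d : ℝ)⁻¹ : ℝ) : ℂ) by push_cast; rfl]
    exact Complex.zero_le_real.2 (by positivity)
  trace_eq_one := by
    have : (d : ℂ) ≠ 0 := by exact_mod_cast hd.ne'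
    simp [maximallyMixed, this]

lemma POVM.prob_nonneg {k : ℕ} (M : POVM d k) {ρ : Matrix (Fin d) (Fin d) ℂ} (hρ : IsState ρ)
    (z : Fin k) : 0 ≤ M.prob ρ z :=
  re_trace_mul_nonneg hρ.posSemidef (M.posSemidef z)

/-- The single requirement `N τ √d ≥ 200` makes all four variance terms small; `d τ ≤ 1` turns it
into `N √τ ≥ 200`. -/
lemma acceptProb_basisPOVM_le (hd : 0 < d) (i : Bool × (Fin (d + d) → Bool))
    {ρ : Matrix (Fin d) (Fin d) ℂ} (hρ : IsState ρ) {τ : ℝ} (hτ : 0 < τ) (hdτ : d * τ ≤ 1)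
    {N : ℕ} (hN : 0 < N) (hNτ : 200 ≤ N * τ * √d)
    (hX : τ ≤ uniformDist ((basisPOVM hd i).prob ρ)) :
    acceptProb ((basisPOVM hd i).prob ρ) N (N ^ 2 * τ / 2) ≤ 1 / 2 := by
  refine (acceptProb_le_far hd (POVM.sum_prob _ hρ) (POVM.prob_nonneg _ hρ) hτ hX hN).trans ?_
  have hd1 : (1 : ℝ) ≤ d := by exact_mod_cast hd
  have hD : 1 ≤ √(d : ℝ) := Real.one_le_sqrt.2 hd1
  have hDD : √(d : ℝ) ^ 2 = d := Real.sq_sqrt (by positivity)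
  have hss : √τ ^ 2 = τ := Real.sq_sqrt hτ.le
  have hs : 0 < √τ := Real.sqrt_pos.2 hτ
  have hN' : (0 : ℝ) < N := by exact_mod_cast hN
  have hDs : √d * √τ ≤ 1 := by
    rw [← Real.sqrt_mul (by positivity)]
    exact Real.sqrt_le_one.2 hdτ
  have ha : 200 ≤ N * √τ := by
    have h1 : N * τ * √d = (N * √τ) * (√d * √τ) := by
      rw [← hss]; simp only [Real.sqrt_sq hs.le]; ring
    rw [h1] at hNτ
    exact hNτ.trans (mul_le_of_le_one_right (by positivity) hDs)
  have b1 : 1 / (N ^ 2 * τ) ≤ 1 / 200 ^ 2 := by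
    refine one_div_le_one_div_of_le (by norm_num) ?_
    calc (200 : ℝ) ^ 2 ≤ (N * √τ) ^ 2 := by gcongr
      _ = N ^ 2 * τ := by rw [mul_pow, hss]
  have b2 : 1 / (d * (N * τ) ^ 2) ≤ 1 / 200 ^ 2 := by
    refine one_div_le_one_div_of_le (by norm_num) ?_
    calc (200 : ℝ) ^ 2 ≤ (N * τ * √d) ^ 2 := by gcongr
      _ = d * (N * τ) ^ 2 := by rw [mul_pow _ (√(d : ℝ)), hDD, mul_comm]
  have b3 : 2 / (d * (N * τ)) ≤ 2 / 200 := by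
    refine div_le_div_of_nonneg_left (by norm_num) (by norm_num) ?_
    calc (200 : ℝ) ≤ N * τ * √d := hNτ
      _ ≤ N * τ * √d * √d := le_mul_of_one_le_right (by positivity) hD
      _ = d * (N * τ) := by rw [← hDD]; simp only [Real.sqrt_sq (zero_le_one.trans hD)]; ring
  have b4 : 2 / (N * √τ) ≤ 2 / 200 :=
    div_le_div_of_nonneg_left (by norm_num) (by norm_num) ha
  linarith

/-- `O(d^{3/2} / ε²)` incoherent measurements suffice for testing mixedness. -/
theorem upper_bound (hd : 0 < d) {ε : ℝ} (hε : 0 < ε) (hε' : ε ≤ 1 / 12) :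
    ∃ n : ℕ, n * ε ^ 2 ≤ 10 ^ 7 * √(d : ℝ) ^ 3 ∧
      ∃ A : IncoherentAlgorithm d n, A.TestsMixedness ε := by
  classical
  have hd1 : (1 : ℝ) ≤ d := by exact_mod_cast hd
  have hD : 1 ≤ √(d : ℝ) := Real.one_le_sqrt.2 hd1
  have hDD : √(d : ℝ) ^ 2 = d := Real.sq_sqrt (by positivity)
  set D := √(d : ℝ)
  have hD3 : 1 ≤ D ^ 3 := one_le_pow₀ hD
  have hε2 : ε ^ 2 ≤ 1 := pow_le_one₀ hε.le (by linarith)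
  set τ : ℝ := ε ^ 2 / (4 * d ^ 2) with hτ
  have hτ0 : 0 < τ := by positivity
  have hdτ : d * τ ≤ 1 := by
    rw [hτ, mul_div_assoc', div_le_one (by positivity)]
    nlinarith
  -- With `τ = ε²/(4d²)`, this is the size at which `N τ √d` reaches 200.
  set N : ℕ := ⌈800 * D ^ 3 / ε ^ 2⌉₊ with hN
  have hN0 : 0 < N := Nat.ceil_pos.2 (by positivity)
  have hNge : 800 * D ^ 3 ≤ N * ε ^ 2 :=
    (div_le_iff₀ (by positivity)).1 (Nat.le_ceil _)
  have hNle : N * ε ^ 2 ≤ 801 * D ^ 3 := by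
    have h1 := (Nat.ceil_lt_add_one (show 0 ≤ 800 * D ^ 3 / ε ^ 2 by positivity)).le
    rw [← hN, div_add_one (by positivity), le_div_iff₀ (by positivity)] at h1
    linarith
  have hNτ : 200 ≤ N * τ * D := by
    have h1 : N * τ * D = N * ε ^ 2 / (4 * D ^ 3) := by
      rw [hτ, ← hDD]
      field_simp
    rw [h1, le_div_iff₀ (by positivity)]
    linarith
  set ι := Bool × (Fin (d + d) → Bool)
  set L := Fintype.card ι with hL
  have hL0 : 0 < L := Fintype.card_pos
  have hL' : (0 : ℝ) < L := by exact_mod_cast hL0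
  -- A far state is rejected in one round with probability at least `1/216 · 1/2 = 1/432`, and `864
  -- = 2 · 432` rounds bring acceptance below `exp (-2)`. The mixed state fails a round with
  -- probability at most `1/2592`, and `864/2592 = 1/3`.
  obtain ⟨n, hn, A, hA⟩ := exists_repeated_test hL0
    (fun i => basisPOVM hd ((Fintype.equivFin ι).symm i)) N (N ^ 2 * τ / 2) 864
  have hA' : ∀ ρ, IsState ρ → A.answerProb ρ .mixed =
      (1 / L * ∑ i, acceptProb ((basisPOVM hd i).prob ρ) N (N ^ 2 * τ / 2)) ^ 864 := by
    intro ρ hρ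
    rw [hA ρ hρ, ← Finset.mul_sum]
    congr 2
    exact (Fintype.equivFin ι).symm.sum_comp
      fun i => acceptProb ((basisPOVM hd i).prob ρ) N (N ^ 2 * τ / 2)
  refine ⟨n, ?_, A, ?_, fun ρ hρ hfar => ?_⟩
  · rw [hn]
    push_cast
    linarith
  · rw [hA' _ (maximallyMixed_isState hd)]
    have h1 : ∀ i, (2591 / 2592 : ℝ) ≤
        acceptProb ((basisPOVM hd i).prob (maximallyMixed d)) N (N ^ 2 * τ / 2) := by
      intro i
      refine le_trans ?_ (le_acceptProb_uniform hd (basisPOVM_prob_maximallyMixed hd i)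
        (by positivity))
      have h2 : (N : ℝ) ^ 2 / (d * (N ^ 2 * τ / 2) ^ 2) = 4 / (N * τ * D) ^ 2 := by
        have : (0 : ℝ) < N := by exact_mod_cast hN0
        rw [mul_pow _ D, hDD]
        field_simp
        norm_num
      have h3 : 4 / (N * τ * D) ^ 2 ≤ 4 / 200 ^ 2 := by gcongr
      rw [h2]
      linarith
    have h2 : (2591 / 2592 : ℝ) ≤
        1 / L * ∑ i, acceptProb ((basisPOVM hd i).prob (maximallyMixed d)) N (N ^ 2 * τ / 2) := by
      rw [one_div_mul_eq_div, le_div_iff₀ hL', mul_comm, ← nsmul_eq_mul, hL]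
      exact Finset.card_nsmul_le_sum _ _ _ fun i _ => h1 i
    have h3 := one_add_mul_le_pow (show (-2 : ℝ) ≤ -(1 / 2592) by norm_num) 864
    calc (2 / 3 : ℝ) ≤ (2591 / 2592) ^ 864 := by
          rw [show (1 : ℝ) + -(1 / 2592) = 2591 / 2592 by norm_num] at h3
          refine le_trans ?_ h3
          norm_num
      _ ≤ _ := by gcongr
  · have hsum := answerProb_add A hρ
    have h0 : 0 ≤
        1 / L * ∑ i, acceptProb ((basisPOVM hd i).prob ρ) N (N ^ 2 * τ / 2) :=
      mul_nonneg (by positivity) (Finset.sum_nonneg fun i _ =>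
        acceptProb_nonneg (POVM.sum_prob _ hρ) (POVM.prob_nonneg _ hρ) _)
    have h1 : ∀ i, acceptProb ((basisPOVM hd i).prob ρ) N (N ^ 2 * τ / 2) ≤
        1 - 1 / 2 * if τ ≤ ∑ z, ((basisPOVM hd i).prob ρ z - 1 / d) ^ 2
          then (1 : ℝ) else 0 := by
      intro i
      split_ifs with h
      · exact (acceptProb_basisPOVM_le hd i hρ hτ0 hdτ hN0 hNτ h).trans (by norm_num)
      · simpa using acceptProb_le_one (POVM.sum_prob _ hρ) (POVM.prob_nonneg _ hρ) _
    have h2 : 1 / L * ∑ i, acceptProb ((basisPOVM hd i).prob ρ) N (N ^ 2 * τ / 2) ≤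
        1 - 1 / 432 := by
      have h3 := Finset.sum_le_sum fun i (_ : i ∈ Finset.univ) => h1 i
      have h4 := card_basisPOVM_ge hd hε hρ hfar
      rw [Finset.sum_sub_distrib, ← Finset.mul_sum, Finset.sum_const, Finset.card_univ,
        nsmul_eq_mul, mul_one] at h3
      rw [one_div_mul_eq_div, div_le_iff₀ hL']
      refine h3.trans ?_
      rw [hL]
      linarith
    have h5 : (1 - 1 / 432 : ℝ) ^ 864 ≤ 1 / 3 := by
      have h6 : (1 - 1 / 432 : ℝ) ≤ Real.exp (-(1 / 432)) := Real.one_sub_le_exp_neg _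
      calc (1 - 1 / 432 : ℝ) ^ 864 ≤ Real.exp (-(1 / 432)) ^ 864 := by gcongr
        _ = Real.exp (-2) := by rw [← Real.exp_nat_mul]; norm_num
        _ ≤ 1 / 3 := by
          rw [Real.exp_neg, one_div]
          gcongr
          linarith [Real.add_one_le_exp 2]
    have h7 := (pow_le_pow_left₀ h0 h2 864).trans h5
    rw [hA' ρ hρ] at hsum
    linarith

end MixednessTesting

/-! ### The two bounds combined -/

theorem mainTheorem1 :
    ∃ c C : ℝ, 0 < c ∧ 0 < C ∧ ∃ d₀ : ℕ, ∀ d : ℕ, d₀ ≤ d → ∀ ε : ℝ, 0 < ε → ε ≤ 1 / 12 →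
      (∀ (n : ℕ) (A : MixednessTesting.IncoherentAlgorithm d n), A.TestsMixedness ε →
        c * ((d : ℝ) ^ (3 / 2 : ℝ) / ε ^ 2) ≤ (n : ℝ)) ∧
      (∃ n : ℕ, (n : ℝ) ≤ C * ((d : ℝ) ^ (3 / 2 : ℝ) / ε ^ 2) ∧
        ∃ A : MixednessTesting.IncoherentAlgorithm d n, A.TestsMixedness ε) := by
  refine ⟨1 / 10 ^ 8, 10 ^ 7, by norm_num, by norm_num, 1000, fun d hd ε hε hε' => ?_⟩
  have h : (d : ℝ) ^ (3 / 2 : ℝ) = √(d : ℝ) ^ 3 := by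
    rw [Real.sqrt_eq_rpow, ← Real.rpow_natCast, ← Real.rpow_mul (by positivity)]
    norm_num
  rw [h]
  refine ⟨fun n A hA => ?_, ?_⟩
  · rw [mul_div_assoc', div_le_iff₀ (by positivity)]
    exact MixednessTesting.lower_bound hd hε hε' A hA
  · obtain ⟨n, hn, A, hA⟩ := MixednessTesting.upper_bound (d := d) (by omega) hε hε'
    exact ⟨n, by rwa [mul_div_assoc', le_div_iff₀ (by positivity)], A, hA⟩
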